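/- **Setting.** Let $\mathfrak h=L^2(\mathbb R^3)$ and let $\mathcal F=\bigoplus_{n\ge 0}S_n(\mathfrak h^{\otimes n})$ be the bosonic Fock space over $\mathfrak h$, with vacuum $\Omega$; its vectors are sequences $(\psi_n)_{n\ge0}$ of totally symmetric functions $\psi_n(k_1,\dots,k_n)$. Let $a^*(g)$ be the (closed) creation operator, $a^*(g)\psi_n=\sqrt{n+1}\,S_{n+1}(g\otimes\psi_n)$, and $a(g)=a^*(g)^*$ the annihilation operator. Let $\omega(k)=|k|$, and let $H_f=d\Gamma(\omega)$ be multiplication by $|k_1|+\dots+|k_n|$ on the $n$-particle space, on its maximal domain. Let $f:\mathbb R^3\to\mathbb C$ satisfy $f/\sqrt\omega\in L^2(\mathbb R^3)$ and $f/\omega\in L^2(\mathbb R^3)$. For $\sigma>0$ let $\chi_\sigma(k)=1$ if $|k|\ge\sigma$ and $\chi_\sigma(k)=0$ otherwise, and put, on $\mathcal H=\mathbb C^2\otimes\mathcal F$, $$H_0=\begin{pmatrix}2&0\\0&0\end{pmatrix}\otimes 1+1\otimes H_f,\qquad T_\sigma=\begin{pmatrix}0&1\\1&0\end{pmatrix}\otimes\phi(\chi_\sigma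 f),\qquad H_{\lambda,\sigma}=H_0+\lambda T_\sigma\quad(\lambda\in\mathbb C),$$ where $\phi(g)=\frac1{4\pi}\bigl(a^*(g/\sqrt\omega)+a(g/\sqrt\omega)\bigr)$. Let $\Omega_\downarrow=\binom01\otimes\Omega$, let $P_{\Omega_\downarrow}$ be the orthogonal projection onto $\mathbb C\,\Omega_\downarrow$, and let $Q_\sigma$ be the orthogonal projection of $\mathcal F$ onto the vectors all of whose wave functions $\psi_n$ vanish almost everywhere where some $|k_j|<\sigma$ (the Fock space over $L^2(\{|k|\ge\sigma\})$); write $Q_\sigma$ also for $1\otimes Q_\sigma$. Put $$S_\sigma^{(0)}=-P_{\Omega_\downarrow},\qquad S_\sigma^{(\nu)}=H_0^{-\nu}\,(1-P_{\Omega_\downarrow})\,Q_\sigma\quad(\nu\ge1),$$ where $H_0^{-1}$ denotes the inverse of the restriction of $H_0$ to $\Omega_\downarrow^\perp$. **Theorem.** For every $\sigma>0$ there is $\lambda_0(\sigma)>0$ such that for all $\lambda$ in the disc $B=\{\lambda\in\mathbb C:|\lambda|<\lambda_0(\sigma)\}$ the operator $H_{\lambda,\sigma}$ has a non-degenerate eigenvalue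 $\widehat E_\sigma(\lambda)$ (one-dimensional eigenspace) with eigenprojection $\widehat P_\sigma(\lambda)$, i.e. a bounded projection onto the eigenspace that commutes with $H_{\lambda,\sigma}$, such that: (i) $\widehat E_\sigma(\lambda)$ is the bottom of the spectrum of $H_{\lambda,\sigma}$: for all $\lambda\in B$, $\operatorname{Re}\widehat E_\sigma(\lambda)=\inf\{\operatorname{Re}z: z\in\sigma(H_{\lambda,\sigma})\}$, and for real $\lambda\in B$ the spectrum is real, $\widehat E_\sigma(\lambda)$ is real and $\widehat E_\sigma(\lambda)=\inf\sigma(H_{\lambda,\sigma})$. Moreover $\widehat E_\sigma(0)=0$. (ii) $\lambda\mapsto\widehat E_\sigma(\lambda)$ and $\lambda\mapsto\widehat P_\sigma(\lambda)$ (in operator norm) are analytic on $B$. (iii) $\widehat P_\sigma(\lambda)^*=\widehat P_\sigma(\overline\lambda)$ for all $\lambda\in B$. Moreover, on $B$ there is a norm-convergent expansion $\widehat P_\sigma(\lambda)=\sum_{n=0}^\infty\widehat P_\sigma^{(n)}\lambda^n$ with $$\widehat P_\sigma^{(n)}=(-1)^{n+1}\sum_{\substack{\nu_1+\dots+\nu_{n+1}=n\\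 \nu_i\ge0}}S_\sigma^{(\nu_1)}\,T_\sigma\,S_\sigma^{(\nu_2)}\,T_\sigma\cdots T_\sigma\,S_\sigma^{(\nu_{n+1})},$$ where the products on the right are everywhere defined. -/

import Mathlib

open MeasureTheory

noncomputable section

namespace SpinBoson

/-! ## Unbounded operators

An unbounded operator in `X` is a partially defined linear map `X →ₗ.[ℂ] X`. Sums have the
intersection of the domains as domain (Mathlib's convention), products the natural domain below. -/

section Unbounded

variable {X : Type*} [NormedAddCommGroup X] [NormedSpace ℂ X]

/-- The product `A B`, with domain `{x ∈ D(B) | B x ∈ D(A)}`. -/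
def pcomp (A B : X →ₗ.[ℂ] X) : X →ₗ.[ℂ] X :=
  A.comp (B.domRestrict ((A.domain.comap B.toFun).map B.domain.subtype)) (by
    rintro ⟨x, hx⟩
    obtain ⟨⟨y, hy, rfl⟩, h2⟩ := hx
    exact hy)

/-- A bounded operator as an everywhere defined partial linear map. -/
def everywhere (A : X →L[ℂ] X) : X →ₗ.[ℂ] X := (A : X →ₗ[ℂ] X).toPMap ⊤

/-- The power `A ^ ν` of an unbounded operator, with its natural domain. -/
def ppow (A : X →ₗ.[ℂ] X) : ℕ → (X →ₗ.[ℂ] X)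
  | 0 => everywhere (ContinuousLinearMap.id ℂ X)
  | ν + 1 => pcomp A (ppow A ν)

/-- `z` is in the resolvent set of `A` if `A - z` maps `D(A)` bijectively onto the whole space
with a bounded inverse. -/
def resolventSet (A : X →ₗ.[ℂ] X) : Set ℂ :=
  {z | ∃ R : X →L[ℂ] X,
    (∀ x : X, ∃ h : R x ∈ A.domain, A ⟨R x, h⟩ - z • R x = x) ∧
    (∀ x : A.domain, R (A x - z • (x : X)) = x)}

/-- The spectrum of an unbounded operator. -/
def spectrum (A : X →ₗ.[ℂ] X) : Set ℂ := (resolventSet A)ᶜ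

/-- The eigenspace `ker (A - z)`. -/
def eigenspace (A : X →ₗ.[ℂ] X) (z : ℂ) : Submodule ℂ X where
  carrier := {x | ∃ h : x ∈ A.domain, A ⟨x, h⟩ = z • x}
  zero_mem' := ⟨A.domain.zero_mem, by
    rw [smul_zero]; exact A.map_zero⟩
  add_mem' := by
    rintro x y ⟨hx, ex⟩ ⟨hy, ey⟩
    refine ⟨A.domain.add_mem hx hy, ?_⟩
    rw [smul_add, ← ex, ← ey]
    exact A.map_add ⟨x, hx⟩ ⟨y, hy⟩
  smul_mem' := by
    rintro c x ⟨hx, ex⟩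
    refine ⟨A.domain.smul_mem c hx, ?_⟩
    rw [smul_comm, ← ex]
    exact A.map_smul c ⟨x, hx⟩

/-- `z` is a non-degenerate eigenvalue of `A`: the eigenspace is one-dimensional. -/
def IsNondegenerateEigenvalue (A : X →ₗ.[ℂ] X) (z : ℂ) : Prop :=
  Module.finrank ℂ (eigenspace A z) = 1

/-- `P` is an eigenprojection of `A` for the eigenvalue `z`: a bounded (not necessarily orthogonal)
projection onto the eigenspace which commutes with `A`, i.e. `P A ⊆ A P`. -/
def IsEigenprojection (A : X →ₗ.[ℂ] X) (z : ℂ) (P : X →L[ℂ] X) : Prop :=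
  P ∘L P = P ∧
  LinearMap.range (P : X →ₗ[ℂ] X) = eigenspace A z ∧
  ∀ x : A.domain, ∃ h : P x ∈ A.domain, A ⟨P x, h⟩ = P (A x)

end Unbounded

/-! ## Bosonic Fock space over `L²(ℝ³)` -/

/-- Momentum space `ℝ³`. -/
abbrev E3 := EuclideanSpace ℝ (Fin 3)

/-- Momenta `(k₁, …, kₙ)` of `n` particles. -/
abbrev Conf (n : ℕ) := Fin n → E3

theorem measurePreserving_perm (n : ℕ) (π : Equiv.Perm (Fin n)) :
    MeasurePreserving (fun k : Conf n => fun i => k (π i)) volume volume := by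
  convert volume_measurePreserving_piCongrLeft (fun _ : Fin n => E3) π.symm using 1
  ext k i : 2
  have h := MeasurableEquiv.piCongrLeft_apply_apply (β := fun _ : Fin n => E3) π.symm k (π i)
  rw [Equiv.symm_apply_apply] at h
  exact h.symm

/-- The action `ψ(k₁, …, kₙ) ↦ ψ(k_{π 1}, …, k_{π n})` on `L²((ℝ³)ⁿ)`. -/
def permute (n : ℕ) (π : Equiv.Perm (Fin n)) :
    Lp ℂ 2 (volume : Measure (Conf n)) →ₗᵢ[ℂ] Lp ℂ 2 (volume : Measure (Conf n)) :=
  Lp.compMeasurePreservingₗᵢ ℂ (fun k : Conf n => fun i => k (π i)) (measurePreserving_perm n π)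

/-- The `n`-particle space: totally symmetric functions in `L²((ℝ³)ⁿ)`. For `n = 0` the
configuration space is a point of mass one, so that this is a copy of `ℂ`. -/
def SymL2 (n : ℕ) : Submodule ℂ (Lp ℂ 2 (volume : Measure (Conf n))) where
  carrier := {ψ | ∀ π : Equiv.Perm (Fin n), permute n π ψ = ψ}
  zero_mem' := fun π => map_zero _
  add_mem' := fun ha hb π => by rw [map_add, ha π, hb π]
  smul_mem' := fun c x hx π => by rw [map_smul, hx π]

theorem isClosed_symL2 (n : ℕ) : IsClosed (SymL2 n : Set (Lp ℂ 2 (volume : Measure (Conf n)))) := by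
  have : (SymL2 n : Set (Lp ℂ 2 (volume : Measure (Conf n)))) =
      ⋂ π : Equiv.Perm (Fin n), {ψ | permute n π ψ = ψ} := by
    ext ψ
    simp only [Set.mem_iInter]
    rfl
  rw [this]
  exact isClosed_iInter fun π => isClosed_eq (permute n π).continuous continuous_id

instance (n : ℕ) : CompleteSpace (SymL2 n) := (isClosed_symL2 n).completeSpace_coe

/-- The bosonic Fock space `𝓕`: the Hilbert direct sum of the `n`-particle spaces. -/
def Fock : Type := lp (fun n : ℕ => SymL2 n) 2

instance : NormedAddCommGroup Fock :=
  inferInstanceAs (NormedAddCommGroup (lp (fun n : ℕ => SymL2 n) 2))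

instance : InnerProductSpace ℂ Fock :=
  inferInstanceAs (InnerProductSpace ℂ (lp (fun n : ℕ => SymL2 n) 2))

instance : CompleteSpace Fock :=
  inferInstanceAs (CompleteSpace (lp (fun n : ℕ => SymL2 n) 2))

/-- The `n`-particle component of `ψ ∈ 𝓕`. -/
def component (ψ : Fock) (n : ℕ) : SymL2 n := (show lp (fun n : ℕ => SymL2 n) 2 from ψ) n

theorem component_add (ψ φ : Fock) (n : ℕ) :
    component (ψ + φ) n = component ψ n + component φ n := rfl

theorem component_smul (c : ℂ) (ψ : Fock) (n : ℕ) :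
    component (c • ψ) n = c • component ψ n := rfl

theorem component_zero (n : ℕ) : component 0 n = 0 := rfl

theorem continuous_component (n : ℕ) : Continuous fun ψ : Fock => component ψ n := by
  refine (LipschitzWith.of_dist_le_mul (K := 1) fun ψ φ => ?_).continuous
  rw [NNReal.coe_one, one_mul, dist_eq_norm, dist_eq_norm]
  exact lp.norm_apply_le_norm (by norm_num)
    (show lp (fun n : ℕ => SymL2 n) 2 from (ψ - φ : Fock)) n

/-- The `n`-particle wave function `ψₙ(k₁, …, kₙ)` of `ψ ∈ 𝓕`. -/
def wf (ψ : Fock) (n : ℕ) : Conf n → ℂ :=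
  (component ψ n : Lp ℂ 2 (volume : Measure (Conf n)))

theorem wf_add (ψ φ : Fock) (n : ℕ) :
    wf (ψ + φ) n =ᵐ[volume] fun k => wf ψ n k + wf φ n k := by
  unfold wf
  rw [component_add, Submodule.coe_add]
  exact Lp.coeFn_add _ _

theorem wf_smul (c : ℂ) (ψ : Fock) (n : ℕ) :
    wf (c • ψ) n =ᵐ[volume] fun k => c * wf ψ n k := by
  unfold wf
  rw [component_smul, Submodule.coe_smul]
  exact Lp.coeFn_smul _ _

theorem wf_zero (n : ℕ) : wf 0 n =ᵐ[volume] fun _ => 0 := by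
  unfold wf
  rw [component_zero, Submodule.coe_zero]
  exact Lp.coeFn_zero _ _ _

theorem fock_ext {ψ φ : Fock} (h : ∀ n, wf ψ n =ᵐ[volume] wf φ n) : ψ = φ :=
  lp.ext (funext fun n => Subtype.ext (Lp.ext (h n)))

/-- The vacuum `Ω = (1, 0, 0, …)`. -/
def vacuum : Fock :=
  lp.single (E := fun n : ℕ => SymL2 n) 2 0 ⟨indicatorConstLp 2 (MeasurableSet.univ (α := Conf 0))
    (by simp [volume_pi]) (1 : ℂ), fun π => by
      obtain rfl : π = 1 := Subsingleton.elim _ _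
      refine Lp.ext ?_
      exact Lp.coeFn_compMeasurePreserving _ (measurePreserving_perm 0 1)⟩

/-! ## Second quantization, creation and annihilation operators -/

/-- The graph of `dΓ(h)`: pairs `(ψ, η)` with `ηₙ(k₁, …, kₙ) = ∑ⱼ h(kⱼ) ψₙ(k₁, …, kₙ)`. -/
def dGammaGraph (h : E3 → ℂ) : Submodule ℂ (Fock × Fock) where
  carrier := {p | ∀ n, wf p.2 n =ᵐ[volume] fun k => (∑ j, h (k j)) * wf p.1 n k}
  zero_mem' := fun n => by
    filter_upwards [wf_zero n] with k hk
    simp only [Prod.fst_zero, Prod.snd_zero, hk, mul_zero]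
  add_mem' := by
    intro a b ha hb n
    filter_upwards [ha n, hb n, wf_add a.1 b.1 n, wf_add a.2 b.2 n] with k h1 h2 h3 h4
    simp only [Prod.fst_add, Prod.snd_add, h1, h2, h3, h4, mul_add]
  smul_mem' := by
    intro c a ha n
    filter_upwards [ha n, wf_smul c a.1 n, wf_smul c a.2 n] with k h1 h2 h3
    simp only [Prod.smul_fst, Prod.smul_snd, h1, h2, h3]
    ring

/-- `dΓ(h)`, with domain all `ψ ∈ 𝓕` such that `dΓ(h) ψ ∈ 𝓕`. -/
def dGamma (h : E3 → ℂ) : Fock →ₗ.[ℂ] Fock := (dGammaGraph h).toLinearPMap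

theorem mem_graph_dGamma (h : E3 → ℂ) (p : Fock × Fock) :
    p ∈ (dGamma h).graph ↔
      ∀ n, wf p.2 n =ᵐ[volume] fun k => (∑ j, h (k j)) * wf p.1 n k := by
  rw [dGamma, Submodule.toLinearPMap_graph_eq]
  · rfl
  · rintro ⟨x, y⟩ hx (rfl : x = 0)
    refine fock_ext fun n => ?_
    filter_upwards [hx n, wf_zero n] with k h1 h2
    rw [h1, h2, mul_zero]

/-- The free field Hamiltonian `H_f = dΓ(ω)`, `ω(k) = |k|`. -/
def Hf : Fock →ₗ.[ℂ] Fock := dGamma fun k => (‖k‖ : ℂ)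

theorem quasiMeasurePreserving_remove (n : ℕ) (j : Fin (n + 1)) :
    Measure.QuasiMeasurePreserving (fun k : Conf (n + 1) => fun i => k (j.succAbove i))
      volume volume :=
  Measure.quasiMeasurePreserving_snd.comp
    (volume_preserving_piFinSuccAbove (fun _ : Fin (n + 1) => E3) j).quasiMeasurePreserving

/-- The graph of `a*(g)`: pairs `(ψ, η)` with `η₀ = 0` and `ηₙ₊₁ = √(n+1) Sₙ₊₁ (g ⊗ ψₙ)`. As `ψₙ` is
symmetric, the latter is `(n+1)^(-1/2) ∑ⱼ g(kⱼ) ψₙ(k₀, …, kⱼ₋₁, kⱼ₊₁, …, kₙ)`. -/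
def creationGraph (g : E3 → ℂ) : Submodule ℂ (Fock × Fock) where
  carrier := {p | wf p.2 0 =ᵐ[volume] (fun _ => 0) ∧
    ∀ n, wf p.2 (n + 1) =ᵐ[volume] fun k =>
      ((Real.sqrt (n + 1) : ℝ) : ℂ)⁻¹ *
        ∑ j : Fin (n + 1), g (k j) * wf p.1 n (fun i => k (j.succAbove i))}
  zero_mem' := by
    refine ⟨wf_zero 0, fun n => ?_⟩
    have := ae_all_iff.2 fun j : Fin (n + 1) => (quasiMeasurePreserving_remove n j).ae (wf_zero n)
    filter_upwards [wf_zero (n + 1), this] with k h1 h2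
    simp only [Prod.fst_zero, Prod.snd_zero, h1, h2, mul_zero, Finset.sum_const_zero]
  add_mem' := by
    intro a b ha hb
    refine ⟨?_, fun n => ?_⟩
    · filter_upwards [ha.1, hb.1, wf_add a.2 b.2 0] with k h1 h2 h3
      simp only [Prod.snd_add, h1, h2, h3, add_zero]
    · have := ae_all_iff.2 fun j : Fin (n + 1) =>
        (quasiMeasurePreserving_remove n j).ae (wf_add a.1 b.1 n)
      filter_upwards [ha.2 n, hb.2 n, wf_add a.2 b.2 (n + 1), this] with k h1 h2 h3 h4
      simp only [Prod.fst_add, Prod.snd_add, h1, h2, h3, h4, mul_add, Finset.sum_add_distrib]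
  smul_mem' := by
    intro c a ha
    refine ⟨?_, fun n => ?_⟩
    · filter_upwards [ha.1, wf_smul c a.2 0] with k h1 h2
      simp only [Prod.smul_snd, h1, h2, mul_zero]
    · have := ae_all_iff.2 fun j : Fin (n + 1) =>
        (quasiMeasurePreserving_remove n j).ae (wf_smul c a.1 n)
      filter_upwards [ha.2 n, wf_smul c a.2 (n + 1), this] with k h1 h2 h3
      simp only [Prod.smul_fst, Prod.smul_snd, h1, h2, h3, Finset.mul_sum]
      exact Finset.sum_congr rfl fun j _ => by ring

/-- The creation operator `a*(g)`, with domain all `ψ` for which the sequence `a*(g) ψ` is in `𝓕`.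
For `g ∈ L²(ℝ³)` each block `ψₙ ↦ √(n+1) Sₙ₊₁ (g ⊗ ψₙ)` is bounded, so this is the closure of
`a*(g)` on the vectors with finitely many particles (truncate `ψ` in the particle number). -/
def creation (g : E3 → ℂ) : Fock →ₗ.[ℂ] Fock := (creationGraph g).toLinearPMap

theorem mem_graph_creation (g : E3 → ℂ) (p : Fock × Fock) :
    p ∈ (creation g).graph ↔ wf p.2 0 =ᵐ[volume] (fun _ => 0) ∧
      ∀ n, wf p.2 (n + 1) =ᵐ[volume] fun k =>
        ((Real.sqrt (n + 1) : ℝ) : ℂ)⁻¹ *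
          ∑ j : Fin (n + 1), g (k j) * wf p.1 n (fun i => k (j.succAbove i)) := by
  rw [creation, Submodule.toLinearPMap_graph_eq]
  · rfl
  · rintro ⟨x, y⟩ hx (rfl : x = 0)
    refine fock_ext fun n => ?_
    cases n with
    | zero => exact hx.1.trans (wf_zero 0).symm
    | succ n =>
      have := ae_all_iff.2 fun j : Fin (n + 1) => (quasiMeasurePreserving_remove n j).ae (wf_zero n)
      filter_upwards [hx.2 n, wf_zero (n + 1), this] with k h1 h2 h3
      simp only [h1, h2, h3, mul_zero, Finset.sum_const_zero]

/-- The annihilation operator `a(g)`, the adjoint of `a*(g)`. -/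
def annihilation (g : E3 → ℂ) : Fock →ₗ.[ℂ] Fock := (creation g).adjoint

/-- The field operator `φ(f) = (4π)⁻¹ (a*(f/√ω) + a(f/√ω))`. -/
def field (f : E3 → ℂ) : Fock →ₗ.[ℂ] Fock :=
  ((4 * Real.pi : ℝ) : ℂ)⁻¹ •
    (creation (fun k => f k / (Real.sqrt ‖k‖ : ℂ)) +
      annihilation (fun k => f k / (Real.sqrt ‖k‖ : ℂ)))

/-! ## The spin-boson Hamiltonian -/

/-- The Hilbert space `ℂ² ⊗ 𝓕`, written as the Hilbert sum `𝓕 ⊕ 𝓕`. -/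
abbrev SpinFock := PiLp 2 (fun _ : Fin 2 => Fock)

/-- The operator `M ⊗ A` on `ℂ² ⊗ D(A)`: its components are `((M ⊗ A) ψ)ᵢ = ∑ⱼ Mᵢⱼ A ψⱼ`. -/
def spinTensor (M : Matrix (Fin 2) (Fin 2) ℂ) (A : Fock →ₗ.[ℂ] Fock) :
    SpinFock →ₗ.[ℂ] SpinFock where
  domain :=
    { carrier := {ψ | ∀ j, ψ j ∈ A.domain}
      zero_mem' := fun _ => A.domain.zero_mem
      add_mem' := fun ha hb j => A.domain.add_mem (ha j) (hb j)
      smul_mem' := fun c _ ha j => A.domain.smul_mem c (ha j) }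
  toFun :=
    { toFun := fun ψ => WithLp.toLp 2 fun i => ∑ j, M i j • A ⟨(ψ : SpinFock) j, ψ.2 j⟩
      map_add' := fun ψ φ => by
        ext1 i
        have h : ∀ j, A ⟨((ψ + φ : _) : SpinFock) j, (ψ + φ).2 j⟩ =
            A ⟨(ψ : SpinFock) j, ψ.2 j⟩ + A ⟨(φ : SpinFock) j, φ.2 j⟩ := fun j =>
          A.map_add ⟨(ψ : SpinFock) j, ψ.2 j⟩ ⟨(φ : SpinFock) j, φ.2 j⟩
        simp only [h, PiLp.add_apply, smul_add, Finset.sum_add_distrib]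
      map_smul' := fun c ψ => by
        ext1 i
        have h : ∀ j, A ⟨((c • ψ : _) : SpinFock) j, (c • ψ).2 j⟩ =
            c • A ⟨(ψ : SpinFock) j, ψ.2 j⟩ := fun j =>
          A.map_smul c ⟨(ψ : SpinFock) j, ψ.2 j⟩
        simp only [h, PiLp.smul_apply, Finset.smul_sum, RingHom.id_apply]
        exact Finset.sum_congr rfl fun j _ => smul_comm _ _ _ }

/-- The identity of `𝓕`. -/
def idFock : Fock →ₗ.[ℂ] Fock := everywhere (ContinuousLinearMap.id ℂ Fock)

/-- `H₀ = τ ⊗ 1 + 1 ⊗ H_f` with `τ = diag(2, 0)`. -/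
def H0 : SpinFock →ₗ.[ℂ] SpinFock := spinTensor !![2, 0; 0, 0] idFock + spinTensor 1 Hf

open Classical in
/-- The infrared cutoff `χ_σ f`, where `χ_σ(k) = 1` if `|k| ≥ σ` and `0` otherwise. -/
def cutoff (σ : ℝ) (f : E3 → ℂ) : E3 → ℂ := fun k => if σ ≤ ‖k‖ then f k else 0

/-- `T_σ = σ_x ⊗ φ(χ_σ f)`. -/
def Tint (f : E3 → ℂ) (σ : ℝ) : SpinFock →ₗ.[ℂ] SpinFock :=
  spinTensor !![0, 1; 1, 0] (field (cutoff σ f))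

/-- The infrared regularized Hamiltonian `H_{λ,σ} = H₀ + λ T_σ`. -/
def Hreg (f : E3 → ℂ) (σ : ℝ) (lam : ℂ) : SpinFock →ₗ.[ℂ] SpinFock := H0 + lam • Tint f σ

/-! ## The reduced resolvents and the Rayleigh–Schrödinger terms -/

/-- `Ω_↓ = (0, 1) ⊗ Ω`. -/
def vacuumDown : SpinFock := WithLp.toLp 2 ![0, vacuum]

/-- The orthogonal projection onto `ℂ Ω_↓`. -/
def PDown : SpinFock →L[ℂ] SpinFock := (ℂ ∙ vacuumDown).starProjection

/-- The natural embedding of the Fock space over `L²({|k| ≥ σ})` into `𝓕`: all `ψ` whose wave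
functions vanish if one of the momenta satisfies `|kⱼ| < σ`. -/
def highFock (σ : ℝ) : Submodule ℂ Fock where
  carrier := {ψ | ∀ n, ∀ᵐ k : Conf n, (∃ j, ‖k j‖ < σ) → wf ψ n k = 0}
  zero_mem' := fun n => by
    filter_upwards [wf_zero n] with k hk _ using hk
  add_mem' := fun {a b} ha hb n => by
    filter_upwards [ha n, hb n, wf_add a b n] with k h1 h2 h3 h
    rw [h3, h1 h, h2 h, add_zero]
  smul_mem' := fun c a ha n => by
    filter_upwards [ha n, wf_smul c a n] with k h1 h2 h
    rw [h2, h1 h, mul_zero]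

theorem isClosed_highFock (σ : ℝ) : IsClosed (highFock σ : Set Fock) := by
  have hB : ∀ n, MeasurableSet {k : Conf n | ∃ j, ‖k j‖ < σ} := fun n => by
    have : {k : Conf n | ∃ j, ‖k j‖ < σ} = ⋃ j, {k : Conf n | ‖k j‖ < σ} := by
      ext k; simp
    rw [this]
    exact MeasurableSet.iUnion fun j =>
      measurableSet_lt (measurable_pi_apply j).norm measurable_const
  have : (highFock σ : Set Fock) = ⋂ n : ℕ, {ψ : Fock |
      LpToLpRestrictCLM (Conf n) ℂ ℂ volume 2 {k : Conf n | ∃ j, ‖k j‖ < σ}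
        (component ψ n : Lp ℂ 2 (volume : Measure (Conf n))) = 0} := by
    ext ψ
    simp only [Set.mem_iInter]
    refine forall_congr' fun n => ?_
    have h1 := LpToLpRestrictCLM_coeFn ℂ {k : Conf n | ∃ j, ‖k j‖ < σ}
      (component ψ n : Lp ℂ 2 (volume : Measure (Conf n)))
    have h2 : (∀ᵐ k : Conf n, (∃ j, ‖k j‖ < σ) → wf ψ n k = 0) ↔
        ∀ᵐ k : Conf n ∂(volume.restrict {k : Conf n | ∃ j, ‖k j‖ < σ}), wf ψ n k = 0 :=
      (ae_restrict_iff' (hB n)).symm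
    rw [h2]
    constructor
    · intro h
      refine Lp.ext ?_
      filter_upwards [h, h1, Lp.coeFn_zero ℂ 2 (volume.restrict {k : Conf n | ∃ j, ‖k j‖ < σ})]
        with k a b c
      rw [b, c]
      exact a
    · intro h
      have h' : LpToLpRestrictCLM (Conf n) ℂ ℂ volume 2 {k : Conf n | ∃ j, ‖k j‖ < σ}
        (component ψ n : Lp ℂ 2 (volume : Measure (Conf n))) = 0 := h
      rw [h'] at h1
      filter_upwards [h1, Lp.coeFn_zero ℂ 2 (volume.restrict {k : Conf n | ∃ j, ‖k j‖ < σ})]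
        with k b c
      exact b.symm.trans c
  rw [this]
  refine isClosed_iInter fun n => isClosed_eq ?_ continuous_const
  exact (ContinuousLinearMap.continuous _).comp
    (continuous_subtype_val.comp (continuous_component n))

instance (σ : ℝ) : CompleteSpace (highFock σ) := (isClosed_highFock σ).completeSpace_coe

/-- `1 ⊗ Q_σ`, where `Q_σ` is the orthogonal projection of `𝓕` onto `highFock σ`. -/
def Qσ (σ : ℝ) : SpinFock →ₗ.[ℂ] SpinFock := spinTensor 1 (everywhere (highFock σ).starProjection)

/-- The inverse of the restriction of `H₀` to the orthogonal complement of its ground state. -/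
def H0inv : SpinFock →ₗ.[ℂ] SpinFock := (H0.domRestrict (ℂ ∙ vacuumDown)ᗮ).inverse

/-- `S_σ^{(0)} = -P_{Ω_↓}` and `S_σ^{(ν)} = H₀^{-ν} (1 - P_{Ω_↓}) Q_σ` for `ν ≥ 1`. -/
def reducedResolvent (σ : ℝ) : ℕ → (SpinFock →ₗ.[ℂ] SpinFock)
  | 0 => everywhere (-PDown)
  | ν + 1 => pcomp (ppow H0inv (ν + 1))
      (pcomp (everywhere (ContinuousLinearMap.id ℂ SpinFock - PDown)) (Qσ σ))

/-- The product `S_σ^{(ν₁)} T_σ S_σ^{(ν₂)} ⋯ T_σ S_σ^{(νₙ₊₁)}` of unbounded operators. -/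
def rsTerm (f : E3 → ℂ) (σ : ℝ) : (n : ℕ) → (Fin (n + 1) → ℕ) → (SpinFock →ₗ.[ℂ] SpinFock)
  | 0, ν => reducedResolvent σ (ν 0)
  | n + 1, ν => pcomp (reducedResolvent σ (ν 0)) (pcomp (Tint f σ) (rsTerm f σ n (Fin.tail ν)))

/-- `(-1)^(n+1) ∑ S_σ^{(ν₁)} T_σ S_σ^{(ν₂)} ⋯ T_σ S_σ^{(νₙ₊₁)}`, the sum being over all
`ν₁, …, νₙ₊₁ ≥ 0` with `ν₁ + ⋯ + νₙ₊₁ = n`. -/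
def rsCoefficient (f : E3 → ℂ) (σ : ℝ) (n : ℕ) : SpinFock →ₗ.[ℂ] SpinFock :=
  ((-1 : ℂ) ^ (n + 1)) • ∑ ν ∈ Finset.Nat.antidiagonalTuple (n + 1) n, rsTerm f σ n ν

end SpinBoson

end

/-!
# The spin-boson model with an infrared cutoff: analytic perturbation theory of the ground state

Let `Q` be the projection onto the states without soft particles, that is, with all momenta of
absolute value at least `σ`. On the range of `Q` the free Hamiltonian `H₀` has the simple eigenvalue
`0` with eigenvector `Ω_↓`, and no other spectrum below `c = min σ 2` (`le_energy`). As the coupling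
function vanishes on soft momenta, the interaction `T` commutes with `Q`; and as the momenta it does
see carry at least the energy `σ` each, their number is at most the energy divided by `σ`, which
makes `T (H₀ + 1)⁻¹` bounded and `T` bounded relative to the form of `H₀ + 1` (`exists_fieldRel`).
So on the range of `Q` an isolated simple eigenvalue is perturbed by a relatively bounded operator.
This situation is axiomatized by `GapData`, in terms of bounded operators only.

In that setting the resolvent `R(ζ)` of `H₀ + λ T` on the range of `Q` is given by a Neumann series
in `λ T R₀(ζ)` on an annulus around `0`, for small `λ`. The eigenprojection is the contour integral
`P = -(2πi)⁻¹ ∮ R(ζ) dζ`; it is a projection by the resolvent identity (`Admissible.P_idem`). The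
Laurent expansion of `R₀(ζ)` at `0` has the reduced resolvents `S^{(ν)}` as coefficients, and the
residue of the `n`-th term of the Neumann series is the sum over `ν₁ + ⋯ + νₙ₊₁ = n` of the products
`S^{(ν₁)} T ⋯ T S^{(νₙ₊₁)}` (`res_Y_mul_K_pow`); this is the power series of `P`
(`Admissible.hasSum_P`). Close to `λ = 0` the range of `P` is a line, on which `H₀ + λ T` is
multiplication by an analytic function `E`; on its complement the numerical range of `H₀ + λ T`
stays to the right of `c / 2` (`Small.accretive`), hence of `E`.

States with soft particles are compared with those without by pulling the particles through the
Hamiltonian. If `ψ` has `m + 1` soft particles and `a_q ψ` is the state with one particle of soft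
momentum `q` removed, then `(H + |q|) a_q ψ = a_q H ψ` (`HRel.ae_fiber`), and the integral of
`‖a_q ψ‖²` over the soft momenta is `(m + 1) ‖ψ‖²`. Therefore a lower bound for `H - z`, valid for
all `z` to the left of `E`, passes from `m` soft particles to `m + 1` (`HRel.lower_bound_sector`),
and the gain `|q| > 0` excludes soft particles in eigenvectors for `E` (`HRel.sectorOp_zero_eq`).
Since `-1` is in the resolvent set for small `λ`, the lower bound puts the half plane to the left
of `E` into the resolvent set (`subset_resolventSet`). For real `λ` the same argument applies to
the upper and the lower half plane, because `H` is symmetric.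

Unbounded operators are handled through relations between wave functions, `CreRel`, `AnnRel` and
`HRel`, and the identification of `HRel` with the graph of the Hamiltonian (`mem_Hreg_graph`) rests
on the domain of `H₀` being the range of `(H₀ + 1)⁻¹`.
-/

noncomputable section

namespace SpinBoson

open scoped ENNReal InnerProductSpace

/-! ### Wave functions -/

theorem stronglyMeasurable_wf (ψ : Fock) (n : ℕ) : StronglyMeasurable (wf ψ n) :=
  Lp.stronglyMeasurable _

theorem memLp_wf (ψ : Fock) (n : ℕ) : MemLp (wf ψ n) 2 volume := Lp.memLp _

theorem wf_perm (ψ : Fock) (n : ℕ) (π : Equiv.Perm (Fin n)) :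
    (fun k : Conf n => wf ψ n (fun i => k (π i))) =ᵐ[volume] wf ψ n := by
  have h := (component ψ n).2 π
  have h2 := Lp.coeFn_compMeasurePreserving
    (component ψ n : Lp ℂ 2 (volume : Measure (Conf n))) (measurePreserving_perm n π)
  have h3 : Lp.compMeasurePreserving (fun k : Conf n => fun i => k (π i))
      (measurePreserving_perm n π) (component ψ n : Lp ℂ 2 (volume : Measure (Conf n))) =
      (component ψ n : Lp ℂ 2 (volume : Measure (Conf n))) := h
  rw [h3] at h2
  exact h2.symm

theorem wf_neg (ψ : Fock) (n : ℕ) : wf (-ψ) n =ᵐ[volume] fun k => - wf ψ n k := by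
  filter_upwards [wf_smul (-1) ψ n] with k hk
  rw [← neg_one_smul ℂ ψ, hk, neg_one_mul]

theorem wf_sub (ψ φ : Fock) (n : ℕ) :
    wf (ψ - φ) n =ᵐ[volume] fun k => wf ψ n k - wf φ n k := by
  filter_upwards [wf_add ψ (-φ) n, wf_neg φ n] with k h1 h2
  rw [sub_eq_add_neg, h1, h2, sub_eq_add_neg]

theorem enorm_component_sq (ψ : Fock) (n : ℕ) :
    ‖component ψ n‖ₑ ^ 2 = ∫⁻ k, ‖wf ψ n k‖ₑ ^ 2 := by
  have h : ‖component ψ n‖ₑ = eLpNorm (wf ψ n) 2 volume := Lp.enorm_def _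
  rw [h, eLpNorm_eq_lintegral_rpow_enorm_toReal (by norm_num) (by norm_num),
    ← ENNReal.rpow_natCast, ← ENNReal.rpow_mul]
  norm_num

theorem hasSum_norm_component (ψ : Fock) : HasSum (fun n => ‖component ψ n‖ ^ 2) (‖ψ‖ ^ 2) := by
  have := lp.hasSum_norm (p := 2) (by norm_num) (show lp (fun n : ℕ => SymL2 n) 2 from ψ)
  have e : (2 : ℝ≥0∞).toReal = ((2 : ℕ) : ℝ) := by norm_num
  simp only [e, Real.rpow_natCast] at this
  exact this

theorem enorm_sq_eq_ofReal {V : Type*} [NormedAddCommGroup V] (x : V) :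
    ‖x‖ₑ ^ 2 = ENNReal.ofReal (‖x‖ ^ 2) := by
  rw [← ofReal_norm, ENNReal.ofReal_pow (norm_nonneg x)]

/-- The squared norm of a Fock space vector, as an extended real. -/
theorem enorm_sq_eq (ψ : Fock) : ‖ψ‖ₑ ^ 2 = ∑' n, ∫⁻ k, ‖wf ψ n k‖ₑ ^ 2 := by
  simp_rw [← enorm_component_sq, enorm_sq_eq_ofReal]
  rw [← (hasSum_norm_component ψ).tsum_eq,
    ENNReal.ofReal_tsum_of_nonneg (fun _ => by positivity) (hasSum_norm_component ψ).summable]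

/-- A square summable sequence of symmetric functions is the sequence of wave functions of a Fock
space vector. -/
theorem exists_wf_eq (F : ∀ n, Conf n → ℂ) (hm : ∀ n, AEStronglyMeasurable (F n) volume)
    (hs : ∀ n (π : Equiv.Perm (Fin n)),
      (fun k : Conf n => F n (fun i => k (π i))) =ᵐ[volume] F n)
    (hfin : ∑' n, ∫⁻ k, ‖F n k‖ₑ ^ 2 ≠ ∞) : ∃ ψ : Fock, ∀ n, wf ψ n =ᵐ[volume] F n := by
  have hL : ∀ n, MemLp (F n) 2 volume := fun n => by
    refine ⟨hm n, ?_⟩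
    rw [eLpNorm_lt_top_iff_lintegral_rpow_enorm_lt_top (by norm_num) (by norm_num)]
    have := ENNReal.ne_top_of_tsum_ne_top hfin n
    simpa using this.lt_top
  let G : ∀ n, SymL2 n := fun n => ⟨(hL n).toLp, fun π => by
    refine Lp.ext ?_
    have h2 := Lp.coeFn_compMeasurePreserving ((hL n).toLp) (measurePreserving_perm n π)
    refine h2.trans (Filter.EventuallyEq.trans ?_ ((hs n π).trans (hL n).coeFn_toLp.symm))
    exact (measurePreserving_perm n π).quasiMeasurePreserving.ae_eq_comp (hL n).coeFn_toLp⟩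
  have hG : ∀ n, ‖G n‖ₑ ^ 2 = ∫⁻ k, ‖F n k‖ₑ ^ 2 := fun n => by
    have h : ‖G n‖ₑ = eLpNorm (F n) 2 volume := by
      rw [← Lp.enorm_toLp (hL n)]; rfl
    rw [h, eLpNorm_eq_lintegral_rpow_enorm_toReal (by norm_num) (by norm_num),
      ← ENNReal.rpow_natCast, ← ENNReal.rpow_mul]
    norm_num
  have hmem : Memℓp G 2 := by
    refine memℓp_gen ?_
    have e : (2 : ℝ≥0∞).toReal = ((2 : ℕ) : ℝ) := by norm_num
    simp only [e, Real.rpow_natCast]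
    simp_rw [← hG, enorm_sq_eq_ofReal] at hfin
    have := ENNReal.summable_toReal hfin
    simpa [ENNReal.toReal_ofReal] using this
  refine ⟨(⟨G, hmem⟩ : lp (fun n : ℕ => SymL2 n) 2), fun n => (hL n).coeFn_toLp⟩

theorem hasSum_inner_component (ψ φ : Fock) :
    HasSum (fun n => ∫ k, inner ℂ (wf ψ n k) (wf φ n k)) (inner ℂ ψ φ) :=
  lp.hasSum_inner (𝕜 := ℂ) (show lp (fun n : ℕ => SymL2 n) 2 from ψ)
    (show lp (fun n : ℕ => SymL2 n) 2 from φ)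

theorem integrable_inner_wf (ψ φ : Fock) (n : ℕ) :
    Integrable (fun k => inner ℂ (wf ψ n k) (wf φ n k)) volume :=
  L2.integrable_inner _ _

/-- A pointwise lower bound on `Re (ψ̄ φ)` by a weight gives a lower bound on `Re ⟪ψ, φ⟫`. -/
theorem lintegral_weight_le_re_inner (ψ φ : Fock) (w : ∀ n, Conf n → ℝ) (hw : ∀ n k, 0 ≤ w n k)
    (h : ∀ n, ∀ᵐ k, w n k * ‖wf ψ n k‖ ^ 2 ≤ (inner ℂ (wf ψ n k) (wf φ n k)).re) :
    ∑' n, ∫⁻ k, ENNReal.ofReal (w n k) * ‖wf ψ n k‖ₑ ^ 2 ≤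
      ENNReal.ofReal (inner ℂ ψ φ).re := by
  have hS : HasSum (fun n => ∫ k, (inner ℂ (wf ψ n k) (wf φ n k)).re) (inner ℂ ψ φ).re := by
    have := Complex.reCLM.hasSum (hasSum_inner_component ψ φ)
    simp only [Complex.reCLM_apply] at this
    convert this using 2 with n
    exact integral_re (integrable_inner_wf ψ φ n)
  have h0 : ∀ n, ∀ᵐ k, 0 ≤ (inner ℂ (wf ψ n k) (wf φ n k)).re := fun n => by
    filter_upwards [h n] with k hk
    exact le_trans (mul_nonneg (hw n k) (by positivity)) hk
  rw [← hS.tsum_eq, ENNReal.ofReal_tsum_of_nonneg (fun n => integral_nonneg_of_ae (h0 n))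
    hS.summable]
  refine ENNReal.tsum_le_tsum fun n => ?_
  have hi : Integrable (fun k => (inner ℂ (wf ψ n k) (wf φ n k)).re) volume :=
    (integrable_inner_wf ψ φ n).re
  rw [ofReal_integral_eq_lintegral_ofReal hi (h0 n)]
  refine lintegral_mono_ae ?_
  filter_upwards [h n] with k hk
  rw [enorm_sq_eq_ofReal, ← ENNReal.ofReal_mul (hw n k)]
  exact ENNReal.ofReal_le_ofReal hk

/-! ### Multiplication operators -/

/-- A symbol: a bounded sequence of measurable symmetric functions of the momenta. -/
structure Symbol where
  /-- The function of the momenta of `n` particles. -/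
  fn : ∀ n, Conf n → ℂ
  meas : ∀ n, Measurable (fn n)
  symm : ∀ n (π : Equiv.Perm (Fin n)) (k : Conf n), fn n (fun i => k (π i)) = fn n k
  bound : ∃ C : ℝ, 0 ≤ C ∧ ∀ n k, ‖fn n k‖ ≤ C

theorem lintegral_mul_wf_le (m : ∀ n, Conf n → ℂ) {C : ℝ}
    (hb : ∀ n k, ‖m n k‖ ≤ C) (ψ : Fock) :
    ∑' n, ∫⁻ k, ‖m n k * wf ψ n k‖ₑ ^ 2 ≤ ENNReal.ofReal C ^ 2 * ‖ψ‖ₑ ^ 2 := by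
  rw [enorm_sq_eq, ← ENNReal.tsum_mul_left]
  refine ENNReal.tsum_le_tsum fun n => ?_
  rw [← lintegral_const_mul _ ((stronglyMeasurable_wf ψ n).measurable.enorm.pow_const 2)]
  refine lintegral_mono fun k => ?_
  rw [enorm_mul, mul_pow]
  gcongr
  rw [← ofReal_norm]
  exact ENNReal.ofReal_le_ofReal (hb n k)

theorem exists_mulOp (s : Symbol) (ψ : Fock) :
    ∃ η : Fock, ∀ n, wf η n =ᵐ[volume] fun k => s.fn n k * wf ψ n k := by
  obtain ⟨C, hC, hb⟩ := s.bound
  refine exists_wf_eq _ (fun n => ((s.meas n).aestronglyMeasurable).mul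
    (stronglyMeasurable_wf ψ n).aestronglyMeasurable) (fun n π => ?_)
    (ne_top_of_le_ne_top ?_ (lintegral_mul_wf_le s.fn hb ψ))
  · filter_upwards [wf_perm ψ n π] with k hk
    rw [s.symm, hk]
  · exact ENNReal.mul_ne_top (by simp) (by simp)

theorem norm_le_of_wf_eq_mul (m : ∀ n, Conf n → ℂ) {C : ℝ} (hC : 0 ≤ C)
    (hb : ∀ n k, ‖m n k‖ ≤ C) (ψ η : Fock)
    (h : ∀ n, wf η n =ᵐ[volume] fun k => m n k * wf ψ n k) : ‖η‖ ≤ C * ‖ψ‖ := by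
  have h1 : ‖η‖ₑ ^ 2 ≤ ENNReal.ofReal C ^ 2 * ‖ψ‖ₑ ^ 2 := by
    refine le_trans (le_of_eq ?_) (lintegral_mul_wf_le m hb ψ)
    rw [enorm_sq_eq]
    refine tsum_congr fun n => lintegral_congr_ae ?_
    filter_upwards [h n] with k hk
    rw [hk]
  rw [enorm_sq_eq_ofReal, enorm_sq_eq_ofReal, ← ENNReal.ofReal_pow hC,
    ← ENNReal.ofReal_mul (by positivity), ENNReal.ofReal_le_ofReal_iff (by positivity),
    ← mul_pow] at h1
  exact (pow_le_pow_iff_left₀ (norm_nonneg _) (by positivity) (by norm_num)).1 h1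

/-- The bounded operator of multiplication by a symbol. -/
def mulOp (s : Symbol) : Fock →L[ℂ] Fock :=
  LinearMap.mkContinuous
    { toFun := fun ψ => (exists_mulOp s ψ).choose
      map_add' := fun ψ φ => fock_ext fun n => by
        filter_upwards [(exists_mulOp s (ψ + φ)).choose_spec n, (exists_mulOp s ψ).choose_spec n,
          (exists_mulOp s φ).choose_spec n, wf_add ψ φ n,
          wf_add (exists_mulOp s ψ).choose (exists_mulOp s φ).choose n] with k h1 h2 h3 h4 h5
        rw [h1, h5, h2, h3, h4, mul_add]
      map_smul' := fun c ψ => fock_ext fun n => by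
        filter_upwards [(exists_mulOp s (c • ψ)).choose_spec n, (exists_mulOp s ψ).choose_spec n,
          wf_smul c ψ n, wf_smul c (exists_mulOp s ψ).choose n] with k h1 h2 h3 h4
        rw [h1, RingHom.id_apply, h4, h2, h3]
        ring }
    s.bound.choose fun ψ => norm_le_of_wf_eq_mul s.fn s.bound.choose_spec.1
      s.bound.choose_spec.2 ψ _ (exists_mulOp s ψ).choose_spec

theorem wf_mulOp (s : Symbol) (ψ : Fock) (n : ℕ) :
    wf (mulOp s ψ) n =ᵐ[volume] fun k => s.fn n k * wf ψ n k :=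
  (exists_mulOp s ψ).choose_spec n

theorem norm_mulOp_le (s : Symbol) {C : ℝ} (hC : 0 ≤ C) (hb : ∀ n k, ‖s.fn n k‖ ≤ C) (ψ : Fock) :
    ‖mulOp s ψ‖ ≤ C * ‖ψ‖ :=
  norm_le_of_wf_eq_mul s.fn hC hb ψ _ (wf_mulOp s ψ)

/-- Multiplication by a real symbol is symmetric. -/
theorem inner_mulOp (s : Symbol) (hr : ∀ n k, (starRingEnd ℂ) (s.fn n k) = s.fn n k) (ψ φ : Fock) :
    inner ℂ (mulOp s ψ) φ = inner ℂ ψ (mulOp s φ) := by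
  refine (hasSum_inner_component (mulOp s ψ) φ).unique ?_
  convert hasSum_inner_component ψ (mulOp s φ) using 2 with n
  refine integral_congr_ae ?_
  filter_upwards [wf_mulOp s ψ n, wf_mulOp s φ n] with k h1 h2
  simp only [h1, h2, RCLike.inner_apply, map_mul, hr]
  ring

/-! ### Occupation numbers and insertion of a momentum -/

open Classical in
/-- The number of momenta of the configuration `k` which lie in the region `B`. -/
def occ (B : Set E3) {n : ℕ} (k : Conf n) : ℕ := ∑ j, if k j ∈ B then 1 else 0

theorem measurable_occ {B : Set E3} (hB : MeasurableSet B) (n : ℕ) :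
    Measurable (fun k : Conf n => occ B k) := by
  classical
  refine Finset.measurable_sum _ fun j _ => ?_
  exact Measurable.ite (measurable_pi_apply j hB) measurable_const measurable_const

theorem occ_perm (B : Set E3) {n : ℕ} (π : Equiv.Perm (Fin n)) (k : Conf n) :
    occ B (fun i => k (π i)) = occ B k := by
  classical
  exact Equiv.sum_comp π fun j => if k j ∈ B then 1 else 0

theorem occ_succAbove_of_mem {B : Set E3} {n : ℕ} (k : Conf (n + 1)) (j : Fin (n + 1))
    (h : k j ∈ B) : occ B k = occ B (fun i => k (j.succAbove i)) + 1 := by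
  classical
  unfold occ
  rw [Fin.sum_univ_succAbove _ j, if_pos h, add_comm]

theorem occ_succAbove_of_notMem {B : Set E3} {n : ℕ} (k : Conf (n + 1)) (j : Fin (n + 1))
    (h : k j ∉ B) : occ B k = occ B (fun i => k (j.succAbove i)) := by
  classical
  unfold occ
  rw [Fin.sum_univ_succAbove _ j, if_neg h, zero_add]

theorem occ_cons_of_mem {B : Set E3} {n : ℕ} (q : E3) (k : Conf n) (h : q ∈ B) :
    occ B (Fin.cons q k : Conf (n + 1)) = occ B k + 1 := by
  classical
  unfold occ
  rw [Fin.sum_univ_succ]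
  simp [h, add_comm]

theorem occ_cons_of_notMem {B : Set E3} {n : ℕ} (q : E3) (k : Conf n) (h : q ∉ B) :
    occ B (Fin.cons q k : Conf (n + 1)) = occ B k := by
  classical
  unfold occ
  rw [Fin.sum_univ_succ]
  simp [h]

theorem occ_eq_card (B : Set E3) {n : ℕ} (k : Conf n) [DecidablePred fun j => k j ∈ B] :
    occ B k = (Finset.univ.filter fun j => k j ∈ B).card := by
  classical
  rw [Finset.card_filter]
  exact Finset.sum_congr rfl fun j _ => by congr

theorem occ_eq_zero_iff (B : Set E3) {n : ℕ} (k : Conf n) : occ B k = 0 ↔ ∀ j, k j ∉ B := by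
  classical
  simp [occ]

/-- Insertion of a momentum at the place `j`. -/
def insertAt {n : ℕ} (j : Fin (n + 1)) (p : E3 × Conf n) : Conf (n + 1) := j.insertNth p.1 p.2

theorem insertAt_zero {n : ℕ} (p : E3 × Conf n) :
    insertAt 0 p = (Fin.cons p.1 p.2 : Conf (n + 1)) := by
  simp [insertAt]

theorem insertAt_self {n : ℕ} (j : Fin (n + 1)) (p : E3 × Conf n) : insertAt j p j = p.1 := by
  simp [insertAt]

theorem insertAt_succAbove {n : ℕ} (j : Fin (n + 1)) (p : E3 × Conf n) :
    (fun i => insertAt j p (j.succAbove i)) = p.2 := by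
  ext1 i; simp [insertAt]

theorem measurePreserving_insertAt {n : ℕ} (j : Fin (n + 1)) :
    MeasurePreserving (insertAt j : E3 × Conf n → Conf (n + 1)) (volume.prod volume) volume :=
  (volume_preserving_piFinSuccAbove (fun _ : Fin (n + 1) => E3) j).symm

theorem measurableEmbedding_insertAt {n : ℕ} (j : Fin (n + 1)) :
    MeasurableEmbedding (insertAt j : E3 × Conf n → Conf (n + 1)) :=
  (MeasurableEquiv.piFinSuccAbove (fun _ : Fin (n + 1) => E3) j).symm.measurableEmbedding

theorem insertAt_eq_cons_perm {n : ℕ} (j : Fin (n + 1)) (p : E3 × Conf n) :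
    insertAt j p = fun i => (Fin.cons p.1 p.2 : Conf (n + 1)) (j.cycleRange i) := by
  ext1 i
  induction i using Fin.succAboveCases j with
  | x => simp [insertAt]
  | p i => simp [insertAt, Fin.cycleRange_succAbove]

/-- A symmetric wave function does not depend on the place at which a momentum is inserted. -/
theorem wf_insertAt (ψ : Fock) (n : ℕ) (j : Fin (n + 1)) :
    ∀ᵐ p : E3 × Conf n ∂(volume.prod volume),
      wf ψ (n + 1) (insertAt j p) = wf ψ (n + 1) (Fin.cons p.1 p.2) := by
  have h := (measurePreserving_insertAt (n := n) 0).quasiMeasurePreserving.ae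
    (wf_perm ψ (n + 1) j.cycleRange)
  filter_upwards [h] with p hp
  rw [insertAt_zero] at hp
  rw [← hp, insertAt_eq_cons_perm]

theorem quasiMeasurePreserving_apply (n : ℕ) (j : Fin (n + 1)) :
    Measure.QuasiMeasurePreserving (fun k : Conf (n + 1) => k j) volume volume :=
  Measure.quasiMeasurePreserving_fst.comp
    (volume_preserving_piFinSuccAbove (fun _ : Fin (n + 1) => E3) j).quasiMeasurePreserving

/-- Tonelli's theorem for the separation of one momentum. -/
theorem lintegral_conf_succ {n : ℕ} (j : Fin (n + 1)) (F : Conf (n + 1) → ℝ≥0∞)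
    (hF : AEMeasurable F volume) :
    ∫⁻ k, F k = ∫⁻ q, ∫⁻ k : Conf n, F (insertAt j (q, k)) := by
  rw [← (measurePreserving_insertAt j).lintegral_comp_emb (measurableEmbedding_insertAt j)]
  exact lintegral_prod (fun p => F (insertAt j p))
    (hF.comp_quasiMeasurePreserving (measurePreserving_insertAt j).quasiMeasurePreserving)

/-- Integrating the number of momenta in `B` against `|ψ|²` amounts to integrating one momentum
over `B`, by symmetry. -/
theorem lintegral_occ_mul {B : Set E3} (hB : MeasurableSet B) (ψ : Fock) (n : ℕ) :
    ∫⁻ k, (occ B k : ℝ≥0∞) * ‖wf ψ (n + 1) k‖ₑ ^ 2 =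
      ∫⁻ q in B, (n + 1 : ℝ≥0∞) * ∫⁻ k : Conf n, ‖wf ψ (n + 1) (Fin.cons q k)‖ₑ ^ 2 := by
  classical
  have hm : Measurable fun k => ‖wf ψ (n + 1) k‖ₑ ^ 2 :=
    (stronglyMeasurable_wf ψ (n + 1)).measurable.enorm.pow_const 2
  have hi : ∀ j : Fin (n + 1), Measurable fun k : Conf (n + 1) =>
      (if k j ∈ B then 1 else 0 : ℝ≥0∞) * ‖wf ψ (n + 1) k‖ₑ ^ 2 := fun j =>
    (Measurable.ite (measurable_pi_apply j hB) measurable_const measurable_const).mul hm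
  have h1 : ∀ j : Fin (n + 1), ∫⁻ k : Conf (n + 1),
      (if k j ∈ B then 1 else 0 : ℝ≥0∞) * ‖wf ψ (n + 1) k‖ₑ ^ 2 =
      ∫⁻ q in B, ∫⁻ k : Conf n, ‖wf ψ (n + 1) (Fin.cons q k)‖ₑ ^ 2 := fun j => by
    rw [lintegral_conf_succ j _ (hi j).aemeasurable, ← lintegral_indicator hB]
    refine lintegral_congr_ae ?_
    filter_upwards [Measure.ae_ae_of_ae_prod (wf_insertAt ψ n j)] with q hq
    simp only [insertAt_self, Set.indicator_apply]
    by_cases hqB : q ∈ B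
    · simp only [hqB, if_true, one_mul]
      refine lintegral_congr_ae ?_
      filter_upwards [hq] with k hk
      rw [hk]
    · simp [hqB]
  calc ∫⁻ k, (occ B k : ℝ≥0∞) * ‖wf ψ (n + 1) k‖ₑ ^ 2
      = ∫⁻ k, ∑ j, (if k j ∈ B then 1 else 0 : ℝ≥0∞) * ‖wf ψ (n + 1) k‖ₑ ^ 2 := by
        refine lintegral_congr fun k => ?_
        rw [occ, ← Finset.sum_mul]
        push_cast
        rfl
    _ = ∑ j : Fin (n + 1), ∫⁻ q in B, ∫⁻ k : Conf n, ‖wf ψ (n + 1) (Fin.cons q k)‖ₑ ^ 2 := by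
        rw [lintegral_finsetSum _ fun j _ => hi j]
        exact Finset.sum_congr rfl fun j _ => h1 j
    _ = _ := by
        rw [lintegral_const_mul' _ _ (by finiteness)]
        simp

/-! ### Creation operators -/

/-- The relation `η = a*(g) ψ`. -/
def CreRel (g : E3 → ℂ) (ψ η : Fock) : Prop := (ψ, η) ∈ creationGraph g

/-- The wave functions of `a*(g) ψ`. -/
def creFn (g : E3 → ℂ) (ψ : Fock) : ∀ n, Conf n → ℂ
  | 0 => fun _ => 0
  | n + 1 => fun k => ((Real.sqrt (n + 1) : ℝ) : ℂ)⁻¹ *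
      ∑ j : Fin (n + 1), g (k j) * wf ψ n (fun i => k (j.succAbove i))

theorem creRel_iff (g : E3 → ℂ) (ψ η : Fock) :
    CreRel g ψ η ↔ ∀ n, wf η n =ᵐ[volume] creFn g ψ n := by
  constructor
  · rintro ⟨h0, h1⟩ (_ | n)
    exacts [h0, h1 n]
  · exact fun h => ⟨h 0, fun n => h (n + 1)⟩

theorem aestronglyMeasurable_creFn {g : E3 → ℂ} (hg : AEStronglyMeasurable g volume) (ψ : Fock) :
    ∀ n, AEStronglyMeasurable (creFn g ψ n) volume
  | 0 => aestronglyMeasurable_const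
  | n + 1 => by
    refine AEStronglyMeasurable.const_mul ?_ _
    refine Finset.aestronglyMeasurable_fun_sum _ fun j _ => AEStronglyMeasurable.mul ?_ ?_
    · exact hg.comp_quasiMeasurePreserving (quasiMeasurePreserving_apply n j)
    · exact (stronglyMeasurable_wf ψ n).aestronglyMeasurable.comp_quasiMeasurePreserving
        (quasiMeasurePreserving_remove n j)

/-- Removing the entry `j` after a permutation is a permutation after removing the entry `π j`. -/
theorem exists_perm_succAbove {n : ℕ} (π : Equiv.Perm (Fin (n + 1))) (j : Fin (n + 1)) :
    ∃ π' : Equiv.Perm (Fin n), ∀ i, π (j.succAbove i) = (π j).succAbove (π' i) := by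
  refine ⟨(finSuccAboveEquiv j).trans ((π.subtypeEquiv fun a => by simp).trans
    (finSuccAboveEquiv (π j)).symm), fun i => ?_⟩
  have h := (finSuccAboveEquiv (π j)).apply_symm_apply
    ((π.subtypeEquiv fun a => by simp : {x // x ≠ j} ≃ {x // x ≠ π j}) (finSuccAboveEquiv j i))
  exact (congrArg Subtype.val h).symm

theorem creFn_perm (g : E3 → ℂ) (ψ : Fock) : ∀ n (π : Equiv.Perm (Fin n)),
    (fun k : Conf n => creFn g ψ n (fun i => k (π i))) =ᵐ[volume] creFn g ψ n
  | 0, _ => Filter.EventuallyEq.rfl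
  | n + 1, π => by
    choose π' hπ' using exists_perm_succAbove π
    have := ae_all_iff.2 fun j : Fin (n + 1) =>
      (quasiMeasurePreserving_remove n (π j)).ae (wf_perm ψ n (π' j))
    filter_upwards [this] with k hk
    simp only [creFn]
    congr 1
    rw [← Equiv.sum_comp π fun j => g (k j) * wf ψ n (fun i => k (j.succAbove i))]
    refine Finset.sum_congr rfl fun j _ => ?_
    simp only [hπ']
    rw [hk j]

/-- Cauchy–Schwarz for the sum over the momenta lying in the region where `g` lives. -/
theorem enorm_creFn_sq_le {g : E3 → ℂ} {B : Set E3} (hgB : ∀ k ∉ B, g k = 0) (ψ : Fock) (n : ℕ)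
    (k : Conf (n + 1)) :
    ‖creFn g ψ (n + 1) k‖ₑ ^ 2 ≤ (n + 1 : ℝ≥0∞)⁻¹ * ∑ j : Fin (n + 1), ‖g (k j)‖ₑ ^ 2 *
      ((1 + occ B (fun i => k (j.succAbove i)) : ℝ≥0∞) *
        ‖wf ψ n (fun i => k (j.succAbove i))‖ₑ ^ 2) := by
  classical
  set x : Fin (n + 1) → ℂ := fun j => g (k j) * wf ψ n (fun i => k (j.succAbove i)) with hx
  set s := Finset.univ.filter fun j => k j ∈ B with hs
  have h1 : ∑ j, x j = ∑ j ∈ s, x j := by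
    refine (Finset.sum_subset (Finset.subset_univ s) fun j _ hj => ?_).symm
    have : k j ∉ B := by simpa [hs] using hj
    simp [hx, hgB _ this]
  have h2 : ‖∑ j, x j‖₊ ^ 2 ≤ (s.card : NNReal) * ∑ j ∈ s, ‖x j‖₊ ^ 2 := by
    rw [h1]
    exact (pow_le_pow_left' (nnnorm_sum_le _ _) 2).trans sq_sum_le_card_mul_sum_sq
  have h3 : ‖∑ j, x j‖ₑ ^ 2 ≤ (occ B k : ℝ≥0∞) * ∑ j ∈ s, ‖x j‖ₑ ^ 2 := by
    have := ENNReal.coe_le_coe.2 h2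
    rw [occ_eq_card]
    push_cast at this
    exact this
  have h4 : ‖(((Real.sqrt (n + 1) : ℝ) : ℂ)⁻¹)‖ₑ ^ 2 = (n + 1 : ℝ≥0∞)⁻¹ := by
    rw [enorm_sq_eq_ofReal, norm_inv, Complex.norm_real, Real.norm_eq_abs, inv_pow, sq_abs,
      Real.sq_sqrt (by positivity), ENNReal.ofReal_inv_of_pos (by positivity)]
    congr 1
    rw [ENNReal.ofReal_add (by positivity) (by positivity)]
    simp
  change ‖_ * ∑ j, x j‖ₑ ^ 2 ≤ _
  rw [enorm_mul, mul_pow, h4]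
  gcongr
  refine h3.trans ?_
  rw [Finset.mul_sum]
  refine (Finset.sum_le_sum fun j hj => ?_).trans
    (Finset.sum_le_sum_of_subset (Finset.subset_univ s))
  have hj' : k j ∈ B := by simpa [hs] using hj
  rw [occ_succAbove_of_mem k j hj', hx]
  simp only [enorm_mul, mul_pow]
  push_cast
  rw [add_comm]
  exact le_of_eq (by ring)

/-- For `g` supported in `B`, the operator `a*(g)` is bounded by `‖g‖` times the square root of one
plus the number of particles in `B`. -/
theorem lintegral_creFn_le {g : E3 → ℂ} (hg : AEStronglyMeasurable g volume) {B : Set E3}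
    (hB : MeasurableSet B) (hgB : ∀ k ∉ B, g k = 0) (ψ : Fock) :
    ∑' n, ∫⁻ k, ‖creFn g ψ n k‖ₑ ^ 2 ≤ (∫⁻ q, ‖g q‖ₑ ^ 2) *
      ∑' n, ∫⁻ k, (1 + occ B k : ℝ≥0∞) * ‖wf ψ n k‖ₑ ^ 2 := by
  rw [tsum_eq_zero_add' ENNReal.summable, ← ENNReal.tsum_mul_left]
  have h0 : ∫⁻ k, ‖creFn g ψ 0 k‖ₑ ^ 2 = 0 := by simp [creFn]
  rw [h0, zero_add]
  refine ENNReal.tsum_le_tsum fun n => ?_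
  have hw : Measurable fun k : Conf n => (1 + occ B k : ℝ≥0∞) * ‖wf ψ n k‖ₑ ^ 2 := by
    refine Measurable.mul (M := ℝ≥0∞) (Measurable.const_add ?_ 1)
      ((stronglyMeasurable_wf ψ n).measurable.enorm.pow_const 2)
    exact (measurable_from_top (f := fun m : ℕ => (m : ℝ≥0∞))).comp (measurable_occ hB n)
  have hm : ∀ j : Fin (n + 1), AEMeasurable (fun k : Conf (n + 1) => ‖g (k j)‖ₑ ^ 2 *
      ((1 + occ B (fun i => k (j.succAbove i)) : ℝ≥0∞) *
        ‖wf ψ n (fun i => k (j.succAbove i))‖ₑ ^ 2)) volume := fun j => by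
    refine AEMeasurable.mul (M := ℝ≥0∞) ?_ ?_
    · exact ((hg.comp_quasiMeasurePreserving (quasiMeasurePreserving_apply n j)).enorm).pow_const 2
    · exact hw.aemeasurable.comp_quasiMeasurePreserving (quasiMeasurePreserving_remove n j)
  calc ∫⁻ k, ‖creFn g ψ (n + 1) k‖ₑ ^ 2
      ≤ ∫⁻ k, (n + 1 : ℝ≥0∞)⁻¹ * ∑ j : Fin (n + 1), ‖g (k j)‖ₑ ^ 2 *
          ((1 + occ B (fun i => k (j.succAbove i)) : ℝ≥0∞) *
            ‖wf ψ n (fun i => k (j.succAbove i))‖ₑ ^ 2) :=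
        lintegral_mono fun k => enorm_creFn_sq_le hgB ψ n k
    _ = (n + 1 : ℝ≥0∞)⁻¹ * ∑ j : Fin (n + 1), (∫⁻ q, ‖g q‖ₑ ^ 2) *
          ∫⁻ k : Conf n, (1 + occ B k : ℝ≥0∞) * ‖wf ψ n k‖ₑ ^ 2 := by
        rw [lintegral_const_mul' _ _ (by simp), lintegral_finsetSum' _ fun j _ => hm j]
        congr 1
        refine Finset.sum_congr rfl fun j _ => ?_
        rw [lintegral_conf_succ j _ (hm j)]
        simp only [insertAt_self, insertAt_succAbove]
        rw [← lintegral_mul_const'' _ (hg.enorm.pow_const 2)]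
        exact lintegral_congr fun q => lintegral_const_mul _ hw
    _ = _ := by
        rw [Finset.sum_const, Finset.card_univ, Fintype.card_fin, nsmul_eq_mul, ← mul_assoc]
        push_cast
        rw [ENNReal.inv_mul_cancel (by simp) (by finiteness), one_mul]

/-- A state with finite expected number of particles in the support of `g` is in the domain of
`a*(g)`. -/
theorem exists_creRel {g : E3 → ℂ} (hg : MemLp g 2 volume) {B : Set E3}
    (hB : MeasurableSet B) (hgB : ∀ k ∉ B, g k = 0) (ψ : Fock)
    (hψ : ∑' n, ∫⁻ k, (1 + occ B k : ℝ≥0∞) * ‖wf ψ n k‖ₑ ^ 2 ≠ ∞) :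
    ∃ η, CreRel g ψ η ∧ ‖η‖ₑ ^ 2 ≤ (∫⁻ q, ‖g q‖ₑ ^ 2) *
      ∑' n, ∫⁻ k, (1 + occ B k : ℝ≥0∞) * ‖wf ψ n k‖ₑ ^ 2 := by
  have hg2 : ∫⁻ q, ‖g q‖ₑ ^ 2 ≠ ∞ := by
    have := (eLpNorm_lt_top_iff_lintegral_rpow_enorm_lt_top (by norm_num) (by norm_num)).1 hg.2
    simpa using this.ne
  have hle := lintegral_creFn_le hg.1 hB hgB ψ
  obtain ⟨η, hη⟩ := exists_wf_eq (creFn g ψ) (aestronglyMeasurable_creFn hg.1 ψ) (creFn_perm g ψ)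
    (ne_top_of_le_ne_top (ENNReal.mul_ne_top hg2 hψ) hle)
  refine ⟨η, (creRel_iff g ψ η).2 hη, ?_⟩
  rw [enorm_sq_eq]
  refine le_trans (le_of_eq (tsum_congr fun n => lintegral_congr_ae ?_)) hle
  filter_upwards [hη n] with k hk
  rw [hk]

/-! ### Annihilation operators -/

theorem ae_cons_left {n : ℕ} {p : Conf (n + 1) → Prop} (h : ∀ᵐ k, p k) :
    ∀ᵐ q : E3, ∀ᵐ k : Conf n, p (Fin.cons q k) := by
  have := (measurePreserving_insertAt (n := n) 0).quasiMeasurePreserving.ae h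
  simp only [insertAt_zero] at this
  exact Measure.ae_ae_of_ae_prod this

theorem ae_cons_right {n : ℕ} {p : Conf (n + 1) → Prop} (h : ∀ᵐ k, p k) :
    ∀ᵐ k : Conf n, ∀ᵐ q : E3, p (Fin.cons q k) := by
  have := ((measurePreserving_insertAt (n := n) 0).comp
    (Measure.measurePreserving_swap (μ := volume) (ν := volume))).quasiMeasurePreserving.ae h
  simp only [Function.comp_apply, insertAt_zero] at this
  exact Measure.ae_ae_of_ae_prod this

/-- The wave functions `√(n+1) ∫ ḡ(p) ψₙ₊₁(p, k₁, …, kₙ) dp` of `a(g) ψ`. -/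
def annFn (g : E3 → ℂ) (ψ : Fock) (n : ℕ) (k : Conf n) : ℂ :=
  ((Real.sqrt (n + 1) : ℝ) : ℂ) * ∫ p, (starRingEnd ℂ) (g p) * wf ψ (n + 1) (Fin.cons p k)

/-- The relation `η = a(g) ψ`, in terms of wave functions. -/
def AnnRel (g : E3 → ℂ) (ψ η : Fock) : Prop := ∀ n, wf η n =ᵐ[volume] annFn g ψ n

theorem measurable_cons (n : ℕ) :
    Measurable fun p : E3 × Conf n => (Fin.cons p.1 p.2 : Conf (n + 1)) := by
  have := (measurableEmbedding_insertAt (n := n) 0).measurable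
  simpa only [funext insertAt_zero] using! this

theorem measurable_cons_left {n : ℕ} (q : E3) :
    Measurable fun k : Conf n => (Fin.cons q k : Conf (n + 1)) :=
  (measurable_cons n).comp (measurable_const.prodMk measurable_id)

theorem measurable_cons_right {n : ℕ} (k : Conf n) :
    Measurable fun q : E3 => (Fin.cons q k : Conf (n + 1)) :=
  (measurable_cons n).comp (measurable_id.prodMk measurable_const)

theorem aestronglyMeasurable_annFn {g : E3 → ℂ} (hg : AEStronglyMeasurable g volume) (ψ : Fock)
    (n : ℕ) : AEStronglyMeasurable (annFn g ψ n) volume := by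
  refine AEStronglyMeasurable.const_mul ?_ _
  refine AEStronglyMeasurable.integral_prod_right' (μ := volume) (ν := volume)
    (f := fun z : Conf n × E3 => (starRingEnd ℂ) (g z.2) * wf ψ (n + 1) (Fin.cons z.2 z.1)) ?_
  refine AEStronglyMeasurable.mul ?_ ?_
  · exact Complex.continuous_conj.comp_aestronglyMeasurable
      (hg.comp_quasiMeasurePreserving Measure.quasiMeasurePreserving_snd)
  · exact ((stronglyMeasurable_wf ψ (n + 1)).comp_measurable
      ((measurable_cons n).comp measurable_swap)).aestronglyMeasurable

theorem wf_cons_perm (ψ : Fock) (n : ℕ) (π : Equiv.Perm (Fin n)) : ∀ᵐ k : Conf (n + 1),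
    wf ψ (n + 1) (Fin.cons (k 0) fun i => k (π i).succ) = wf ψ (n + 1) k := by
  filter_upwards [wf_perm ψ (n + 1) (Equiv.Perm.decomposeFin.symm (0, π))] with k hk
  rw [← hk]
  congr 1
  ext1 i
  induction i using Fin.cases with
  | zero => simp
  | succ i => simp

theorem annFn_perm (g : E3 → ℂ) (ψ : Fock) (n : ℕ) (π : Equiv.Perm (Fin n)) :
    (fun k : Conf n => annFn g ψ n (fun i => k (π i))) =ᵐ[volume] annFn g ψ n := by
  filter_upwards [ae_cons_right (wf_cons_perm ψ n π)] with k hk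
  unfold annFn
  congr 1
  refine integral_congr_ae ?_
  filter_upwards [hk] with q hq
  simp only [Fin.cons_zero, Fin.cons_succ] at hq
  rw [hq]

/-- The Cauchy–Schwarz inequality for `ℝ≥0∞`-valued functions. -/
theorem lintegral_mul_sq_le {α : Type*} [MeasurableSpace α] {μ : Measure α} {f g : α → ℝ≥0∞}
    (hf : AEMeasurable f μ) (hg : AEMeasurable g μ) :
    (∫⁻ a, f a * g a ∂μ) ^ 2 ≤ (∫⁻ a, f a ^ 2 ∂μ) * ∫⁻ a, g a ^ 2 ∂μ := by
  have h := ENNReal.lintegral_mul_le_Lp_mul_Lq μ Real.HolderConjugate.two_two hf hg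
  have e : ∀ x : ℝ≥0∞, (x ^ (1 / 2 : ℝ)) ^ 2 = x := fun x => by
    rw [← ENNReal.rpow_natCast, ← ENNReal.rpow_mul]; norm_num
  have h2 := pow_le_pow_left' h 2
  rw [mul_pow, e, e] at h2
  simpa using h2

theorem enorm_sqrt_sq (n : ℕ) : ‖((Real.sqrt (n + 1) : ℝ) : ℂ)‖ₑ ^ 2 = (n + 1 : ℝ≥0∞) := by
  rw [enorm_sq_eq_ofReal, Complex.norm_real, Real.norm_eq_abs, sq_abs,
    Real.sq_sqrt (by positivity), ENNReal.ofReal_add (by positivity) (by positivity)]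
  simp

theorem enorm_annFn_sq_le {g : E3 → ℂ} (hg : AEStronglyMeasurable g volume) {B : Set E3}
    (hB : MeasurableSet B) (hgB : ∀ k ∉ B, g k = 0) (ψ : Fock) (n : ℕ) (k : Conf n) :
    ‖annFn g ψ n k‖ₑ ^ 2 ≤ (∫⁻ q, ‖g q‖ₑ ^ 2) *
      ((n + 1 : ℝ≥0∞) * ∫⁻ q in B, ‖wf ψ (n + 1) (Fin.cons q k)‖ₑ ^ 2) := by
  have hm : Measurable fun q => ‖wf ψ (n + 1) (Fin.cons q k)‖ₑ :=
    ((stronglyMeasurable_wf ψ (n + 1)).measurable.comp (measurable_cons_right k)).enorm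
  rw [annFn, enorm_mul, mul_pow, enorm_sqrt_sq]
  have h1 : ‖∫ p, (starRingEnd ℂ) (g p) * wf ψ (n + 1) (Fin.cons p k)‖ₑ ≤
      ∫⁻ p in B, ‖g p‖ₑ * ‖wf ψ (n + 1) (Fin.cons p k)‖ₑ := by
    refine (enorm_integral_le_lintegral_enorm _).trans ?_
    rw [← lintegral_indicator hB]
    refine lintegral_mono fun p => ?_
    by_cases hp : p ∈ B
    · rw [Set.indicator_of_mem hp, enorm_mul, ← ofReal_norm ((starRingEnd ℂ) (g p)),
        RCLike.norm_conj, ofReal_norm]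
    · simp [hgB p hp]
  have h2 := (pow_le_pow_left' h1 2).trans (lintegral_mul_sq_le
    (hg.enorm.mono_measure Measure.restrict_le_self) hm.aemeasurable)
  calc _ ≤ (n + 1 : ℝ≥0∞) * ((∫⁻ q in B, ‖g q‖ₑ ^ 2) *
        ∫⁻ q in B, ‖wf ψ (n + 1) (Fin.cons q k)‖ₑ ^ 2) := by gcongr
    _ ≤ (n + 1 : ℝ≥0∞) * ((∫⁻ q, ‖g q‖ₑ ^ 2) *
        ∫⁻ q in B, ‖wf ψ (n + 1) (Fin.cons q k)‖ₑ ^ 2) := by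
        gcongr
        exact Measure.restrict_le_self
    _ = _ := by ring

/-- For `g` supported in `B`, the operator `a(g)` is bounded by `‖g‖` times the square root of the
number of particles in `B`; the summand `1` gives the same bound as for `a*(g)`. -/
theorem lintegral_annFn_le {g : E3 → ℂ} (hg : AEStronglyMeasurable g volume) {B : Set E3}
    (hB : MeasurableSet B) (hgB : ∀ k ∉ B, g k = 0) (ψ : Fock) :
    ∑' n, ∫⁻ k, ‖annFn g ψ n k‖ₑ ^ 2 ≤ (∫⁻ q, ‖g q‖ₑ ^ 2) *
      ∑' n, ∫⁻ k, (1 + occ B k : ℝ≥0∞) * ‖wf ψ n k‖ₑ ^ 2 := by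
  rw [← ENNReal.tsum_mul_left]
  refine le_trans ?_ (ENNReal.tsum_comp_le_tsum_of_injective (Nat.succ_injective)
    (fun n => (∫⁻ q, ‖g q‖ₑ ^ 2) * ∫⁻ k : Conf n, (1 + occ B k : ℝ≥0∞) * ‖wf ψ n k‖ₑ ^ 2))
  refine ENNReal.tsum_le_tsum fun n => ?_
  have hm : Measurable fun p : E3 × Conf n => ‖wf ψ (n + 1) (Fin.cons p.1 p.2)‖ₑ ^ 2 :=
    ((stronglyMeasurable_wf ψ (n + 1)).measurable.comp (measurable_cons n)).enorm.pow_const 2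
  have hm' : Measurable fun k : Conf n =>
      ∫⁻ q in B, ‖wf ψ (n + 1) (Fin.cons q k)‖ₑ ^ 2 := hm.lintegral_prod_left'
  calc ∫⁻ k, ‖annFn g ψ n k‖ₑ ^ 2
      ≤ ∫⁻ k, (∫⁻ q, ‖g q‖ₑ ^ 2) *
          ((n + 1 : ℝ≥0∞) * ∫⁻ q in B, ‖wf ψ (n + 1) (Fin.cons q k)‖ₑ ^ 2) :=
        lintegral_mono fun k => enorm_annFn_sq_le hg hB hgB ψ n k
    _ = (∫⁻ q, ‖g q‖ₑ ^ 2) * ∫⁻ k, (occ B k : ℝ≥0∞) * ‖wf ψ (n + 1) k‖ₑ ^ 2 := by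
        rw [lintegral_const_mul _ (hm'.const_mul _), lintegral_const_mul _ hm',
          lintegral_occ_mul hB, lintegral_const_mul' _ _ (by finiteness)]
        congr 2
        exact lintegral_lintegral_swap (μ := volume) (ν := volume.restrict B)
          (f := fun k q => ‖wf ψ (n + 1) (Fin.cons q k)‖ₑ ^ 2)
          (hm.comp measurable_swap).aemeasurable
    _ ≤ _ := by
        gcongr
        exact le_add_self

/-- A state with finite expected number of particles in the support of `g` is in the domain of
`a(g)`. -/
theorem exists_annRel {g : E3 → ℂ} (hg : MemLp g 2 volume) {B : Set E3}
    (hB : MeasurableSet B) (hgB : ∀ k ∉ B, g k = 0) (ψ : Fock)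
    (hψ : ∑' n, ∫⁻ k, (1 + occ B k : ℝ≥0∞) * ‖wf ψ n k‖ₑ ^ 2 ≠ ∞) :
    ∃ η, AnnRel g ψ η ∧ ‖η‖ₑ ^ 2 ≤ (∫⁻ q, ‖g q‖ₑ ^ 2) *
      ∑' n, ∫⁻ k, (1 + occ B k : ℝ≥0∞) * ‖wf ψ n k‖ₑ ^ 2 := by
  have hg2 : ∫⁻ q, ‖g q‖ₑ ^ 2 ≠ ∞ := by
    have := (eLpNorm_lt_top_iff_lintegral_rpow_enorm_lt_top (by norm_num) (by norm_num)).1 hg.2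
    simpa using this.ne
  have hle := lintegral_annFn_le hg.1 hB hgB ψ
  obtain ⟨η, hη⟩ := exists_wf_eq (annFn g ψ) (aestronglyMeasurable_annFn hg.1 ψ) (annFn_perm g ψ)
    (ne_top_of_le_ne_top (ENNReal.mul_ne_top hg2 hψ) hle)
  refine ⟨η, hη, ?_⟩
  rw [enorm_sq_eq]
  refine le_trans (le_of_eq (tsum_congr fun n => lintegral_congr_ae ?_)) hle
  filter_upwards [hη n] with k hk
  rw [hk]

theorem memLp_wf_cons (ψ : Fock) (n : ℕ) :
    MemLp (fun p : E3 × Conf n => wf ψ (n + 1) (Fin.cons p.1 p.2)) 2 (volume.prod volume) := by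
  have := (memLp_wf ψ (n + 1)).comp_measurePreserving (measurePreserving_insertAt (n := n) 0)
  simpa only [Function.comp_def, insertAt_zero] using this

theorem memLp_mul_wf {g : E3 → ℂ} (hg : MemLp g 2 volume) (φ : Fock) (n : ℕ) :
    MemLp (fun p : E3 × Conf n => g p.1 * wf φ n p.2) 2 (volume.prod volume) := by
  refine ⟨(hg.1.comp_quasiMeasurePreserving Measure.quasiMeasurePreserving_fst).mul
    ((memLp_wf φ n).1.comp_quasiMeasurePreserving Measure.quasiMeasurePreserving_snd), ?_⟩
  have h1 := (eLpNorm_lt_top_iff_lintegral_rpow_enorm_lt_top (by norm_num) (by norm_num)).1 hg.2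
  have h2 := (eLpNorm_lt_top_iff_lintegral_rpow_enorm_lt_top (by norm_num) (by norm_num)).1
    (memLp_wf φ n).2
  rw [eLpNorm_lt_top_iff_lintegral_rpow_enorm_lt_top (by norm_num) (by norm_num)]
  simp only [ENNReal.toReal_ofNat, ENNReal.rpow_ofNat, enorm_mul, mul_pow] at h1 h2 ⊢
  rw [lintegral_prod_mul (hg.1.enorm.pow_const 2) ((memLp_wf φ n).1.enorm.pow_const 2)]
  exact ENNReal.mul_lt_top h1 h2

/-- The `n`-particle part of the adjointness of `a(g)` and `a*(g)`: Fubini, and the symmetry of the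
wave function of `ψ`. -/
theorem integral_inner_creFn {g : E3 → ℂ} (hg : MemLp g 2 volume) (ψ φ : Fock) (n : ℕ) :
    ∫ k, inner ℂ (wf ψ (n + 1) k) (creFn g φ (n + 1) k) =
      ∫ k, inner ℂ (annFn g ψ n k) (wf φ n k) := by
  set F : E3 × Conf n → ℂ := fun p =>
    g p.1 * wf φ n p.2 * (starRingEnd ℂ) (wf ψ (n + 1) (Fin.cons p.1 p.2)) with hF
  have hint : Integrable F (volume.prod volume) :=
    MemLp.integrable_mul (memLp_mul_wf hg φ n) (memLp_wf_cons ψ n).star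
  set G : Fin (n + 1) → Conf (n + 1) → ℂ := fun j k =>
    g (k j) * wf φ n (fun i => k (j.succAbove i)) * (starRingEnd ℂ) (wf ψ (n + 1) k) with hG
  have hGF : ∀ j, (fun p => G j (insertAt j p)) =ᵐ[volume.prod volume] F := fun j => by
    filter_upwards [wf_insertAt ψ n j] with p hp
    simp only [hG, hF, insertAt_self, insertAt_succAbove, hp]
  have hGi : ∀ j, Integrable (G j) volume := fun j =>
    ((measurePreserving_insertAt j).integrable_comp_emb (measurableEmbedding_insertAt j)).1
      (hint.congr (hGF j).symm)
  have hGint : ∀ j, ∫ k, G j k = ∫ p, F p ∂(volume.prod volume) := fun j => by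
    rw [← (measurePreserving_insertAt j).integral_comp (measurableEmbedding_insertAt j)]
    exact integral_congr_ae (hGF j)
  have hs : ((Real.sqrt (n + 1) : ℝ) : ℂ)⁻¹ * (n + 1 : ℕ) = ((Real.sqrt (n + 1) : ℝ) : ℂ) := by
    have h0 : ((Real.sqrt (n + 1) : ℝ) : ℂ) ≠ 0 := by
      exact_mod_cast (Real.sqrt_pos.2 (by positivity)).ne'
    rw [inv_mul_eq_iff_eq_mul₀ h0, ← Complex.ofReal_mul, Real.mul_self_sqrt (by positivity)]
    push_cast
    rfl
  calc ∫ k, inner ℂ (wf ψ (n + 1) k) (creFn g φ (n + 1) k)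
      = ∫ k, ((Real.sqrt (n + 1) : ℝ) : ℂ)⁻¹ * ∑ j, G j k := by
        refine integral_congr_ae (Filter.Eventually.of_forall fun k => ?_)
        simp only [RCLike.inner_apply, creFn, hG, ← Finset.sum_mul]
        ring
    _ = ((Real.sqrt (n + 1) : ℝ) : ℂ) * ∫ p, F p ∂(volume.prod volume) := by
        rw [integral_const_mul, integral_finsetSum _ fun j _ => hGi j]
        simp only [hGint, Finset.sum_const, Finset.card_univ, Fintype.card_fin, nsmul_eq_mul]
        rw [← mul_assoc, hs]
    _ = ∫ k, ((Real.sqrt (n + 1) : ℝ) : ℂ) * ∫ q, F (q, k) := by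
        rw [integral_prod_symm F hint, integral_const_mul]
    _ = _ := by
        refine integral_congr_ae (Filter.Eventually.of_forall fun k => ?_)
        have e : ∫ q, F (q, k) = wf φ n k * ∫ q, (starRingEnd ℂ)
            ((starRingEnd ℂ) (g q) * wf ψ (n + 1) (Fin.cons q k)) := by
          rw [← integral_const_mul]
          refine integral_congr_ae (Filter.Eventually.of_forall fun q => ?_)
          simp only [hF, map_mul, Complex.conj_conj]
          ring
        beta_reduce
        rw [e, integral_conj]
        simp only [RCLike.inner_apply, annFn, map_mul, Complex.conj_ofReal]
        ring

/-- The wave function operators `a(g)` and `a*(g)` are formally adjoint. -/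
theorem inner_annRel_creRel {g : E3 → ℂ} (hg : MemLp g 2 volume) {ψ η φ θ : Fock}
    (h1 : AnnRel g ψ η) (h2 : CreRel g φ θ) : inner ℂ η φ = inner ℂ ψ θ := by
  rw [creRel_iff] at h2
  have e0 : ∫ k, inner ℂ (wf ψ 0 k) (wf θ 0 k) = 0 := by
    refine (integral_congr_ae ?_).trans (integral_zero _ _)
    filter_upwards [h2 0] with k hk
    simp [hk, creFn]
  have e1 : ∀ n, ∫ k, inner ℂ (wf ψ (n + 1) k) (wf θ (n + 1) k) =
      ∫ k, inner ℂ (wf η n k) (wf φ n k) := fun n => by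
    rw [integral_congr_ae (g := fun k => inner ℂ (wf ψ (n + 1) k) (creFn g φ (n + 1) k)),
      integral_inner_creFn hg]
    · refine integral_congr_ae ?_
      filter_upwards [h1 n] with k hk
      rw [hk]
    · filter_upwards [h2 (n + 1)] with k hk
      rw [hk]
  have hs := (hasSum_nat_add_iff' 1).2 (hasSum_inner_component ψ θ)
  simp only [Finset.range_one, Finset.sum_singleton, e0, sub_zero, e1] at hs
  exact (hasSum_inner_component η φ).unique hs

/-- The symbol `1 / (n + 1)` of `(N + 1)⁻¹`, where `N` is the number of particles. -/
def invNumberSymbol : Symbol where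
  fn n _ := ((n + 1 : ℝ) : ℂ)⁻¹
  meas _ := measurable_const
  symm _ _ _ := rfl
  bound := ⟨1, zero_le_one, fun n k => by
    rw [norm_inv, Complex.norm_real, Real.norm_eq_abs, abs_of_pos (by positivity)]
    exact inv_le_one_of_one_le₀ (by linarith [Nat.cast_nonneg (α := ℝ) n])⟩

theorem occ_le (B : Set E3) {n : ℕ} (k : Conf n) : occ B k ≤ n := by
  classical
  rw [occ_eq_card]
  exact (Finset.card_le_univ _).trans (by simp)

/-- For `g ∈ L²`, the domain of `a*(g)` is dense: it contains the range of `(N + 1)⁻¹`, and a vector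
`ψ` orthogonal to this range has `⟪ψ, (N + 1)⁻¹ ψ⟫ = 0`, so that `ψ = 0`. -/
theorem dense_creation_domain {g : E3 → ℂ} (hg : MemLp g 2 volume) :
    Dense ((creation g).domain : Set Fock) := by
  rw [Submodule.dense_iff_topologicalClosure_eq_top, Submodule.topologicalClosure_eq_top_iff,
    Submodule.eq_bot_iff]
  intro ψ hψ
  have hmem : mulOp invNumberSymbol ψ ∈ (creation g).domain := by
    have hfin : ∑' n, ∫⁻ k, (1 + occ Set.univ k : ℝ≥0∞) *
        ‖wf (mulOp invNumberSymbol ψ) n k‖ₑ ^ 2 ≠ ∞ := by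
      refine ne_top_of_le_ne_top (b := ‖ψ‖ₑ ^ 2) (by simp) ?_
      rw [enorm_sq_eq]
      refine ENNReal.tsum_le_tsum fun n => lintegral_mono_ae ?_
      filter_upwards [wf_mulOp invNumberSymbol ψ n] with k hk
      rw [hk, enorm_mul, mul_pow, ← mul_assoc]
      refine mul_le_of_le_one_left' ?_
      have h1 : (1 + occ Set.univ k : ℝ≥0∞) ≤ n + 1 := by
        rw [add_comm]
        gcongr
        exact_mod_cast occ_le _ k
      have h2 : ‖invNumberSymbol.fn n k‖ₑ = (n + 1 : ℝ≥0∞)⁻¹ := by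
        change ‖((n + 1 : ℝ) : ℂ)⁻¹‖ₑ = _
        rw [← ofReal_norm, norm_inv, Complex.norm_real, Real.norm_eq_abs,
          abs_of_pos (by positivity), ENNReal.ofReal_inv_of_pos (by positivity),
          ENNReal.ofReal_add (by positivity) (by positivity)]
        simp
      rw [h2, sq, ← mul_assoc]
      calc _ ≤ (n + 1 : ℝ≥0∞) * (n + 1 : ℝ≥0∞)⁻¹ * (n + 1 : ℝ≥0∞)⁻¹ := by gcongr
        _ = (n + 1 : ℝ≥0∞)⁻¹ := by
          rw [ENNReal.mul_inv_cancel (by simp) (by finiteness), one_mul]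
        _ ≤ 1 := ENNReal.inv_le_one.2 le_add_self
    obtain ⟨η, hη, -⟩ := exists_creRel hg MeasurableSet.univ (fun k hk => (hk trivial).elim) _ hfin
    exact LinearPMap.mem_domain_of_mem_graph ((mem_graph_creation g _).2 hη)
  have h0 : inner ℂ ψ (mulOp invNumberSymbol ψ) = 0 :=
    (Submodule.mem_orthogonal' _ _).1 hψ _ hmem
  have hle := lintegral_weight_le_re_inner ψ (mulOp invNumberSymbol ψ) (fun n _ => (n + 1 : ℝ)⁻¹)
    (fun n k => by positivity) (fun n => by
      filter_upwards [wf_mulOp invNumberSymbol ψ n] with k hk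
      have e : inner ℂ (wf ψ n k) (wf (mulOp invNumberSymbol ψ) n k) =
          (((n + 1 : ℝ)⁻¹ * ‖wf ψ n k‖ ^ 2 : ℝ) : ℂ) := by
        rw [hk]
        simp only [invNumberSymbol, RCLike.inner_apply, mul_assoc, Complex.mul_conj,
          Complex.normSq_eq_norm_sq]
        push_cast
        rfl
      rw [e, Complex.ofReal_re])
  rw [h0, Complex.zero_re, ENNReal.ofReal_zero, nonpos_iff_eq_zero, ENNReal.tsum_eq_zero] at hle
  refine fock_ext fun n => ?_
  have h := hle n
  have hm : Measurable fun k => ‖wf ψ n k‖ₑ ^ 2 :=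
    (stronglyMeasurable_wf ψ n).measurable.enorm.pow_const 2
  rw [lintegral_const_mul _ hm] at h
  have h3 : ∫⁻ k, ‖wf ψ n k‖ₑ ^ 2 = 0 :=
    (mul_eq_zero.1 h).resolve_left (by simp; positivity)
  rw [lintegral_eq_zero_iff hm] at h3
  filter_upwards [h3, wf_zero n] with k hk hk0
  rw [hk0]
  simpa using hk

/-- The operator defined by the wave functions `annFn` is contained in the adjoint of `a*(g)`.
Density of the domain of `a*(g)` is needed here, as `LinearPMap.adjoint` is `0` otherwise. -/
theorem mem_annihilation_graph {g : E3 → ℂ} (hg : MemLp g 2 volume) {ψ η : Fock}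
    (h : AnnRel g ψ η) : (ψ, η) ∈ (annihilation g).graph := by
  have hadj : ∀ x : (creation g).domain, inner ℂ η (x : Fock) = inner ℂ ψ (creation g x) :=
    fun x => inner_annRel_creRel hg h ((mem_graph_creation g _).1 ((creation g).mem_graph x))
  have hmem : ψ ∈ (annihilation g).domain := LinearPMap.mem_adjoint_domain_of_exists _ ⟨η, hadj⟩
  rw [LinearPMap.mem_graph_iff]
  exact ⟨⟨ψ, hmem⟩, rfl, LinearPMap.adjoint_apply_eq (dense_creation_domain hg) _ hadj⟩

/-! ### Sectors with a fixed number of momenta in a region -/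

open Classical in
/-- The symbol of the projection onto the configurations with exactly `m` momenta in `B`. -/
def sectorSymbol (B : Set E3) (hB : MeasurableSet B) (m : ℕ) : Symbol where
  fn _ k := if occ B k = m then 1 else 0
  meas n := Measurable.ite (measurable_occ hB n (measurableSet_singleton m)) measurable_const
    measurable_const
  symm n π k := by rw [occ_perm]
  bound := ⟨1, zero_le_one, fun n k => by split_ifs <;> simp⟩

/-- The orthogonal projection onto the states with exactly `m` particles in the region `B`. -/
def sector (B : Set E3) (hB : MeasurableSet B) (m : ℕ) : Fock →L[ℂ] Fock :=
  mulOp (sectorSymbol B hB m)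

open Classical in
theorem wf_sector (B : Set E3) (hB : MeasurableSet B) (m : ℕ) (ψ : Fock) (n : ℕ) :
    wf (sector B hB m ψ) n =ᵐ[volume] fun k => if occ B k = m then wf ψ n k else 0 := by
  filter_upwards [wf_mulOp (sectorSymbol B hB m) ψ n] with k hk
  rw [sector, hk]
  simp [sectorSymbol]

theorem inner_sector (B : Set E3) (hB : MeasurableSet B) (m : ℕ) (ψ φ : Fock) :
    inner ℂ (sector B hB m ψ) φ = inner ℂ ψ (sector B hB m φ) := by
  classical
  refine inner_mulOp _ (fun n k => ?_) ψ φ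
  simp only [sectorSymbol]
  split_ifs <;> simp

theorem sector_sector (B : Set E3) (hB : MeasurableSet B) (m : ℕ) (ψ : Fock) :
    sector B hB m (sector B hB m ψ) = sector B hB m ψ := by
  classical
  refine fock_ext fun n => ?_
  filter_upwards [wf_sector B hB m ψ n, wf_sector B hB m (sector B hB m ψ) n] with k h1 h2
  rw [h2, h1]
  split_ifs <;> rfl

/-- The sectors of a region decompose the Fock space orthogonally. -/
theorem tsum_enorm_sector_sq (B : Set E3) (hB : MeasurableSet B) (ψ : Fock) :
    ∑' m, ‖sector B hB m ψ‖ₑ ^ 2 = ‖ψ‖ₑ ^ 2 := by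
  classical
  simp_rw [enorm_sq_eq]
  rw [ENNReal.tsum_comm]
  refine tsum_congr fun n => ?_
  rw [← lintegral_tsum fun m =>
    ((stronglyMeasurable_wf _ n).measurable.enorm.pow_const 2).aemeasurable]
  refine lintegral_congr_ae ?_
  filter_upwards [ae_all_iff.2 fun m => wf_sector B hB m ψ n] with k hk
  rw [tsum_eq_single (occ B k)]
  · rw [hk, if_pos rfl]
  · intro m hm
    rw [hk, if_neg (Ne.symm hm)]
    simp

theorem dGammaGraph_sector {h : E3 → ℂ} {ψ η : Fock} (H : (ψ, η) ∈ dGammaGraph h) (B : Set E3)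
    (hB : MeasurableSet B) (m : ℕ) : (sector B hB m ψ, sector B hB m η) ∈ dGammaGraph h := by
  classical
  intro n
  filter_upwards [wf_sector B hB m ψ n, wf_sector B hB m η n, H n] with k h1 h2 h3
  simp only [h1, h2, h3]
  split_ifs <;> simp

/-- If `g` vanishes on `B`, then `a*(g)` does not change the number of particles in `B`. -/
theorem CreRel.sector {g : E3 → ℂ} {ψ η : Fock} (H : CreRel g ψ η) {B : Set E3}
    (hB : MeasurableSet B) (hgB : ∀ k ∈ B, g k = 0) (m : ℕ) :
    CreRel g (sector B hB m ψ) (sector B hB m η) := by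
  classical
  rw [creRel_iff] at H ⊢
  rintro (_ | n)
  · filter_upwards [wf_sector B hB m η 0, H 0] with k h1 h2
    rw [h1, h2]
    simp [creFn]
  · have := ae_all_iff.2 fun j : Fin (n + 1) =>
      (quasiMeasurePreserving_remove n j).ae (wf_sector B hB m ψ n)
    filter_upwards [wf_sector B hB m η (n + 1), H (n + 1), this] with k h1 h2 h3
    rw [h1, h2]
    simp only [creFn, h3]
    by_cases hk : occ B k = m
    · rw [if_pos hk]
      congr 1
      refine Finset.sum_congr rfl fun j _ => ?_
      by_cases hj : k j ∈ B
      · simp [hgB _ hj]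
      · rw [if_pos (by rw [← occ_succAbove_of_notMem k j hj, hk])]
    · rw [if_neg hk, Finset.sum_eq_zero, mul_zero]
      intro j _
      by_cases hj : k j ∈ B
      · simp [hgB _ hj]
      · rw [if_neg (by rwa [← occ_succAbove_of_notMem k j hj]), mul_zero]

/-- If `g` vanishes on `B`, then `a(g)` does not change the number of particles in `B`. -/
theorem AnnRel.sector {g : E3 → ℂ} {ψ η : Fock} (H : AnnRel g ψ η) {B : Set E3}
    (hB : MeasurableSet B) (hgB : ∀ k ∈ B, g k = 0) (m : ℕ) :
    AnnRel g (sector B hB m ψ) (sector B hB m η) := by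
  classical
  intro n
  filter_upwards [wf_sector B hB m η n, H n, ae_cons_right (wf_sector B hB m ψ (n + 1))]
    with k h1 h2 h3
  have e : ∫ p, (starRingEnd ℂ) (g p) * wf (SpinBoson.sector B hB m ψ) (n + 1) (Fin.cons p k) =
      ∫ p, if occ B k = m then (starRingEnd ℂ) (g p) * wf ψ (n + 1) (Fin.cons p k) else 0 := by
    refine integral_congr_ae ?_
    filter_upwards [h3] with p hp
    rw [hp]
    by_cases hpB : p ∈ B
    · simp [hgB p hpB]
    · rw [occ_cons_of_notMem p k hpB]
      split_ifs <;> simp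
  rw [h1, h2, annFn, annFn, e]
  split_ifs <;> simp

/-! ### Removing one momentum -/

/-- `u = a_q ψ`, the pointwise annihilation of a particle of momentum `q`:
`uₙ(k) = √(n+1) ψₙ₊₁(q, k)`. It depends on the chosen representatives of the wave functions of `ψ`,
so that statements about it hold for almost every `q` only. -/
def IsFiber (q : E3) (ψ u : Fock) : Prop :=
  ∀ n, wf u n =ᵐ[volume] fun k => ((Real.sqrt (n + 1) : ℝ) : ℂ) * wf ψ (n + 1) (Fin.cons q k)

/-- The squared norm of `a_q ψ`, as a function of `q`. -/
def fiberSq (ψ : Fock) (q : E3) : ℝ≥0∞ :=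
  ∑' n : ℕ, (n + 1 : ℝ≥0∞) * ∫⁻ k : Conf n, ‖wf ψ (n + 1) (Fin.cons q k)‖ₑ ^ 2

theorem measurable_fiberSq (ψ : Fock) : Measurable (fiberSq ψ) := by
  refine Measurable.tsum fun n => Measurable.const_mul ?_ _
  have hm : Measurable fun p : E3 × Conf n => ‖wf ψ (n + 1) (Fin.cons p.1 p.2)‖ₑ ^ 2 :=
    ((stronglyMeasurable_wf ψ (n + 1)).measurable.comp (measurable_cons n)).enorm.pow_const 2
  exact hm.lintegral_prod_right'

theorem lintegral_fiberSq {B : Set E3} (hB : MeasurableSet B) (ψ : Fock) :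
    ∫⁻ q in B, fiberSq ψ q = ∑' n, ∫⁻ k, (occ B k : ℝ≥0∞) * ‖wf ψ n k‖ₑ ^ 2 := by
  have hm : ∀ n, Measurable fun p : E3 × Conf n => ‖wf ψ (n + 1) (Fin.cons p.1 p.2)‖ₑ ^ 2 :=
    fun n => ((stronglyMeasurable_wf ψ (n + 1)).measurable.comp
      (measurable_cons n)).enorm.pow_const 2
  unfold fiberSq
  rw [lintegral_tsum fun n => ((hm n).lintegral_prod_right'.const_mul _).aemeasurable,
    tsum_eq_zero_add' (f := fun n => ∫⁻ k : Conf n, (occ B k : ℝ≥0∞) * ‖wf ψ n k‖ₑ ^ 2)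
      ENNReal.summable]
  have h0 : ∫⁻ k : Conf 0, (occ B k : ℝ≥0∞) * ‖wf ψ 0 k‖ₑ ^ 2 = 0 := by simp [occ]
  rw [h0, zero_add]
  exact tsum_congr fun n => (lintegral_occ_mul hB ψ n).symm

/-- On the states with `m` particles in `B`, `∫_B ‖a_q ψ‖² dq = m ‖ψ‖²`. -/
theorem lintegral_fiberSq_sector {B : Set E3} (hB : MeasurableSet B) {m : ℕ} {ψ : Fock}
    (hψ : sector B hB m ψ = ψ) : ∫⁻ q in B, fiberSq ψ q = m * ‖ψ‖ₑ ^ 2 := by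
  classical
  rw [lintegral_fiberSq hB, enorm_sq_eq, ← ENNReal.tsum_mul_left]
  refine tsum_congr fun n => ?_
  rw [← lintegral_const_mul _ ((stronglyMeasurable_wf ψ n).measurable.enorm.pow_const 2)]
  refine lintegral_congr_ae ?_
  have h := wf_sector B hB m ψ n
  rw [hψ] at h
  filter_upwards [h] with k hk
  by_cases hm : occ B k = m
  · rw [hm]
  · rw [if_neg hm] at hk
    rw [hk]
    simp

theorem IsFiber.enorm_sq {q : E3} {ψ u : Fock} (h : IsFiber q ψ u) : ‖u‖ₑ ^ 2 = fiberSq ψ q := by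
  rw [enorm_sq_eq, fiberSq]
  refine tsum_congr fun n => ?_
  rw [← lintegral_const_mul' _ _ (by finiteness)]
  refine lintegral_congr_ae ?_
  filter_upwards [h n] with k hk
  rw [hk, enorm_mul, mul_pow, enorm_sqrt_sq]

/-- With finitely many particles in `B`, the state `a_q ψ` exists for almost every `q ∈ B`. -/
theorem ae_exists_isFiber {B : Set E3} (hB : MeasurableSet B) {m : ℕ} {ψ : Fock}
    (hψ : sector B hB m ψ = ψ) : ∀ᵐ q ∂(volume.restrict B), ∃ u, IsFiber q ψ u := by
  have h1 : ∀ᵐ q ∂(volume.restrict B), fiberSq ψ q < ∞ :=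
    ae_lt_top (measurable_fiberSq ψ) (by
      rw [lintegral_fiberSq_sector hB hψ]
      finiteness)
  have h2 : ∀ᵐ q : E3, ∀ n, ∀ π : Equiv.Perm (Fin n), ∀ᵐ k : Conf n,
      wf ψ (n + 1) (Fin.cons q fun i => k (π i)) = wf ψ (n + 1) (Fin.cons q k) := by
    refine ae_all_iff.2 fun n => ae_all_iff.2 fun π => ?_
    have := ae_cons_left (wf_cons_perm ψ n π)
    simpa only [Fin.cons_zero, Fin.cons_succ] using this
  filter_upwards [h1, ae_restrict_of_ae h2] with q hq1 hq2
  refine exists_wf_eq (fun n k => ((Real.sqrt (n + 1) : ℝ) : ℂ) * wf ψ (n + 1) (Fin.cons q k))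
    (fun n => ?_) (fun n π => ?_) ?_
  · exact (((stronglyMeasurable_wf ψ (n + 1)).comp_measurable
      (measurable_cons_left q)).aestronglyMeasurable).const_mul _
  · filter_upwards [hq2 n π] with k hk
    rw [hk]
  · refine ne_of_eq_of_ne (tsum_congr fun n => ?_) hq1.ne
    rw [← lintegral_const_mul' _ _ (by finiteness)]
    refine lintegral_congr fun k => ?_
    rw [enorm_mul, mul_pow, enorm_sqrt_sq]

theorem ae_isFiber_add (ψ φ : Fock) : ∀ᵐ q : E3, ∀ u v, IsFiber q ψ u → IsFiber q φ v →
    IsFiber q (ψ + φ) (u + v) := by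
  have := ae_all_iff.2 fun n => ae_cons_left (wf_add ψ φ (n + 1))
  filter_upwards [this] with q hq u v hu hv n
  filter_upwards [hq n, hu n, hv n, wf_add u v n] with k h1 h2 h3 h4
  rw [h1, h4, h2, h3]
  ring

theorem ae_isFiber_smul (c : ℂ) (ψ : Fock) : ∀ᵐ q : E3, ∀ u, IsFiber q ψ u →
    IsFiber q (c • ψ) (c • u) := by
  have := ae_all_iff.2 fun n => ae_cons_left (wf_smul c ψ (n + 1))
  filter_upwards [this] with q hq u hu n
  filter_upwards [hq n, hu n, wf_smul c u n] with k h1 h2 h3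
  rw [h1, h3, h2]
  ring

theorem IsFiber.unique {q : E3} {ψ u v : Fock} (hu : IsFiber q ψ u) (hv : IsFiber q ψ v) :
    u = v := fock_ext fun n => (hu n).trans (hv n).symm

/-- `dΓ(h) a_q = a_q dΓ(h) - h(q) a_q`. -/
theorem ae_isFiber_dGamma {h : E3 → ℂ} {ψ η : Fock} (H : (ψ, η) ∈ dGammaGraph h) :
    ∀ᵐ q : E3, ∀ u v, IsFiber q ψ u → IsFiber q η v → (u, v - h q • u) ∈ dGammaGraph h := by
  have := ae_all_iff.2 fun n => ae_cons_left (H (n + 1))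
  filter_upwards [this] with q hq u v hu hv n
  filter_upwards [hq n, hu n, hv n, wf_sub v (h q • u) n, wf_smul (h q) u n] with k h1 h2 h3 h4 h5
  rw [h4, h5, h3, h1, h2, Fin.sum_univ_succ]
  simp only [Fin.cons_zero, Fin.cons_succ]
  ring

theorem cons_succ_succAbove {n : ℕ} (q : E3) (k : Conf (n + 1)) (j : Fin (n + 1)) :
    (fun i => (Fin.cons q k : Conf (n + 2)) (j.succ.succAbove i)) =
      (Fin.cons q fun i => k (j.succAbove i) : Conf (n + 1)) := by
  ext1 i
  induction i using Fin.cases with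
  | zero => simp
  | succ i => simp

theorem ofReal_sqrt_ne_zero (n : ℕ) : ((Real.sqrt (n + 1) : ℝ) : ℂ) ≠ 0 := by
  exact_mod_cast (Real.sqrt_pos.2 (by positivity)).ne'

/-- `a*(g) a_q = a_q a*(g)` if `g(q) = 0`. -/
theorem ae_isFiber_creRel {g : E3 → ℂ} {ψ η : Fock} (H : CreRel g ψ η) :
    ∀ᵐ q : E3, g q = 0 → ∀ u v, IsFiber q ψ u → IsFiber q η v → CreRel g u v := by
  rw [creRel_iff] at H
  filter_upwards [ae_all_iff.2 fun n => ae_cons_left (H (n + 1))] with q hq hgq u v hu hv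
  rw [creRel_iff]
  rintro (_ | n)
  · filter_upwards [hv 0, hq 0] with k h1 h2
    rw [h1, h2]
    simp [creFn, hgq]
  · have := ae_all_iff.2 fun j : Fin (n + 1) => (quasiMeasurePreserving_remove n j).ae (hu n)
    filter_upwards [hv (n + 1), hq (n + 1), this] with k h1 h2 h3
    rw [h1, h2]
    simp only [creFn, h3]
    rw [mul_inv_cancel_left₀ (ofReal_sqrt_ne_zero (n + 1)), Fin.sum_univ_succ]
    simp only [Fin.cons_zero, hgq, zero_mul, zero_add, Fin.cons_succ, cons_succ_succAbove]
    rw [Finset.mul_sum]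
    refine Finset.sum_congr rfl fun j _ => ?_
    rw [mul_left_comm (g (k j)), inv_mul_cancel_left₀ (ofReal_sqrt_ne_zero n)]

/-- `a(g) a_q = a_q a(g)`. -/
theorem ae_isFiber_annRel {g : E3 → ℂ} {ψ η : Fock} (H : AnnRel g ψ η) :
    ∀ᵐ q : E3, ∀ u v, IsFiber q ψ u → IsFiber q η v → AnnRel g u v := by
  have hsw := ae_all_iff.2 fun n => ae_cons_left (ae_cons_right
    (wf_perm ψ (n + 2) (Equiv.swap 0 1)))
  filter_upwards [ae_all_iff.2 fun n => ae_cons_left (H (n + 1)), hsw] with q hq hs u v hu hv n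
  filter_upwards [hv n, hq n, ae_cons_right (hu (n + 1)), hs n] with k h1 h2 h3 h4
  have e : ∫ p, (starRingEnd ℂ) (g p) * wf u (n + 1) (Fin.cons p k) =
      ((Real.sqrt ((n + 1 : ℕ) + 1) : ℝ) : ℂ) *
        ∫ p, (starRingEnd ℂ) (g p) * wf ψ (n + 1 + 1) (Fin.cons p (Fin.cons q k)) := by
    rw [← integral_const_mul]
    refine integral_congr_ae ?_
    filter_upwards [h3, h4] with p hp1 hp2
    -- The momenta `p` and `q` are interchanged by the symmetry of `ψ`.
    have hc : (fun i => (Fin.cons p (Fin.cons q k : Conf (n + 1)) : Conf (n + 2))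
        (Equiv.swap 0 1 i)) = Fin.cons q (Fin.cons p k : Conf (n + 1)) := by
      ext1 i
      induction i using Fin.cases with
      | zero => rw [Equiv.swap_apply_left]; rfl
      | succ i =>
        induction i using Fin.cases with
        | zero => exact congrArg _ (Equiv.swap_apply_right (0 : Fin (n + 2)) 1)
        | succ i =>
          rw [Equiv.swap_apply_of_ne_of_ne (Fin.succ_ne_zero _)
            (show i.succ.succ ≠ 1 from fun h => Fin.succ_ne_zero i (Fin.succ_injective _ h))]
          rfl
    rw [hc] at hp2
    rw [hp1, ← hp2]
    ring
  rw [h1, h2, annFn, annFn, e]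

/-- Removing a particle from `B` lowers the number of particles in `B` by one. -/
theorem ae_isFiber_sector {B : Set E3} (hB : MeasurableSet B) {m : ℕ} {ψ : Fock}
    (hψ : sector B hB (m + 1) ψ = ψ) :
    ∀ᵐ q : E3, q ∈ B → ∀ u, IsFiber q ψ u → sector B hB m u = u := by
  classical
  have h : ∀ n, wf ψ n =ᵐ[volume] fun k => if occ B k = m + 1 then wf ψ n k else 0 := fun n => by
    have := wf_sector B hB (m + 1) ψ n
    rwa [hψ] at this
  filter_upwards [ae_all_iff.2 fun n => ae_cons_left (h (n + 1))] with q hq hqB u hu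
  refine fock_ext fun n => ?_
  filter_upwards [wf_sector B hB m u n, hq n, hu n] with k h1 h2 h3
  rw [h1, h3]
  rw [occ_cons_of_mem q k hqB] at h2
  by_cases hk : occ B k = m
  · rw [if_pos hk]
  · rw [if_neg (by omega)] at h2
    rw [if_neg hk, h2, mul_zero]

/-! ### Perturbation of an isolated simple eigenvalue: the reduced resolvent -/

/-- The data of analytic perturbation theory for `H₀ + λ T` on the range of a projection `Q`, where
`H₀ ≥ 0` has the simple eigenvalue `0` with eigenvector `Ω`, isolated by a gap `c`. All operators
are bounded: `G = (H₀ + 1)⁻¹`, `TG = T (H₀ + 1)⁻¹`, and `S` is the reduced resolvent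
`H₀⁻¹ (1 - P_Ω) Q`. The unbounded operator `H₀ + λ T` sends `G y` to `y - G y + λ TG y`. -/
structure GapData (X : Type*) [NormedAddCommGroup X] [InnerProductSpace ℂ X] where
  /-- The resolvent `(H₀ + 1)⁻¹`. -/
  G : X →L[ℂ] X
  /-- The operator `T (H₀ + 1)⁻¹`. -/
  TG : X →L[ℂ] X
  /-- The projection onto the reducing subspace on which `0` is isolated. -/
  Q : X →L[ℂ] X
  /-- The reduced resolvent of `H₀` at `0`. -/
  S : X →L[ℂ] X
  /-- The ground state of `H₀`. -/
  Ω : X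
  /-- The spectral gap. -/
  c : ℝ
  /-- The relative form bound of `T`. -/
  C : ℝ
  c_pos : 0 < c
  C_pos : 0 < C
  G_inj : ∀ x, G x = 0 → x = 0
  G_symm : ∀ x y, inner ℂ (G x) y = inner ℂ x (G y)
  G_Ω : G Ω = Ω
  Q_Ω : Q Ω = Ω
  norm_Ω : ‖Ω‖ = 1
  T_symm : ∀ x y, inner ℂ (TG x) (G y) = inner ℂ (G x) (TG y)
  G_nonneg : ∀ y, ‖G y‖ ^ 2 ≤ (inner ℂ (G y) y).re
  T_bound : ∀ y, ‖inner ℂ (G y) (TG y)‖ ≤ C * (inner ℂ (G y) y).re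
  Q_symm : ∀ x y, inner ℂ (Q x) y = inner ℂ x (Q y)
  Q_idem : ∀ x, Q (Q x) = Q x
  Q_G : ∀ x, Q (G x) = G (Q x)
  Q_T : ∀ x, Q (TG x) = TG (Q x)
  S_eq : ∀ x, S x = G (S x + Q x - inner ℂ Ω x • Ω)
  S_G : ∀ x, S (G x) = G (S x)
  Q_S : ∀ x, Q (S x) = S x
  S_Q : ∀ x, S (Q x) = S x
  inner_S : ∀ x, inner ℂ Ω (S x) = 0
  S_norm : c * ‖S‖ ≤ 1
  gap : ∀ y, Q (G y) = G y → inner ℂ Ω (G y) = 0 → (1 + c) * ‖G y‖ ^ 2 ≤ (inner ℂ (G y) y).re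

namespace GapData

variable {X : Type*} [NormedAddCommGroup X] [InnerProductSpace ℂ X] (D : GapData X)

/-- The orthogonal projection onto `ℂ Ω`. -/
def PΩ : X →L[ℂ] X := (innerSL ℂ D.Ω).smulRight D.Ω

theorem PΩ_apply (x : X) : D.PΩ x = inner ℂ D.Ω x • D.Ω := rfl

theorem inner_Ω_Ω : inner ℂ D.Ω D.Ω = (1 : ℂ) := by
  rw [inner_self_eq_norm_sq_to_K, D.norm_Ω]; simp

theorem inner_Ω_G (x : X) : inner ℂ D.Ω (D.G x) = inner ℂ D.Ω x := by
  rw [← D.G_symm, D.G_Ω]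

theorem inner_Ω_Q (x : X) : inner ℂ D.Ω (D.Q x) = inner ℂ D.Ω x := by
  rw [← D.Q_symm, D.Q_Ω]

/-- The inverse of `1 - ζ S`. -/
def U (ζ : ℂ) : X →L[ℂ] X := Ring.inverse (1 - ζ • D.S)

/-- `(H₀ + 1)` times the resolvent of `H₀` on the range of `Q`. -/
def Y (ζ : ℂ) : X →L[ℂ] X := -(ζ⁻¹ • D.PΩ) + (D.S + D.Q - D.PΩ) * D.U ζ

/-- The resolvent `(H₀ - ζ)⁻¹ Q = -ζ⁻¹ P_Ω + S (1 - ζ S)⁻¹`. -/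
def R0 (ζ : ℂ) : X →L[ℂ] X := D.G * D.Y ζ

/-- The operator `T (H₀ - ζ)⁻¹ Q`. -/
def K (ζ : ℂ) : X →L[ℂ] X := D.TG * D.Y ζ

/-- The inverse of `1 + λ T (H₀ - ζ)⁻¹ Q`. -/
def J (lam ζ : ℂ) : X →L[ℂ] X := Ring.inverse (1 + lam • D.K ζ)

/-- `(H₀ + 1)` times the resolvent of `H₀ + λ T` on the range of `Q`. -/
def W (lam ζ : ℂ) : X →L[ℂ] X := D.Y ζ * D.J lam ζ

/-- The resolvent `(H₀ + λ T - ζ)⁻¹ Q`. -/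
def R (lam ζ : ℂ) : X →L[ℂ] X := D.G * D.W lam ζ

theorem norm_smul_S_lt {ζ : ℂ} (h : ‖ζ‖ < D.c) : ‖ζ • D.S‖ < 1 := by
  rw [norm_smul]
  rcases (norm_nonneg D.S).eq_or_lt with h0 | h0
  · rw [← h0, mul_zero]; exact one_pos
  · exact (mul_lt_mul_of_pos_right h h0).trans_le D.S_norm

theorem Y_apply (ζ : ℂ) (x : X) : D.Y ζ x = -(ζ⁻¹ • D.PΩ x) +
    (D.S (D.U ζ x) + D.Q (D.U ζ x) - D.PΩ (D.U ζ x)) := rfl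

theorem R0_apply (ζ : ℂ) (x : X) : D.R0 ζ x = -(ζ⁻¹ • D.PΩ x) + D.S (D.U ζ x) := by
  change D.G (D.Y ζ x) = _
  rw [Y_apply, map_add, map_neg, map_smul, D.PΩ_apply x, map_smul, D.G_Ω, PΩ_apply, ← D.S_eq]

theorem Q_R0 (ζ : ℂ) (x : X) : D.Q (D.R0 ζ x) = D.R0 ζ x := by
  rw [R0_apply, map_add, map_neg, map_smul, D.Q_S, PΩ_apply, map_smul, D.Q_Ω]

theorem K_apply (ζ : ℂ) (x : X) : D.K ζ x = D.TG (D.Y ζ x) := rfl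

theorem R_apply (lam ζ : ℂ) (x : X) : D.R lam ζ x = D.R0 ζ (D.J lam ζ x) := rfl

theorem Q_R (lam ζ : ℂ) (x : X) : D.Q (D.R lam ζ x) = D.R lam ζ x := by rw [R_apply, D.Q_R0]

variable [CompleteSpace X]

theorem isUnit_one_sub {ζ : ℂ} (h : ‖ζ‖ < D.c) : IsUnit (1 - ζ • D.S) :=
  isUnit_one_sub_of_norm_lt_one (D.norm_smul_S_lt h)

theorem U_apply {ζ : ℂ} (h : ‖ζ‖ < D.c) (x : X) : D.U ζ x = x + ζ • D.S (D.U ζ x) := by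
  have := DFunLike.congr_fun (Ring.mul_inverse_cancel _ (D.isUnit_one_sub h)) x
  change D.U ζ x - ζ • D.S (D.U ζ x) = x at this
  linear_combination (norm := module) this

theorem U_apply' {ζ : ℂ} (h : ‖ζ‖ < D.c) (x : X) : D.U ζ x = x + ζ • D.U ζ (D.S x) := by
  have := DFunLike.congr_fun (Ring.inverse_mul_cancel _ (D.isUnit_one_sub h)) x
  change D.U ζ (x - ζ • D.S x) = x at this
  rw [map_sub, map_smul] at this
  linear_combination (norm := module) this

theorem inner_Ω_U {ζ : ℂ} (h : ‖ζ‖ < D.c) (x : X) :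
    inner ℂ D.Ω (D.U ζ x) = inner ℂ D.Ω x := by
  rw [D.U_apply h, inner_add_right, inner_smul_right, D.inner_S, mul_zero, add_zero]

/-- `(H₀ - ζ) R₀(ζ) = Q`, since `Y(ζ) = (H₀ + 1) R₀(ζ)`. -/
theorem Y_eq {ζ : ℂ} (h0 : ζ ≠ 0) (h : ‖ζ‖ < D.c) (x : X) :
    D.Y ζ x = D.Q x + (1 + ζ) • D.R0 ζ x := by
  have hQ : D.Q (D.U ζ x) = D.Q x + ζ • D.S (D.U ζ x) := by
    conv_lhs => rw [D.U_apply h]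
    rw [map_add, map_smul, D.Q_S]
  rw [R0_apply, Y_apply, hQ, D.PΩ_apply (D.U ζ x), D.inner_Ω_U h, ← PΩ_apply]
  have : ζ * ζ⁻¹ = 1 := mul_inv_cancel₀ h0
  linear_combination (norm := module) this • D.PΩ x

/-- `R₀(ζ)` is a left inverse of `H₀ - ζ`. -/
theorem R0_left {ζ : ℂ} (h0 : ζ ≠ 0) (h : ‖ζ‖ < D.c) (x : X) :
    D.R0 ζ x - (1 + ζ) • D.R0 ζ (D.G x) = D.G (D.Q x) := by
  have hUG : ∀ x, D.U ζ (D.G x) = D.G (D.U ζ x) := fun x => by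
    obtain ⟨u, hu⟩ := D.isUnit_one_sub h
    have hc : Commute (1 - ζ • D.S) D.G := by
      have : Commute D.S D.G := by
        ext x; exact D.S_G x
      exact (Commute.one_left _).sub_left (this.smul_left ζ)
    rw [← hu] at hc
    have := DFunLike.congr_fun hc.units_inv_left.eq x
    rw [U, ← hu, Ring.inverse_unit]
    exact this
  have hRG : D.R0 ζ (D.G x) = D.G (D.R0 ζ x) := by
    rw [R0_apply, R0_apply, hUG, D.S_G, map_add, map_neg, map_smul, PΩ_apply, D.inner_Ω_G,
      PΩ_apply, map_smul, D.G_Ω]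
  have := congrArg D.G (D.Y_eq h0 h x)
  rw [map_add, map_smul] at this
  change D.R0 ζ x = _ at this
  rw [hRG]
  linear_combination (norm := module) this

theorem R0_Q {ζ : ℂ} (h : ‖ζ‖ < D.c) (x : X) : D.R0 ζ (D.Q x) = D.R0 ζ x := by
  have : D.S (D.U ζ (D.Q x)) = D.S (D.U ζ x) := by
    rw [D.U_apply' h, D.S_Q, D.U_apply' h x, map_add, map_add, D.S_Q]
  rw [R0_apply, R0_apply, this, PΩ_apply, PΩ_apply, D.inner_Ω_Q]

theorem Q_K {ζ : ℂ} (h0 : ζ ≠ 0) (h : ‖ζ‖ < D.c) (x : X) : D.Q (D.K ζ x) = D.K ζ x := by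
  rw [K_apply, D.Q_T, D.Y_eq h0 h, map_add, map_smul, D.Q_idem, D.Q_R0]

theorem K_Q {ζ : ℂ} (h0 : ζ ≠ 0) (h : ‖ζ‖ < D.c) (x : X) : D.K ζ (D.Q x) = D.K ζ x := by
  rw [K_apply, K_apply, D.Y_eq h0 h, D.Y_eq h0 h, D.Q_idem, D.R0_Q h]

/-- The points `(λ, ζ)` at which the Neumann series for the perturbed resolvent converges. -/
structure Good (lam ζ : ℂ) : Prop where
  ne_zero : ζ ≠ 0
  lt : ‖ζ‖ < D.c
  norm_lt : ‖lam • D.K ζ‖ < 1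

variable {D} {lam ζ ξ : ℂ}

theorem Good.isUnit (h : D.Good lam ζ) : IsUnit (1 + lam • D.K ζ) := by
  have := isUnit_one_sub_of_norm_lt_one (x := -(lam • D.K ζ)) (by rw [norm_neg]; exact h.norm_lt)
  rwa [sub_neg_eq_add] at this

theorem Good.J_apply (h : D.Good lam ζ) (x : X) :
    D.J lam ζ x = x - lam • D.K ζ (D.J lam ζ x) := by
  have := DFunLike.congr_fun (Ring.mul_inverse_cancel _ h.isUnit) x
  change D.J lam ζ x + lam • D.K ζ (D.J lam ζ x) = x at this
  linear_combination (norm := module) this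

theorem Good.J_apply' (h : D.Good lam ζ) (x : X) :
    D.J lam ζ x = x - lam • D.J lam ζ (D.K ζ x) := by
  have := DFunLike.congr_fun (Ring.inverse_mul_cancel _ h.isUnit) x
  change D.J lam ζ (x + lam • D.K ζ x) = x at this
  rw [map_add, map_smul] at this
  linear_combination (norm := module) this

theorem Good.R_Q (h : D.Good lam ζ) (x : X) : D.R lam ζ (D.Q x) = D.R lam ζ x := by
  rw [R_apply, R_apply, h.J_apply' (D.Q x), h.J_apply' x, D.K_Q h.ne_zero h.lt, map_sub, map_sub,
    D.R0_Q h.lt]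

/-- `(H₀ + λ T - ζ) R(ζ) = Q`. -/
theorem Good.W_eq (h : D.Good lam ζ) (x : X) :
    D.W lam ζ x + lam • D.TG (D.W lam ζ x) = D.Q x + (1 + ζ) • D.R lam ζ x := by
  change D.Y ζ (D.J lam ζ x) + lam • D.K ζ (D.J lam ζ x) = D.Q x + (1 + ζ) • D.R0 ζ (D.J lam ζ x)
  rw [D.Y_eq h.ne_zero h.lt]
  have h1 := congrArg D.Q (h.J_apply x)
  rw [map_sub, map_smul, D.Q_K h.ne_zero h.lt] at h1
  linear_combination (norm := module) h1

/-- `R(ζ) (H₀ + λ T - ζ) = Q`. -/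
theorem Good.R_left (h : D.Good lam ζ) (y : X) :
    D.R lam ζ (y + lam • D.TG y - (1 + ζ) • D.G y) = D.G (D.Q y) := by
  set z := y + lam • D.TG y - (1 + ζ) • D.G y with hz
  have h1 : ∀ x, D.R lam ζ x = D.R0 ζ x - lam • D.R lam ζ (D.K ζ x) := fun x => by
    rw [R_apply, h.J_apply' x, map_sub, map_smul]; rfl
  have h2 := D.R0_left h.ne_zero h.lt y
  have hR0z : D.R0 ζ z = D.G (D.Q y) + lam • D.R0 ζ (D.TG y) := by
    rw [hz, map_sub, map_add, map_smul, map_smul]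
    linear_combination (norm := module) h2
  have hKz : D.K ζ z = D.Q (D.TG y) + lam • D.K ζ (D.TG y) := by
    have h3 : D.Y ζ z = D.Q y + lam • D.Y ζ (D.TG y) := by
      rw [D.Y_eq h.ne_zero h.lt, hR0z, D.Y_eq h.ne_zero h.lt, hz, map_sub, map_add, map_smul,
        map_smul, D.Q_G]
      module
    rw [K_apply, h3, map_add, map_smul, ← D.Q_T]; rfl
  rw [h1, hR0z, hKz, map_add, map_smul, h.R_Q]
  linear_combination (norm := module) -(lam • h1 (D.TG y))

/-- The first resolvent identity. -/
theorem Good.resolvent_identity (hζ : D.Good lam ζ) (hξ : D.Good lam ξ) :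
    D.R lam ζ - D.R lam ξ = (ζ - ξ) • (D.R lam ζ * D.R lam ξ) := by
  ext x
  change D.R lam ζ x - D.R lam ξ x = (ζ - ξ) • D.R lam ζ (D.R lam ξ x)
  have h1 := hζ.R_left (D.W lam ξ x)
  rw [hξ.W_eq x] at h1
  change D.R lam ζ (_ - (1 + ζ) • D.R lam ξ x) = _ at h1
  rw [← D.Q_G] at h1
  change _ = D.Q (D.R lam ξ x) at h1
  rw [Q_R, map_sub, map_add, map_smul, map_smul, hζ.R_Q] at h1
  linear_combination (norm := module) h1

/-- The adjoint of the resolvent. -/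
theorem Good.inner_R (h : D.Good lam ζ)
    (h' : D.Good ((starRingEnd ℂ) lam) ((starRingEnd ℂ) ζ)) (x y : X) :
    inner ℂ (D.R lam ζ x) y =
      inner ℂ x (D.R ((starRingEnd ℂ) lam) ((starRingEnd ℂ) ζ) y) := by
  have e1 : inner ℂ (D.R lam ζ x) y = inner ℂ (D.R lam ζ x) (D.Q y) := by
    rw [← D.Q_symm, Q_R]
  have e2 : inner ℂ x (D.R ((starRingEnd ℂ) lam) ((starRingEnd ℂ) ζ) y) =
      inner ℂ (D.Q x) (D.R ((starRingEnd ℂ) lam) ((starRingEnd ℂ) ζ) y) := by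
    rw [D.Q_symm, Q_R]
  have hx := h.W_eq x
  have hy := h'.W_eq y
  have hx' : D.Q x = D.W lam ζ x + lam • D.TG (D.W lam ζ x) - (1 + ζ) • D.R lam ζ x := by
    rw [hx]; module
  rw [← sub_eq_iff_eq_add] at hy
  rw [e1, e2, hx', ← hy]
  set u := D.W lam ζ x
  set v := D.W ((starRingEnd ℂ) lam) ((starRingEnd ℂ) ζ) y
  have hu : D.R lam ζ x = D.G u := rfl
  have hv : D.R ((starRingEnd ℂ) lam) ((starRingEnd ℂ) ζ) y = D.G v := rfl
  rw [hu, hv]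
  simp only [inner_add_left, inner_add_right, inner_sub_left, inner_sub_right, inner_smul_left,
    inner_smul_right, D.T_symm, D.G_symm, map_add, map_sub, map_smul, map_one]

end GapData

/-! ### Contour integrals -/

section Contour

variable {V V' : Type*} [NormedAddCommGroup V] [NormedSpace ℂ V] [NormedAddCommGroup V']
  [NormedSpace ℂ V']

theorem map_circleIntegral [CompleteSpace V] [CompleteSpace V'] (L : V →L[ℂ] V') {F : ℂ → V}
    {a : ℂ} {r : ℝ} (hF : CircleIntegrable F a r) :
    L (∮ z in C(a, r), F z) = ∮ z in C(a, r), L (F z) := by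
  rw [circleIntegral, circleIntegral, ← L.intervalIntegral_comp_comm hF.out]
  simp only [map_smul]

/-- Termwise integration of a series which is dominated on the circle. -/
theorem hasSum_circleIntegral [CompleteSpace V] {F : ℕ → ℂ → V} {f : ℂ → V} {r : ℝ} (hr : 0 ≤ r)
    {u : ℕ → ℝ} (hu : Summable u) (hF : ∀ n, ContinuousOn (F n) (Metric.sphere 0 r))
    (hb : ∀ n, ∀ z ∈ Metric.sphere (0 : ℂ) r, ‖F n z‖ ≤ u n)
    (hs : ∀ z ∈ Metric.sphere (0 : ℂ) r, HasSum (fun n => F n z) (f z)) :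
    HasSum (fun n => ∮ z in C(0, r), F n z) (∮ z in C(0, r), f z) := by
  refine intervalIntegral.hasSum_integral_of_dominated_convergence (fun n _ => r * u n)
    (fun n => ?_) (fun n => ?_) ?_ ?_ ?_
  · exact ((hF n).circleIntegrable hr).out.def'.1
  · refine Filter.Eventually.of_forall fun θ _ => ?_
    rw [norm_smul]
    simp only [deriv_circleMap, norm_mul, norm_circleMap_zero, Complex.norm_I, mul_one,
      abs_of_nonneg hr]
    exact mul_le_mul_of_nonneg_left (hb n _ (circleMap_mem_sphere _ hr θ)) hr
  · exact Filter.Eventually.of_forall fun _ _ => hu.mul_left r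
  · exact intervalIntegrable_const
  · exact Filter.Eventually.of_forall fun θ _ =>
      (hs _ (circleMap_mem_sphere _ hr θ)).const_smul _

/-- The normalized contour integral `(2πi)⁻¹ ∮ F` over the circle of radius `r` around `0`. -/
def res (r : ℝ) (F : ℂ → V) : V := (2 * Real.pi * Complex.I : ℂ)⁻¹ • ∮ z in C(0, r), F z

theorem map_res [CompleteSpace V] [CompleteSpace V'] (L : V →L[ℂ] V') {F : ℂ → V} {r : ℝ}
    (hF : CircleIntegrable F 0 r) : L (res r F) = res r fun z => L (F z) := by
  rw [res, map_smul, map_circleIntegral L hF, res]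

theorem res_congr {F F' : ℂ → V} {r : ℝ} (hr : 0 ≤ r)
    (h : ∀ z ∈ Metric.sphere (0 : ℂ) r, F z = F' z) : res r F = res r F' := by
  rw [res, res, circleIntegral.integral_congr hr h]

theorem res_add {F F' : ℂ → V} {r : ℝ} (h : CircleIntegrable F 0 r) (h' : CircleIntegrable F' 0 r) :
    res r (fun z => F z + F' z) = res r F + res r F' := by
  rw [res, circleIntegral.integral_add h h', smul_add, res, res]

theorem res_sub {F F' : ℂ → V} {r : ℝ} (h : CircleIntegrable F 0 r) (h' : CircleIntegrable F' 0 r) :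
    res r (fun z => F z - F' z) = res r F - res r F' := by
  rw [res, circleIntegral.integral_sub h h', smul_sub, res, res]

theorem res_smul (a : ℂ) (F : ℂ → V) (r : ℝ) : res r (fun z => a • F z) = a • res r F := by
  rw [res, circleIntegral.integral_smul, smul_comm, res]

theorem res_eq_zero {F : ℂ → V} {r : ℝ} (hr : 0 ≤ r)
    (h : ∀ z ∈ Metric.closedBall (0 : ℂ) r, DifferentiableAt ℂ F z) : res r F = 0 := by
  rw [res, Complex.circleIntegral_eq_zero_of_differentiable_on_off_countable hr Set.countable_empty
    (fun z hz => (h z hz).continuousAt.continuousWithinAt)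
    fun z hz => h z (Metric.ball_subset_closedBall hz.1), smul_zero]

theorem res_const (v : V) {r : ℝ} (hr : 0 ≤ r) : res r (fun _ => v) = 0 :=
  res_eq_zero hr fun _ _ => differentiableAt_const v

theorem res_zpow_smul [CompleteSpace V] (m : ℤ) (v : V) {r : ℝ} (hr : 0 < r) :
    res r (fun z => z ^ m • v) = if m = -1 then v else 0 := by
  rw [res, circleIntegral.integral_smul_const]
  split_ifs with h
  · have := circleIntegral.integral_sub_center_inv 0 hr.ne'
    simp only [sub_zero] at this
    simp only [h, zpow_neg_one, this]
    rw [smul_smul, inv_mul_cancel₀ Complex.two_pi_I_ne_zero, one_smul]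
  · have := circleIntegral.integral_sub_zpow_of_ne h 0 0 r
    simp only [sub_zero] at this
    rw [this, zero_smul, smul_zero]

end Contour

/-! ### The eigenprojection as a contour integral of the resolvent -/

namespace GapData

variable {X : Type*} [NormedAddCommGroup X] [InnerProductSpace ℂ X] (D : GapData X)

/-- The projection `-(2πi)⁻¹ ∮ (H₀ + λ T - ζ)⁻¹ Q dζ`. -/
def P (lam : ℂ) : X →L[ℂ] X := -res (D.c / 2) (D.R lam)

/-- `(H₀ + 1) P`. -/
def P1 (lam : ℂ) : X →L[ℂ] X := -res (D.c / 2) (D.W lam)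

/-- `(H₀ + λ T) P`. -/
def HP (lam : ℂ) : X →L[ℂ] X := -res (D.c / 2) fun ζ => ζ • D.R lam ζ

variable [CompleteSpace X]

/-- A radius such that for `|λ| < ρ` the Neumann series converges for `c/4 ≤ |ζ| ≤ c/2`. -/
def Admissible (ρ : ℝ) : Prop :=
  0 < ρ ∧ ∀ ζ : ℂ, D.c / 4 ≤ ‖ζ‖ → ‖ζ‖ ≤ D.c / 2 → ρ * ‖D.K ζ‖ ≤ 1 / 2

theorem differentiableAt_U {ζ : ℂ} (h : ‖ζ‖ < D.c) : DifferentiableAt ℂ D.U ζ :=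
  (differentiableAt_inverse (D.isUnit_one_sub h)).comp ζ
    ((differentiableAt_const _).sub (differentiableAt_id.smul_const D.S))

theorem differentiableAt_Y {ζ : ℂ} (h0 : ζ ≠ 0) (h : ‖ζ‖ < D.c) : DifferentiableAt ℂ D.Y ζ :=
  (((differentiableAt_inv h0).smul_const D.PΩ).neg).add
    ((differentiableAt_const (D.S + D.Q - D.PΩ)).mul (D.differentiableAt_U h))

theorem differentiableAt_K {ζ : ℂ} (h0 : ζ ≠ 0) (h : ‖ζ‖ < D.c) : DifferentiableAt ℂ D.K ζ :=
  (differentiableAt_const D.TG).mul (D.differentiableAt_Y h0 h)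

theorem exists_admissible : ∃ ρ, D.Admissible ρ := by
  have hc := D.c_pos
  have hcomp : IsCompact (Metric.closedBall (0 : ℂ) (D.c / 2) \ Metric.ball 0 (D.c / 4)) :=
    (isCompact_closedBall _ _).diff Metric.isOpen_ball
  obtain ⟨M, hM⟩ := hcomp.exists_bound_of_continuousOn (f := D.K) fun ζ hζ => by
    simp only [Set.mem_sdiff, Metric.mem_closedBall, dist_zero_right, Metric.mem_ball,
      not_lt] at hζ
    refine (D.differentiableAt_K ?_ (by linarith)).continuousAt.continuousWithinAt
    rintro rfl
    rw [norm_zero] at hζ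
    linarith
  refine ⟨1 / (2 * (|M| + 1)), by positivity, fun ζ h1 h2 => ?_⟩
  have hK : ‖D.K ζ‖ ≤ |M| + 1 := by
    have := hM ζ (by simpa using ⟨h2, h1⟩)
    linarith [le_abs_self M]
  rw [div_mul_eq_mul_div, one_mul, div_le_div_iff₀ (by positivity) (by norm_num)]
  linarith

variable {D} {ρ : ℝ} {lam : ℂ}

theorem Admissible.norm_le (h : D.Admissible ρ) (hl : ‖lam‖ < ρ) {ζ : ℂ} (h1 : D.c / 4 ≤ ‖ζ‖)
    (h2 : ‖ζ‖ ≤ D.c / 2) : ‖lam • D.K ζ‖ ≤ 1 / 2 := by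
  rw [norm_smul]
  exact (mul_le_mul_of_nonneg_right hl.le (norm_nonneg _)).trans (h.2 ζ h1 h2)

theorem Admissible.good (h : D.Admissible ρ) (hl : ‖lam‖ < ρ) {ζ : ℂ} (h1 : D.c / 4 ≤ ‖ζ‖)
    (h2 : ‖ζ‖ ≤ D.c / 2) : D.Good lam ζ where
  ne_zero := by
    rintro rfl
    rw [norm_zero] at h1
    linarith [D.c_pos]
  lt := by linarith [D.c_pos]
  norm_lt := (h.norm_le hl h1 h2).trans_lt (by norm_num)

theorem Admissible.good_sphere (h : D.Admissible ρ) (hl : ‖lam‖ < ρ) {ζ : ℂ}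
    (hζ : ζ ∈ Metric.sphere (0 : ℂ) (D.c / 2)) : D.Good lam ζ := by
  rw [mem_sphere_zero_iff_norm] at hζ
  exact h.good hl (by linarith [D.c_pos]) hζ.le

theorem Good.differentiableAt_W {ζ : ℂ} (h : D.Good lam ζ) : DifferentiableAt ℂ (D.W lam) ζ :=
  (D.differentiableAt_Y h.ne_zero h.lt).mul ((differentiableAt_inverse h.isUnit).comp ζ
    ((differentiableAt_const _).add ((D.differentiableAt_K h.ne_zero h.lt).const_smul lam)))

theorem Good.differentiableAt_R {ζ : ℂ} (h : D.Good lam ζ) : DifferentiableAt ℂ (D.R lam) ζ :=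
  (differentiableAt_const D.G).mul h.differentiableAt_W

theorem Admissible.continuousOn_R (h : D.Admissible ρ) (hl : ‖lam‖ < ρ) :
    ContinuousOn (D.R lam) (Metric.sphere 0 (D.c / 2)) := fun _ hζ =>
  (h.good_sphere hl hζ).differentiableAt_R.continuousAt.continuousWithinAt

theorem Admissible.circleIntegrable_R (h : D.Admissible ρ) (hl : ‖lam‖ < ρ) :
    CircleIntegrable (D.R lam) 0 (D.c / 2) :=
  (h.continuousOn_R hl).circleIntegrable (by linarith [D.c_pos])

theorem Admissible.circleIntegrable_W (h : D.Admissible ρ) (hl : ‖lam‖ < ρ) :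
    CircleIntegrable (D.W lam) 0 (D.c / 2) :=
  ContinuousOn.circleIntegrable (by linarith [D.c_pos]) fun _ hζ =>
    (h.good_sphere hl hζ).differentiableAt_W.continuousAt.continuousWithinAt

theorem Admissible.circleIntegrable_smul_R (h : D.Admissible ρ) (hl : ‖lam‖ < ρ) :
    CircleIntegrable (fun ζ => ζ • D.R lam ζ) 0 (D.c / 2) :=
  ContinuousOn.circleIntegrable (by linarith [D.c_pos])
    (continuousOn_id.smul (h.continuousOn_R hl))

/-- `P1` is `(H₀ + 1) P`; in particular the range of `P` lies in the domain of `H₀`. -/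
theorem Admissible.P_eq (h : D.Admissible ρ) (hl : ‖lam‖ < ρ) (x : X) :
    D.P lam x = D.G (D.P1 lam x) := by
  have := map_res (ContinuousLinearMap.mul ℂ (X →L[ℂ] X) D.G) (h.circleIntegrable_W hl)
  have h2 : D.P lam = D.G * D.P1 lam := by
    rw [P, P1, mul_neg]
    exact congrArg Neg.neg this.symm
  rw [h2]; rfl

/-- `HP` is `(H₀ + λ T) P`: integrate `(H₀ + λ T - ζ) R(ζ) = Q`. -/
theorem Admissible.P1_eq (h : D.Admissible ρ) (hl : ‖lam‖ < ρ) (x : X) :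
    D.P1 lam x + lam • D.TG (D.P1 lam x) = D.P lam x + D.HP lam x := by
  have hr : 0 ≤ D.c / 2 := by linarith [D.c_pos]
  have e1 := map_res ((1 : (X →L[ℂ] X) →L[ℂ] (X →L[ℂ] X)) +
    lam • ContinuousLinearMap.mul ℂ (X →L[ℂ] X) D.TG) (h.circleIntegrable_W hl)
  have e2 : res (D.c / 2) (fun z => ((1 : (X →L[ℂ] X) →L[ℂ] (X →L[ℂ] X)) +
      lam • ContinuousLinearMap.mul ℂ (X →L[ℂ] X) D.TG) (D.W lam z)) =
      res (D.c / 2) (D.R lam) + res (D.c / 2) fun ζ => ζ • D.R lam ζ := by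
    rw [← zero_add (res (D.c / 2) (D.R lam)), ← res_const D.Q hr,
      ← res_add (circleIntegrable_const _ _ _) (h.circleIntegrable_R hl),
      ← res_add (F := fun z => D.Q + D.R lam z)
        ((circleIntegrable_const _ _ _).add (h.circleIntegrable_R hl))
        (h.circleIntegrable_smul_R hl)]
    refine res_congr hr fun z hz => ?_
    ext y
    have := (h.good_sphere hl hz).W_eq y
    change D.W lam z y + lam • D.TG (D.W lam z y) = D.Q y + D.R lam z y + z • D.R lam z y
    rw [this]
    module
  rw [e2] at e1
  have e3 := congrArg (fun A : X →L[ℂ] X => -(A x)) e1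
  change -(res (D.c / 2) (D.W lam) x + lam • D.TG (res (D.c / 2) (D.W lam) x)) = _ at e3
  have e4 : D.P1 lam x = -(res (D.c / 2) (D.W lam) x) := rfl
  rw [e4, map_neg, smul_neg, ← neg_add, e3]
  have e5 : D.P lam x = -(res (D.c / 2) (D.R lam) x) := rfl
  have e6 : D.HP lam x = -((res (D.c / 2) fun ζ => ζ • D.R lam ζ) x) := rfl
  rw [e5, e6, add_apply, neg_add]

/-- The projection commutes with `H₀ + λ T`. -/
theorem Admissible.P_H (h : D.Admissible ρ) (hl : ‖lam‖ < ρ) (y : X) :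
    D.P lam (y + lam • D.TG y - D.G y) = D.HP lam (D.G y) := by
  have hr : 0 ≤ D.c / 2 := by linarith [D.c_pos]
  have e1 := map_res (ContinuousLinearMap.apply ℂ X (y + lam • D.TG y - D.G y))
    (h.circleIntegrable_R hl)
  have e2 := map_res (ContinuousLinearMap.apply ℂ X (D.G y)) (h.circleIntegrable_smul_R hl)
  have hi : CircleIntegrable (fun z => z • D.R lam z (D.G y)) 0 (D.c / 2) :=
    ContinuousOn.circleIntegrable hr
      (continuousOn_id.smul ((h.continuousOn_R hl).clm_apply continuousOn_const))
  have e3 : res (D.c / 2) (fun z => D.R lam z (y + lam • D.TG y - D.G y)) =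
      res (D.c / 2) fun z => z • D.R lam z (D.G y) := by
    rw [← zero_add (res (D.c / 2) fun z => z • D.R lam z (D.G y)), ← res_const (D.G (D.Q y)) hr,
      ← res_add (circleIntegrable_const _ _ _) hi]
    refine res_congr hr fun z hz => ?_
    have := (h.good_sphere hl hz).R_left y
    rw [← this, ← map_smul (D.R lam z) z, ← map_add (D.R lam z)]
    congr 1
    module
  exact congrArg Neg.neg ((e1.trans e3).trans e2.symm)

theorem Admissible.Q_P (h : D.Admissible ρ) (hl : ‖lam‖ < ρ) (x : X) :
    D.Q (D.P lam x) = D.P lam x := by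
  have e := map_res (ContinuousLinearMap.mul ℂ (X →L[ℂ] X) D.Q) (h.circleIntegrable_R hl)
  have e2 : D.Q * D.P lam = D.P lam := by
    rw [P, mul_neg]
    refine congrArg Neg.neg (e.trans (res_congr (by linarith [D.c_pos]) fun z hz => ?_))
    ext x
    exact D.Q_R lam z x
  exact DFunLike.congr_fun e2 x

/-- By the resolvent identity, `P R(ξ) = R(ξ) - A(ξ)` with the Cauchy integral `A` of the
resolvent. -/
theorem Admissible.P_mul_R (h : D.Admissible ρ) (hl : ‖lam‖ < ρ) {ξ : ℂ} (h1 : D.c / 4 ≤ ‖ξ‖)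
    (h2 : ‖ξ‖ < D.c / 2) : D.P lam * D.R lam ξ =
      D.R lam ξ - res (D.c / 2) fun z => (z - ξ)⁻¹ • D.R lam z := by
  have hr : 0 ≤ D.c / 2 := by linarith [D.c_pos]
  have hne : ∀ z ∈ Metric.sphere (0 : ℂ) (D.c / 2), z - ξ ≠ 0 := fun z hz h0 => by
    rw [mem_sphere_zero_iff_norm, sub_eq_zero.1 h0] at hz
    linarith
  have hc : ContinuousOn (fun z : ℂ => (z - ξ)⁻¹) (Metric.sphere 0 (D.c / 2)) :=
    (continuousOn_id.sub continuousOn_const).inv₀ hne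
  have hg := h.good hl h1 h2.le
  have e := map_res ((ContinuousLinearMap.mul ℂ (X →L[ℂ] X)).flip (D.R lam ξ))
    (h.circleIntegrable_R hl)
  have e2 : res (D.c / 2) (fun z => D.R lam z * D.R lam ξ) =
      (res (D.c / 2) fun z => (z - ξ)⁻¹ • D.R lam z) - D.R lam ξ := by
    have e3 : res (D.c / 2) (fun z => (z - ξ)⁻¹ • D.R lam ξ) = D.R lam ξ := by
      rw [res, circleIntegral.integral_smul_const,
        circleIntegral.integral_sub_inv_of_mem_ball (by simpa using h2), smul_smul,
        inv_mul_cancel₀ Complex.two_pi_I_ne_zero, one_smul]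
    conv_rhs => rw [← e3]
    rw [← res_sub (F := fun z => (z - ξ)⁻¹ • D.R lam z) (F' := fun z => (z - ξ)⁻¹ • D.R lam ξ)
      ((hc.smul (h.continuousOn_R hl)).circleIntegrable hr)
      ((hc.smul continuousOn_const).circleIntegrable hr)]
    refine res_congr hr fun z hz => ?_
    rw [← smul_sub, (h.good_sphere hl hz).resolvent_identity hg, smul_smul,
      inv_mul_cancel₀ (hne z hz), one_smul]
  rw [P, neg_mul]
  exact (congrArg Neg.neg (e.trans e2)).trans (neg_sub _ _)

/-- `P` is a projection. One factor `P` is written as an integral over the circle of radius `c / 4`,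
inside the circle of radius `c / 2` that defines the other one. -/
theorem Admissible.P_idem (h : D.Admissible ρ) (hl : ‖lam‖ < ρ) :
    D.P lam * D.P lam = D.P lam := by
  have hc := D.c_pos
  have hr : 0 ≤ D.c / 4 := by linarith
  have hsph : ∀ z ∈ Metric.sphere (0 : ℂ) (D.c / 4), ‖z‖ = D.c / 4 := fun z hz => by simpa using hz
  have hgood : ∀ z ∈ Metric.sphere (0 : ℂ) (D.c / 4), D.Good lam z := fun z hz =>
    h.good hl (hsph z hz).ge (by rw [hsph z hz]; linarith)
  have hcont : ContinuousOn (D.R lam) (Metric.sphere 0 (D.c / 4)) := fun z hz =>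
    (hgood z hz).differentiableAt_R.continuousAt.continuousWithinAt
  have hP : D.P lam = -res (D.c / 4) (D.R lam) := by
    rw [P, res, res, Complex.circleIntegral_eq_of_differentiable_on_annulus_off_countable
      (r := D.c / 4) (by linarith) (by linarith) Set.countable_empty]
    · intro z hz
      simp only [Set.mem_sdiff, Metric.mem_closedBall, dist_zero_right, Metric.mem_ball,
        not_lt] at hz
      exact (h.good hl hz.2 hz.1).differentiableAt_R.continuousAt.continuousWithinAt
    · rintro z ⟨hz, -⟩
      simp only [Set.mem_sdiff, Metric.mem_closedBall, dist_zero_right, Metric.mem_ball,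
        not_le] at hz
      exact (h.good hl hz.2.le hz.1.le).differentiableAt_R
  -- The Cauchy integral over the outer circle is holomorphic inside and integrates to `0`.
  set A : ℂ → X →L[ℂ] X := fun ξ => res (D.c / 2) fun z => (z - ξ)⁻¹ • D.R lam z with hA
  have hAd : ∀ ξ ∈ Metric.closedBall (0 : ℂ) (D.c / 4), DifferentiableAt ℂ A ξ := fun ξ hξ => by
    have hps := hasFPowerSeriesOn_cauchy_integral (R := (⟨D.c / 2, by linarith⟩ : NNReal))
      (h.circleIntegrable_R hl)
      (NNReal.coe_pos.1 (show 0 < D.c / 2 by linarith))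
    refine (hps.analyticAt_of_mem ?_).differentiableAt
    rw [Metric.mem_closedBall, dist_zero_right] at hξ
    rw [Metric.mem_eball, edist_zero_right, ← ofReal_norm]
    refine (ENNReal.ofReal_lt_ofReal_iff (by linarith)).2 (lt_of_le_of_lt hξ ?_) |>.trans_eq
      (ENNReal.ofReal_eq_coe_nnreal (by linarith : 0 ≤ D.c / 2))
    linarith
  have hAc : ContinuousOn A (Metric.sphere 0 (D.c / 4)) := fun z hz =>
    (hAd z (Metric.sphere_subset_closedBall hz)).continuousAt.continuousWithinAt
  have e := map_res (ContinuousLinearMap.mul ℂ (X →L[ℂ] X) (D.P lam))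
    (hcont.circleIntegrable hr)
  have e2 : res (D.c / 4) (fun z => D.P lam * D.R lam z) = res (D.c / 4) (D.R lam) := by
    rw [res_congr hr fun z hz => h.P_mul_R hl (hsph z hz).ge
      (by rw [hsph z hz]; linarith), res_sub (hcont.circleIntegrable hr) (hAc.circleIntegrable hr),
      res_eq_zero hr hAd, sub_zero]
  conv_lhs => rw [hP, mul_neg]
  rw [← hP]
  conv_rhs => rw [hP]
  exact congrArg Neg.neg (e.trans e2)

end GapData

/-! ### The Rayleigh–Schrödinger series -/

theorem hasSum_pow_inverse_one_sub {A : Type*} [NormedRing A] [CompleteSpace A] (t : A)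
    (h : ‖t‖ < 1) : HasSum (fun n : ℕ => t ^ n) (Ring.inverse (1 - t)) := by
  have hs : Summable fun n : ℕ => t ^ n := summable_geometric_of_norm_lt_one h
  have h1 : (1 - t) * ∑' n : ℕ, t ^ n = 1 := hs.one_sub_mul_tsum_pow
  have h2 : Ring.inverse (1 - t) = ∑' n : ℕ, t ^ n := calc
    Ring.inverse (1 - t) = Ring.inverse (1 - t) * ((1 - t) * ∑' n : ℕ, t ^ n) := by
      rw [h1, mul_one]
    _ = ∑' n : ℕ, t ^ n := by
      rw [← mul_assoc, Ring.inverse_mul_cancel _ (isUnit_one_sub_of_norm_lt_one h), one_mul]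
  rw [h2]
  exact hs.hasSum

namespace GapData

variable {X : Type*} [NormedAddCommGroup X] [InnerProductSpace ℂ X] (D : GapData X)

theorem norm_pow_le_pow (A : X →L[ℂ] X) (n : ℕ) : ‖A ^ n‖ ≤ ‖A‖ ^ n := by
  induction n with
  | zero => simpa using! ContinuousLinearMap.norm_id_le (𝕜 := ℂ) (E := X)
  | succ n ih =>
    rw [pow_succ, pow_succ]
    exact (norm_mul_le _ _).trans (mul_le_mul_of_nonneg_right ih (norm_nonneg _))

/-- The operators `(H₀ + 1) S^{(ν)}`. -/
def V : ℕ → (X →L[ℂ] X)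
  | 0 => -D.PΩ
  | ν + 1 => (D.S + D.Q - D.PΩ) * D.S ^ ν

/-- The products `(H₀ + 1) S^{(ν₁)} T S^{(ν₂)} ⋯ T S^{(νₙ₊₁)}`. -/
def vprod : (n : ℕ) → (Fin (n + 1) → ℕ) → (X →L[ℂ] X)
  | 0, ν => D.V (ν 0)
  | n + 1, ν => D.V (ν 0) * (D.TG * vprod n (Fin.tail ν))

/-- The sums of the products `(H₀ + 1) S^{(ν₁)} T ⋯ T S^{(νₙ₊₁)}` with `ν₁ + ⋯ + νₙ₊₁ = N`. -/
def vcoef (n N : ℕ) : X →L[ℂ] X := ∑ ν ∈ Finset.Nat.antidiagonalTuple (n + 1) N, D.vprod n ν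

theorem vcoef_zero (N : ℕ) : D.vcoef 0 N = D.V N := by
  rw [vcoef, Finset.Nat.antidiagonalTuple_one, Finset.sum_singleton]
  rfl

/-- The recursion for `vcoef`: split off the first factor. -/
theorem vcoef_succ (n N : ℕ) : D.vcoef (n + 1) N =
    ∑ p ∈ Finset.HasAntidiagonal.antidiagonal N, D.V p.1 * (D.TG * D.vcoef n p.2) := by
  simp only [vcoef, Finset.mul_sum]
  rw [Finset.sum_sigma']
  refine Finset.sum_bij'
    (fun ν _ => ⟨(ν 0, ∑ i, Fin.tail (α := fun _ => ℕ) ν i), Fin.tail (α := fun _ => ℕ) ν⟩)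
    (fun q _ => Fin.cons (α := fun _ => ℕ) q.1.1 q.2) ?_ ?_ ?_ ?_ ?_
  · intro ν hν
    rw [Finset.Nat.mem_antidiagonalTuple, Fin.sum_univ_succ] at hν
    simp only [Finset.mem_sigma, Finset.HasAntidiagonal.mem_antidiagonal,
      Finset.Nat.mem_antidiagonalTuple, and_true]
    exact hν
  · rintro ⟨⟨i, j⟩, ν⟩ h
    simp only [Finset.mem_sigma, Finset.HasAntidiagonal.mem_antidiagonal,
      Finset.Nat.mem_antidiagonalTuple] at h
    rw [Finset.Nat.mem_antidiagonalTuple, Fin.sum_univ_succ]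
    simp only [Fin.cons_zero, Fin.cons_succ, h.2, h.1]
  · intro ν _
    simp
  · rintro ⟨⟨i, j⟩, ν⟩ h
    simp only [Finset.mem_sigma, Finset.HasAntidiagonal.mem_antidiagonal,
      Finset.Nat.mem_antidiagonalTuple] at h
    simp only [Fin.cons_zero, Fin.tail_cons, h.2]
  · intro ν _
    rfl

/-- The coefficients of the power series of the eigenprojection. -/
def Pc (n : ℕ) : X →L[ℂ] X := (-1 : ℂ) ^ (n + 1) • (D.G * D.vcoef n n)

theorem Pc_zero : D.Pc 0 = D.PΩ := by
  rw [Pc, vcoef_zero, V]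
  ext x
  simp [PΩ_apply, D.G_Ω]

variable [CompleteSpace X]

/-- The Laurent expansion `ζ (H₀ - ζ)⁻¹ Q = ∑ ζ^ν S^{(ν)}`, multiplied by `H₀ + 1`. -/
theorem hasSum_V {ζ : ℂ} (h0 : ζ ≠ 0) (h : ‖ζ‖ < D.c) :
    (Summable fun ν => ‖ζ ^ ν • D.V ν‖) ∧ HasSum (fun ν => ζ ^ ν • D.V ν) (ζ • D.Y ζ) := by
  have hlt := D.norm_smul_S_lt h
  have e : ∀ ν, ζ ^ (ν + 1) • D.V (ν + 1) =
      ζ • ((D.S + D.Q - D.PΩ) * (ζ • D.S) ^ ν) := fun ν => by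
    rw [V, smul_pow, mul_smul_comm, smul_smul, ← pow_succ']
  constructor
  · rw [← summable_nat_add_iff 1]
    refine Summable.of_nonneg_of_le (fun _ => norm_nonneg _) (fun ν => ?_)
      ((summable_geometric_of_lt_one (norm_nonneg _) hlt).mul_left
        (‖ζ‖ * ‖D.S + D.Q - D.PΩ‖))
    rw [e, norm_smul, mul_assoc]
    refine mul_le_mul_of_nonneg_left ((norm_mul_le _ _).trans ?_) (norm_nonneg _)
    exact mul_le_mul_of_nonneg_left (norm_pow_le_pow _ _) (norm_nonneg _)
  · rw [← hasSum_nat_add_iff' 1]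
    simp only [e, Finset.range_one, Finset.sum_singleton, pow_zero, one_smul]
    have := ((hasSum_pow_inverse_one_sub (ζ • D.S) hlt).mul_left (D.S + D.Q - D.PΩ)).const_smul ζ
    have hY : ζ • D.Y ζ = -(D.PΩ) + ζ • ((D.S + D.Q - D.PΩ) * Ring.inverse (1 - ζ • D.S)) := by
      change ζ • (-(ζ⁻¹ • D.PΩ) + (D.S + D.Q - D.PΩ) * Ring.inverse (1 - ζ • D.S)) = _
      rw [smul_add, smul_neg, smul_smul, mul_inv_cancel₀ h0, one_smul]
    rw [hY, V]
    simpa using this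

/-- The Laurent expansion of `(H₀ - ζ)⁻¹ Q (T (H₀ - ζ)⁻¹ Q)ⁿ`, multiplied by `H₀ + 1`, as a Cauchy
product. -/
theorem hasSum_vcoef {ζ : ℂ} (h0 : ζ ≠ 0) (h : ‖ζ‖ < D.c) (n : ℕ) :
    (Summable fun N => ‖ζ ^ N • D.vcoef n N‖) ∧
      HasSum (fun N => ζ ^ N • D.vcoef n N) (ζ ^ (n + 1) • (D.Y ζ * D.K ζ ^ n)) := by
  obtain ⟨hV1, hV2⟩ := D.hasSum_V h0 h
  induction n with
  | zero => simpa [vcoef_zero] using! ⟨hV1, hV2⟩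
  | succ n ih =>
    obtain ⟨ih1, ih2⟩ := ih
    have hg : Summable fun N => ‖D.TG * (ζ ^ N • D.vcoef n N)‖ :=
      Summable.of_nonneg_of_le (fun _ => norm_nonneg _) (fun N => norm_mul_le _ _)
        (ih1.mul_left ‖D.TG‖)
    have e : ∀ N, ∑ p ∈ Finset.HasAntidiagonal.antidiagonal N,
        ζ ^ p.1 • D.V p.1 * (D.TG * (ζ ^ p.2 • D.vcoef n p.2)) = ζ ^ N • D.vcoef (n + 1) N := by
      intro N
      rw [vcoef_succ, Finset.smul_sum]
      refine Finset.sum_congr rfl fun p hp => ?_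
      rw [← Finset.HasAntidiagonal.mem_antidiagonal.1 hp, mul_smul_comm, smul_mul_smul_comm,
        pow_add]
    have h1 := summable_norm_sum_mul_antidiagonal_of_summable_norm hV1 hg
    have h2 := tsum_mul_tsum_eq_tsum_sum_antidiagonal_of_summable_norm hV1 hg
    simp only [e] at h1 h2
    refine ⟨h1, ?_⟩
    have h3 := h1.of_norm.hasSum
    rw [← h2, hV2.tsum_eq, (ih2.mul_left D.TG).tsum_eq] at h3
    have h4 : ζ ^ (n + 1 + 1) • (D.Y ζ * D.K ζ ^ (n + 1)) =
        ζ • D.Y ζ * (D.TG * ζ ^ (n + 1) • (D.Y ζ * D.K ζ ^ n)) := by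
      rw [mul_smul_comm, smul_mul_smul_comm, ← pow_succ' ζ, pow_succ' (D.K ζ), K]
      simp only [mul_assoc]
    rw [h4]
    exact h3

/-- The residue of the `n`-th term of the Neumann series collects the products with
`ν₁ + ⋯ + νₙ₊₁ = n`. -/
theorem res_Y_mul_K_pow (n : ℕ) :
    res (D.c / 2) (fun ζ => D.Y ζ * D.K ζ ^ n) = D.vcoef n n := by
  have hc := D.c_pos
  have hr : 0 < D.c / 2 := by linarith
  have hn : ∀ ζ ∈ Metric.sphere (0 : ℂ) (D.c / 2), ‖ζ‖ = D.c / 2 := fun ζ hζ => by simpa using hζ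
  have hne : ∀ ζ ∈ Metric.sphere (0 : ℂ) (D.c / 2), ζ ≠ 0 := fun ζ hζ h0 => by
    have := hn ζ hζ
    rw [h0, norm_zero] at this
    linarith
  set F : ℕ → ℂ → (X →L[ℂ] X) := fun N ζ => ζ ^ ((N : ℤ) - (n + 1 : ℕ)) • D.vcoef n N with hF
  have hFe : ∀ N, ∀ ζ ∈ Metric.sphere (0 : ℂ) (D.c / 2),
      F N ζ = (ζ ^ (n + 1))⁻¹ • ζ ^ N • D.vcoef n N := fun N ζ hζ => by
    rw [hF, smul_smul]
    simp only
    rw [zpow_sub₀ (hne ζ hζ), zpow_natCast, zpow_natCast, div_eq_inv_mul]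
  have hr' : ((D.c / 2 : ℝ) : ℂ) ∈ Metric.sphere (0 : ℂ) (D.c / 2) := by
    simp [abs_of_pos hc]
  have hs := hasSum_circleIntegral hr.le (F := F) (f := fun ζ => D.Y ζ * D.K ζ ^ n)
    (u := fun N => ((D.c / 2) ^ (n + 1))⁻¹ * ‖((D.c / 2 : ℝ) : ℂ) ^ N • D.vcoef n N‖)
    ((D.hasSum_vcoef (hne _ hr') (by rw [hn _ hr']; linarith) n).1.mul_left _)
    (fun N ζ hζ => ((continuousAt_zpow₀ ζ _ (Or.inl (hne ζ hζ))).smul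
      continuousAt_const).continuousWithinAt)
    (fun N ζ hζ => by
      rw [hFe N ζ hζ, norm_smul, norm_smul, norm_smul, norm_inv, norm_pow, norm_pow, hn ζ hζ,
        norm_pow, hn _ hr'])
    (fun ζ hζ => by
      have := (D.hasSum_vcoef (hne ζ hζ) (by rw [hn ζ hζ]; linarith) n).2.const_smul
        (ζ ^ (n + 1))⁻¹
      rw [smul_smul, inv_mul_cancel₀ (pow_ne_zero _ (hne ζ hζ)), one_smul] at this
      simpa only [hFe _ ζ hζ] using this)
  have hs2 := hs.const_smul (2 * Real.pi * Complex.I : ℂ)⁻¹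
  have e : ∀ N, (2 * Real.pi * Complex.I : ℂ)⁻¹ • (∮ z in C(0, D.c / 2), F N z) =
      if N = n then D.vcoef n n else 0 := fun N => by
    refine (res_zpow_smul _ _ hr).trans ?_
    by_cases h : N = n
    · subst h
      rw [if_pos (by push_cast; ring), if_pos rfl]
    · rw [if_neg (by push_cast; omega), if_neg h]
  simp only [e] at hs2
  exact hs2.unique (hasSum_ite_eq n _)

variable {D} {ρ : ℝ} {lam : ℂ}

/-- The Rayleigh–Schrödinger series of the eigenprojection: integrate the Neumann series of the
resolvent term by term. -/
theorem Admissible.hasSum_P (h : D.Admissible ρ) (hl : ‖lam‖ < ρ) :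
    HasSum (fun n => lam ^ n • D.Pc n) (D.P lam) := by
  have hc := D.c_pos
  have hr : 0 < D.c / 2 := by linarith
  have hn : ∀ ζ ∈ Metric.sphere (0 : ℂ) (D.c / 2), ‖ζ‖ = D.c / 2 := fun ζ hζ => by simpa using hζ
  have hYc : ContinuousOn D.Y (Metric.sphere 0 (D.c / 2)) := fun ζ hζ =>
    (D.differentiableAt_Y (h.good_sphere hl hζ).ne_zero
      (h.good_sphere hl hζ).lt).continuousAt.continuousWithinAt
  have hKc : ContinuousOn D.K (Metric.sphere 0 (D.c / 2)) := continuousOn_const.mul hYc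
  obtain ⟨M, hM⟩ := (isCompact_sphere (0 : ℂ) (D.c / 2)).exists_bound_of_continuousOn hYc
  set F : ℕ → ℂ → (X →L[ℂ] X) := fun n ζ => (-lam) ^ n • (D.Y ζ * D.K ζ ^ n) with hF
  have hFe : ∀ n ζ, F n ζ = D.Y ζ * (-(lam • D.K ζ)) ^ n := fun n ζ => by
    rw [← neg_smul, smul_pow, mul_smul_comm]
  have hFc : ∀ n, ContinuousOn (F n) (Metric.sphere 0 (D.c / 2)) := fun n =>
    ContinuousOn.congr (continuousOn_const (c := (-lam) ^ n) |>.smul (hYc.mul (hKc.pow n)))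
      fun _ _ => rfl
  have hs := hasSum_circleIntegral hr.le (F := F) (f := D.W lam)
    (u := fun n => M * (1 / 2) ^ n)
    ((summable_geometric_of_lt_one (by norm_num) (by norm_num)).mul_left M) hFc
    (fun n ζ hζ => by
      rw [hFe]
      refine (norm_mul_le _ _).trans (mul_le_mul (hM ζ hζ) ?_ (norm_nonneg _)
        ((norm_nonneg _).trans (hM ζ hζ)))
      refine (norm_pow_le_pow _ _).trans (pow_le_pow_left₀ (norm_nonneg _) ?_ n)
      rw [norm_neg]
      exact h.norm_le hl (by rw [hn ζ hζ]; linarith) (hn ζ hζ).le)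
    (fun ζ hζ => by
      have := (hasSum_pow_inverse_one_sub (-(lam • D.K ζ))
        (by rw [norm_neg]; exact (h.good_sphere hl hζ).norm_lt)).mul_left (D.Y ζ)
      rw [sub_neg_eq_add] at this
      simp only [hFe]
      exact this)
  have hs2 := ((hs.const_smul (2 * Real.pi * Complex.I : ℂ)⁻¹).neg).mul_left D.G
  have e1 : D.G * -((2 * Real.pi * Complex.I : ℂ)⁻¹ • ∮ z in C(0, D.c / 2), D.W lam z) =
      D.P lam := by
    ext x
    exact (h.P_eq hl x).symm
  rw [e1] at hs2
  have e2 : ∀ n, (2 * Real.pi * Complex.I : ℂ)⁻¹ • (∮ z in C(0, D.c / 2), F n z) =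
      (-lam) ^ n • D.vcoef n n := fun n => by
    rw [← D.res_Y_mul_K_pow n]
    exact res_smul _ _ _
  have e3 : ∀ n, D.G * -((-lam) ^ n • D.vcoef n n) = lam ^ n • D.Pc n := fun n => by
    rw [Pc, mul_neg, mul_smul_comm, smul_smul, ← neg_smul]
    congr 1
    rw [neg_pow lam]
    ring
  simp only [e2, e3] at hs2
  exact hs2

theorem Admissible.hasFPowerSeriesOnBall_P (h : D.Admissible ρ) : HasFPowerSeriesOnBall D.P
    (fun n => ContinuousMultilinearMap.mkPiRing ℂ (Fin n) (D.Pc n)) 0 (ENNReal.ofReal ρ) where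
  r_le := by
    refine ENNReal.le_of_forall_nnreal_lt fun r hr => ?_
    refine FormalMultilinearSeries.le_radius_of_tendsto _ (l := 0) ?_
    have hr' : ‖((r : ℝ) : ℂ)‖ < ρ := by
      simp only [Complex.norm_real, Real.norm_eq_abs, NNReal.abs_eq]
      rw [← ENNReal.ofReal_coe_nnreal] at hr
      exact (ENNReal.ofReal_lt_ofReal_iff h.1).1 hr
    have := (h.hasSum_P hr').summable.tendsto_atTop_zero.norm
    simpa [norm_smul, mul_comm] using this
  r_pos := ENNReal.ofReal_pos.2 h.1
  hasSum := fun {y} hy => by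
    rw [Metric.mem_eball, edist_zero_right, ← ofReal_norm,
      ENNReal.ofReal_lt_ofReal_iff h.1] at hy
    simpa using h.hasSum_P hy

theorem Admissible.analyticOnNhd_P (h : D.Admissible ρ) :
    AnalyticOnNhd ℂ D.P (Metric.ball 0 ρ) := by
  have := h.hasFPowerSeriesOnBall_P.analyticOnNhd
  rwa [Metric.eball_ofReal] at this

/-- The adjoint of the eigenprojection is the eigenprojection at the conjugate coupling. -/
theorem Admissible.inner_P (h : D.Admissible ρ) (hl : ‖lam‖ < ρ) (x y : X) :
    inner ℂ (D.P lam x) y = inner ℂ x (D.P ((starRingEnd ℂ) lam) y) := by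
  have hr : 0 ≤ D.c / 2 := by linarith [D.c_pos]
  have hl' : ‖(starRingEnd ℂ) lam‖ < ρ := by rwa [RCLike.norm_conj]
  have e1 := map_res ((innerSL ℂ x).comp (ContinuousLinearMap.apply ℂ X y))
    (h.circleIntegrable_R hl')
  have e2 := map_res ((innerSL ℂ y).comp (ContinuousLinearMap.apply ℂ X x))
    (h.circleIntegrable_R hl)
  have e3 : inner ℂ x (D.P ((starRingEnd ℂ) lam) y) = -res (D.c / 2)
      fun z => inner ℂ x (D.R ((starRingEnd ℂ) lam) z y) :=
    (inner_neg_right _ _).trans (congrArg Neg.neg e1)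
  have e4 : inner ℂ y (D.P lam x) = -res (D.c / 2) fun z => inner ℂ y (D.R lam z x) :=
    (inner_neg_right _ _).trans (congrArg Neg.neg e2)
  -- Conjugation reverses the orientation of the circle; substitute `θ ↦ 2π - θ`.
  rw [← inner_conj_symm, e3, e4, map_neg]
  congr 1
  rw [res, res, smul_eq_mul, smul_eq_mul, map_mul, circleIntegral, circleIntegral,
    ← intervalIntegral.intervalIntegral_conj]
  have e5 := intervalIntegral.integral_comp_sub_left (a := 0) (b := 2 * Real.pi)
    (fun θ => deriv (circleMap 0 (D.c / 2)) θ •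
      (inner ℂ x (D.R ((starRingEnd ℂ) lam) (circleMap 0 (D.c / 2) θ) y) : ℂ)) (2 * Real.pi)
  rw [sub_self, sub_zero] at e5
  rw [← e5]
  have e6 : ∀ θ : ℝ, circleMap 0 (D.c / 2) (2 * Real.pi - θ) =
      (starRingEnd ℂ) (circleMap 0 (D.c / 2) θ) := fun θ => by
    simp only [circleMap, zero_add, map_mul, Complex.conj_ofReal, ← Complex.exp_conj,
      Complex.conj_I]
    rw [← Complex.exp_periodic (↑θ * -Complex.I)]
    congr 2
    push_cast
    ring
  have e7 : ∀ θ : ℝ, (starRingEnd ℂ) (deriv (circleMap 0 (D.c / 2)) θ •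
      (inner ℂ y (D.R lam (circleMap 0 (D.c / 2) θ) x) : ℂ)) =
      -(deriv (circleMap 0 (D.c / 2)) (2 * Real.pi - θ) • (inner ℂ x
        (D.R ((starRingEnd ℂ) lam) (circleMap 0 (D.c / 2) (2 * Real.pi - θ)) y) : ℂ)) := by
    intro θ
    have hz := circleMap_mem_sphere (0 : ℂ) hr θ
    have hz' : (starRingEnd ℂ) (circleMap 0 (D.c / 2) θ) ∈ Metric.sphere (0 : ℂ) (D.c / 2) := by
      rwa [mem_sphere_zero_iff_norm, RCLike.norm_conj, ← mem_sphere_zero_iff_norm]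
    have := (h.good_sphere hl hz).inner_R (h.good_sphere hl' hz') x y
    simp only [deriv_circleMap, smul_eq_mul, map_mul, Complex.conj_I, e6, inner_conj_symm, this]
    ring
  simp only [e7, intervalIntegral.integral_neg]
  simp only [map_inv₀, map_mul, Complex.conj_I, Complex.conj_ofReal, map_ofNat]
  ring

end GapData

/-! ### The perturbed eigenvalue -/

namespace GapData

variable {X : Type*} [NormedAddCommGroup X] [InnerProductSpace ℂ X] (D : GapData X)

/-- The perturbed eigenvalue `⟪Ω, (H₀ + λ T) P Ω⟫ / ⟪Ω, P Ω⟫`, where the numerator is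
`λ ⟪T Ω, P Ω⟫` because `H₀ Ω = 0`. -/
def E (lam : ℂ) : ℂ := lam * inner ℂ (D.TG D.Ω) (D.P lam D.Ω) / inner ℂ D.Ω (D.P lam D.Ω)

theorem norm_Ω_inner_le (A : X →L[ℂ] X) : ‖(inner ℂ D.Ω (A D.Ω) : ℂ)‖ ≤ ‖A‖ := by
  refine (norm_inner_le_norm _ _).trans ?_
  rw [D.norm_Ω, one_mul]
  simpa [D.norm_Ω] using A.le_opNorm D.Ω

theorem E_zero : D.E 0 = 0 := by simp [E]

/-- The operator `(H₀ + λ T - z) (H₀ + 1)⁻¹`. -/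
def Hz (lam z : ℂ) (y : X) : X := y + lam • D.TG y - D.G y - z • D.G y

theorem Hz_eq (lam z : ℂ) (y : X) : D.Hz lam z y = D.Hz lam 0 y - z • D.G y := by
  rw [Hz, Hz, zero_smul, sub_zero]

theorem Hz_sub (lam z : ℂ) (x y : X) : D.Hz lam z (x - y) = D.Hz lam z x - D.Hz lam z y := by
  simp only [Hz, map_sub, smul_sub]
  module

/-- Couplings so small that the perturbed eigenvalue lies below the remaining spectrum: the field
`form` keeps the numerical range on the complement of the eigenvector above `c / 2` (see
`Small.accretive`), the field `re_E_le` the eigenvalue below it. The last two fields provide a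
point, `-1`, of the resolvent set to the left of the eigenvalue. -/
structure Small (ρ : ℝ) (lam : ℂ) : Prop where
  adm : D.Admissible ρ
  lt : ‖lam‖ < ρ
  norm_P_sub : ‖D.P lam - D.PΩ‖ ≤ 1 / 4
  form : ‖lam‖ * D.C * (1 + D.c) ≤ 7 / 16 * D.c
  re_E_le : (D.E lam).re ≤ D.c / 4
  lt_re_E : -1 < (D.E lam).re
  norm_lt : ‖lam • D.TG‖ < 1

theorem inner_Ω_PΩ : inner ℂ D.Ω (D.PΩ D.Ω) = (1 : ℂ) := by
  rw [PΩ_apply, inner_smul_right, D.inner_Ω_Ω, one_mul]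

variable {ρ : ℝ} {lam : ℂ} {D}

theorem inner_Ω_P_ne_zero (h : ‖D.P lam - D.PΩ‖ ≤ 1 / 4) : inner ℂ D.Ω (D.P lam D.Ω) ≠ (0 : ℂ) := by
  intro h0
  have h1 := (D.norm_Ω_inner_le (D.P lam - D.PΩ)).trans h
  rw [sub_apply, inner_sub_right, h0, inner_Ω_PΩ] at h1
  norm_num at h1

theorem im_inner_Hz {t : ℝ} (z : ℂ) (y : X) :
    (inner ℂ (D.G y) (D.Hz t z y)).im = -z.im * ‖D.G y‖ ^ 2 := by
  have hreal : ∀ w : ℂ, (starRingEnd ℂ) w = w → w.im = 0 := fun w hw => Complex.conj_eq_iff_im.1 hw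
  have h1 : (inner ℂ (D.G y) y : ℂ).im = 0 := hreal _ (by rw [inner_conj_symm, D.G_symm])
  have h2 : (inner ℂ (D.G y) (D.TG y) : ℂ).im = 0 :=
    hreal _ (by rw [inner_conj_symm, D.T_symm])
  rw [Hz, inner_sub_right, inner_sub_right, inner_add_right, inner_smul_right, inner_smul_right,
    inner_self_eq_norm_sq_to_K, Complex.sub_im, Complex.sub_im, Complex.add_im, h1,
    Complex.im_ofReal_mul, h2]
  have : ((‖D.G y‖ : ℂ) ^ 2) = ((‖D.G y‖ ^ 2 : ℝ) : ℂ) := by push_cast; rfl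
  change _ - ((‖D.G y‖ : ℂ) ^ 2).im - (z * (‖D.G y‖ : ℂ) ^ 2).im = _
  rw [this, Complex.im_mul_ofReal, Complex.ofReal_im]
  ring

/-- For real couplings `H₀ + λ T` is symmetric, so that `H₀ + λ T - z` is bounded below by
`|Im z|`. -/
theorem abs_im_mul_norm_le {t : ℝ} (z : ℂ) (y : X) : |z.im| * ‖D.G y‖ ≤ ‖D.Hz t z y‖ := by
  rcases (norm_nonneg (D.G y)).eq_or_lt with h0 | h0
  · rw [← h0, mul_zero]; exact norm_nonneg _
  refine le_of_mul_le_mul_right ?_ h0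
  have h1 := (Complex.abs_im_le_norm _).trans
      (norm_inner_le_norm (𝕜 := ℂ) (D.G y) (D.Hz t z y))
  rw [im_inner_Hz, abs_mul, abs_neg, abs_of_nonneg (sq_nonneg ‖D.G y‖)] at h1
  nlinarith

theorem Small.P_Ω_ne_zero (h : D.Small ρ lam) : D.P lam D.Ω ≠ 0 := fun h0 =>
  inner_Ω_P_ne_zero h.norm_P_sub (by rw [h0, inner_zero_right])

/-- On the complement of the eigenvector the numerical range is bounded below by `c / 2`. -/
theorem Small.accretive (h : D.Small ρ lam) (z : ℂ) {y : X} (hQ : D.Q (D.G y) = D.G y)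
    (hP : D.P lam (D.G y) = 0) :
    (D.c / 2 - z.re) * ‖D.G y‖ ^ 2 ≤ (inner ℂ (D.G y) (D.Hz lam z y)).re := by
  have hc := D.c_pos
  have hC := D.C_pos
  set A := (inner ℂ (D.G y) y).re with hA
  have hA0 : 0 ≤ A := (sq_nonneg _).trans (D.G_nonneg y)
  set a : ℂ := inner ℂ D.Ω y with ha
  have hGw : D.G (y - D.PΩ y) = D.G y - D.PΩ y := by
    rw [map_sub, PΩ_apply, map_smul, D.G_Ω]
  have hPG : D.PΩ (D.G y) = D.PΩ y := by rw [PΩ_apply, PΩ_apply, D.inner_Ω_G]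
  have h1 := D.gap (y - D.PΩ y)
    (by rw [hGw, map_sub, hQ, PΩ_apply, map_smul, D.Q_Ω])
    (by rw [hGw, inner_sub_right, D.inner_Ω_G, PΩ_apply, inner_smul_right, D.inner_Ω_Ω, mul_one,
      sub_self])
  rw [hGw] at h1
  have hnorm : ‖D.PΩ y‖ = ‖a‖ := by rw [PΩ_apply, norm_smul, D.norm_Ω, mul_one]
  have hyΩ : (inner ℂ y D.Ω : ℂ) = (starRingEnd ℂ) a := (inner_conj_symm _ _).symm
  have e1 : (inner ℂ (D.G y - D.PΩ y) (y - D.PΩ y)).re = A - ‖a‖ ^ 2 := by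
    have : (inner ℂ (D.G y - D.PΩ y) (y - D.PΩ y) : ℂ) =
        inner ℂ (D.G y) y - a * (starRingEnd ℂ) a := by
      rw [inner_sub_left, inner_sub_right, inner_sub_right, PΩ_apply, inner_smul_right,
        inner_smul_right, inner_smul_left, inner_smul_left, D.inner_Ω_Ω, D.G_symm y D.Ω, D.G_Ω,
        hyΩ, ← ha]
      ring
    rw [this, Complex.mul_conj, Complex.normSq_eq_norm_sq, Complex.sub_re, Complex.ofReal_re]
  have e2 : ‖D.G y - D.PΩ y‖ ^ 2 = ‖D.G y‖ ^ 2 - ‖a‖ ^ 2 := by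
    rw [norm_sub_sq (𝕜 := ℂ), hnorm]
    have : (inner ℂ (D.G y) (D.PΩ y) : ℂ) = a * (starRingEnd ℂ) a := by
      rw [PΩ_apply, inner_smul_right, D.G_symm, D.G_Ω, hyΩ]
    rw [this, Complex.mul_conj, Complex.normSq_eq_norm_sq, RCLike.re_to_complex, Complex.ofReal_re]
    ring
  rw [e1, e2] at h1
  -- As `P` annihilates `G y` and is close to `P_Ω`, the component of `G y` along `Ω` is small.
  have h2 : ‖a‖ ≤ 1 / 4 * ‖D.G y‖ := by
    rw [← hnorm, ← hPG]
    have : D.PΩ (D.G y) = -((D.P lam - D.PΩ) (D.G y)) := by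
      rw [sub_apply, hP, zero_sub, neg_neg]
    rw [this, norm_neg]
    exact ((D.P lam - D.PΩ).le_opNorm _).trans
      (mul_le_mul_of_nonneg_right h.norm_P_sub (norm_nonneg _))
  have h3 : ‖a‖ ^ 2 ≤ ‖D.G y‖ ^ 2 / 16 := by
    have := pow_le_pow_left₀ (norm_nonneg a) h2 2
    linarith [this]
  have h4 : (1 + 15 / 16 * D.c) * ‖D.G y‖ ^ 2 ≤ A := by nlinarith [h1, h3]
  have h5 : -(‖lam‖ * D.C * A) ≤ (lam * inner ℂ (D.G y) (D.TG y)).re := by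
    have := (Complex.abs_re_le_norm (lam * inner ℂ (D.G y) (D.TG y))).trans_eq (norm_mul _ _)
    have h6 := mul_le_mul_of_nonneg_left (D.T_bound y) (norm_nonneg lam)
    have := (abs_le.1 this).1
    linarith
  have e3 : (inner ℂ (D.G y) (D.Hz lam z y)).re = A + (lam * inner ℂ (D.G y) (D.TG y)).re -
      ‖D.G y‖ ^ 2 - z.re * ‖D.G y‖ ^ 2 := by
    rw [Hz, inner_sub_right, inner_sub_right, inner_add_right, inner_smul_right, inner_smul_right,
      inner_self_eq_norm_sq_to_K, Complex.sub_re, Complex.sub_re, Complex.add_re, hA]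
    have : ((‖D.G y‖ : ℂ) ^ 2) = ((‖D.G y‖ ^ 2 : ℝ) : ℂ) := by push_cast; rfl
    change _ - ((‖D.G y‖ : ℂ) ^ 2).re - (z * (‖D.G y‖ : ℂ) ^ 2).re = _
    rw [this, Complex.re_mul_ofReal, Complex.ofReal_re]
  rw [e3]
  set t := ‖lam‖ * D.C with ht
  have ht0 : 0 ≤ t := by positivity
  have ht1 : t * (1 + D.c) ≤ 7 / 16 * D.c := h.form
  have ht2 : t ≤ 1 := by nlinarith
  -- The constant `7 / 16` in `Small.form` is `15 / 16 - 1 / 2`.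
  have h6 : (1 + D.c / 2) * ‖D.G y‖ ^ 2 ≤ (1 - t) * A := by
    have h7 : 1 + D.c / 2 ≤ (1 - t) * (1 + 15 / 16 * D.c) := by nlinarith
    calc _ ≤ (1 - t) * (1 + 15 / 16 * D.c) * ‖D.G y‖ ^ 2 :=
          mul_le_mul_of_nonneg_right h7 (sq_nonneg _)
      _ ≤ (1 - t) * A := by
          rw [mul_assoc]
          exact mul_le_mul_of_nonneg_left h4 (by linarith)
  linarith

variable [CompleteSpace X]

/-- All sufficiently small couplings are small in the sense of `Small`, and the eigenvalue is
analytic there. -/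
theorem Admissible.exists_small (h : D.Admissible ρ) : ∃ δ, 0 < δ ∧ δ ≤ ρ ∧
    (∀ lam ∈ Metric.ball (0 : ℂ) δ, D.Small ρ lam) ∧ AnalyticOnNhd ℂ D.E (Metric.ball 0 δ) := by
  have hc := D.c_pos
  have hC := D.C_pos
  have h00 : ‖(0 : ℂ)‖ < ρ := by simpa using h.1
  have hP0 : D.P 0 = D.PΩ := by
    refine (h.hasSum_P h00).unique ?_
    rw [← D.Pc_zero]
    convert hasSum_single (f := fun n => (0 : ℂ) ^ n • D.Pc n) 0 fun n hn => by simp [hn] using 1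
    simp
  have hPan : ∀ {lam : ℂ}, ‖lam‖ < ρ → AnalyticAt ℂ D.P lam := fun {lam} hl =>
    h.analyticOnNhd_P lam (by simpa using hl)
  have hEan : ∀ {lam : ℂ}, ‖lam‖ < ρ → ‖D.P lam - D.PΩ‖ ≤ 1 / 4 → AnalyticAt ℂ D.E lam := by
    intro lam hl hn
    have hin : ∀ x : X, AnalyticAt ℂ (fun l => (inner ℂ x (D.P l D.Ω) : ℂ)) lam := fun x =>
      ((innerSL ℂ x).comp (ContinuousLinearMap.apply ℂ X D.Ω)).analyticAt _ |>.comp (hPan hl)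
    exact (analyticAt_id.mul (hin _)).div (hin _) (inner_Ω_P_ne_zero hn)
  have hPc := (hPan h00).continuousAt
  have e1 : ∀ᶠ lam in nhds (0 : ℂ), ‖D.P lam - D.PΩ‖ ≤ 1 / 4 := by
    have : Filter.Tendsto (fun lam => ‖D.P lam - D.PΩ‖) (nhds 0) (nhds 0) := by
      have := (hPc.sub (continuousAt_const (y := D.PΩ))).norm
      rw [ContinuousAt] at this
      simpa [hP0] using this
    exact (this.eventually_lt_const (by norm_num : (0 : ℝ) < 1 / 4)).mono fun _ h => h.le
  have e2 : ∀ᶠ lam in nhds (0 : ℂ), ‖lam‖ * D.C * (1 + D.c) ≤ 7 / 16 * D.c := by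
    have : Filter.Tendsto (fun lam : ℂ => ‖lam‖ * D.C * (1 + D.c)) (nhds 0) (nhds 0) := by
      have : Continuous fun lam : ℂ => ‖lam‖ * D.C * (1 + D.c) := by fun_prop
      simpa using this.tendsto 0
    exact (this.eventually_lt_const (by positivity : 0 < 7 / 16 * D.c)).mono fun _ h => h.le
  have e3 : Filter.Tendsto (fun lam => (D.E lam).re) (nhds 0) (nhds 0) := by
    have := Complex.continuous_re.continuousAt.comp
      (hEan h00 (by simp [hP0])).continuousAt
    rw [ContinuousAt] at this
    rwa [Function.comp_apply, E_zero] at this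
  have e4 : ∀ᶠ lam in nhds (0 : ℂ), ‖lam • D.TG‖ < 1 := by
    have : Continuous fun lam : ℂ => ‖lam • D.TG‖ := by fun_prop
    exact (this.tendsto 0).eventually_lt_const (by simp)
  have e5 : ∀ᶠ lam in nhds (0 : ℂ), ‖lam‖ < ρ :=
    continuous_norm.continuousAt.eventually_lt continuousAt_const h00
  have hall : ∀ᶠ lam in nhds (0 : ℂ), D.Small ρ lam := by
    filter_upwards [e1, e2, e3.eventually_lt_const (by positivity : 0 < D.c / 4),
      e3.eventually_const_lt (by norm_num : (-1 : ℝ) < 0), e4, e5] with lam h1 h2 h3 h4 h5 h6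
    exact ⟨h, h6, h1, h2, h3.le, h4, h5⟩
  obtain ⟨δ, hδ, hb⟩ := Metric.eventually_nhds_iff_ball.1 hall
  refine ⟨min δ ρ, lt_min hδ h.1, min_le_right _ _, fun lam hl => hb lam
    (Metric.ball_subset_ball (min_le_left _ _) hl), fun lam hl => ?_⟩
  have := hb lam (Metric.ball_subset_ball (min_le_left _ _) hl)
  exact hEan this.lt this.norm_P_sub

/-- The range of the projection is spanned by `P Ω`. -/
theorem Small.eq_smul (h : D.Small ρ lam) {x : X} (hx : D.P lam x = x) :
    x = ((inner ℂ D.Ω x : ℂ) / inner ℂ D.Ω (D.P lam D.Ω)) • D.P lam D.Ω := by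
  have hne := inner_Ω_P_ne_zero h.norm_P_sub
  have hidem := DFunLike.congr_fun (h.adm.P_idem h.lt) D.Ω
  change D.P lam (D.P lam D.Ω) = D.P lam D.Ω at hidem
  set a := (inner ℂ D.Ω x : ℂ) / inner ℂ D.Ω (D.P lam D.Ω) with ha
  rw [← sub_eq_zero]
  set u := x - a • D.P lam D.Ω with hu
  have h1 : D.P lam u = u := by rw [hu, map_sub, map_smul, hx, hidem]
  have h2 : D.PΩ u = 0 := by
    rw [PΩ_apply, hu, inner_sub_right, inner_smul_right, ha, div_mul_cancel₀ _ hne, sub_self,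
      zero_smul]
  have h3 : u = (D.P lam - D.PΩ) u := by rw [sub_apply, h1, h2, sub_zero]
  have h4 : ‖u‖ ≤ 1 / 4 * ‖u‖ := by
    conv_lhs => rw [h3]
    exact ((D.P lam - D.PΩ).le_opNorm u).trans
      (mul_le_mul_of_nonneg_right h.norm_P_sub (norm_nonneg _))
  exact norm_le_zero_iff.1 (by linarith [norm_nonneg u])

/-- On the range of the projection, `H₀ + λ T` is multiplication by `E`. -/
theorem Small.HP_eq (h : D.Small ρ lam) (x : X) : D.HP lam x = D.E lam • D.P lam x := by
  have hne := inner_Ω_P_ne_zero h.norm_P_sub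
  have hidem : ∀ x, D.P lam (D.P lam x) = D.P lam x := fun x =>
    DFunLike.congr_fun (h.adm.P_idem h.lt) x
  have hP := fun x => h.adm.P_eq h.lt x
  have hP1 := fun x => h.adm.P1_eq h.lt x
  have h1 : ∀ x, D.P1 lam (D.P lam x) = D.P1 lam x := fun x => by
    rw [← sub_eq_zero]
    refine D.G_inj _ ?_
    rw [map_sub, ← hP, ← hP, hidem, sub_self]
  have h2 : ∀ x, D.HP lam (D.P lam x) = D.HP lam x := fun x => by
    have e1 := hP1 x
    have e2 := hP1 (D.P lam x)
    rw [h1, hidem, e1] at e2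
    exact (add_left_cancel e2).symm
  have h3 : ∀ x, D.P lam (D.HP lam x) = D.HP lam x := fun x => by
    have e1 := h.adm.P_H h.lt (D.P1 lam x)
    rw [hP1, ← hP, add_sub_cancel_left, h2] at e1
    exact e1
  have h4 : D.HP lam D.Ω = D.E lam • D.P lam D.Ω := by
    rw [h.eq_smul (h3 D.Ω), E]
    congr 2
    have e1 := congrArg (fun v => (inner ℂ D.Ω v : ℂ)) (hP1 D.Ω)
    simp only [inner_add_right, inner_smul_right] at e1
    have e2 : (inner ℂ D.Ω (D.P1 lam D.Ω) : ℂ) = inner ℂ D.Ω (D.P lam D.Ω) := by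
      rw [hP, D.inner_Ω_G]
    have e3 : (inner ℂ D.Ω (D.TG (D.P1 lam D.Ω)) : ℂ) = inner ℂ (D.TG D.Ω) (D.P lam D.Ω) := by
      rw [hP, D.T_symm, D.G_Ω]
    rw [e2, e3] at e1
    exact (add_left_cancel e1).symm
  rw [← h2, h.eq_smul (hidem x), map_smul, h2, h4, smul_comm]

/-- `P x` is an eigenvector for `E`. -/
theorem Small.Hz_P1 (h : D.Small ρ lam) (z : ℂ) (x : X) :
    D.Hz lam z (D.P1 lam x) = (D.E lam - z) • D.P lam x := by
  rw [Hz, h.adm.P1_eq h.lt, ← h.adm.P_eq h.lt, h.HP_eq]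
  module

theorem Small.P_Hz (h : D.Small ρ lam) (z : ℂ) (y : X) :
    D.P lam (D.Hz lam z y) = (D.E lam - z) • D.P lam (D.G y) := by
  rw [Hz, map_sub, h.adm.P_H h.lt, h.HP_eq, map_smul]
  module

/-- An eigenvector in the range of `Q` is in the range of the eigenprojection. -/
theorem Small.P_eq_self (h : D.Small ρ lam) {y : X} (hQ : D.Q (D.G y) = D.G y)
    (hy : D.Hz lam (D.E lam) y = 0) : D.P lam (D.G y) = D.G y := by
  have hc := D.c_pos
  set x := D.G y with hx
  have hG : D.G (y - D.P1 lam x) = x - D.P lam x := by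
    rw [map_sub, ← h.adm.P_eq h.lt]
  have hidem := DFunLike.congr_fun (h.adm.P_idem h.lt) x
  change D.P lam (D.P lam x) = D.P lam x at hidem
  have h1 := h.accretive (D.E lam) (y := y - D.P1 lam x)
    (by rw [hG, map_sub, hQ, h.adm.Q_P h.lt])
    (by rw [hG, map_sub, hidem, sub_self])
  rw [hG, Hz_sub, hy, h.Hz_P1, sub_self, zero_smul, sub_zero, inner_zero_right,
    Complex.zero_re] at h1
  have h2 : ‖x - D.P lam x‖ ^ 2 ≤ 0 := by
    have := h.re_E_le
    have h3 : 0 ≤ ‖x - D.P lam x‖ ^ 2 := sq_nonneg _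
    nlinarith
  have h3 : ‖x - D.P lam x‖ = 0 := by
    have := le_antisymm h2 (sq_nonneg _)
    exact pow_eq_zero_iff two_ne_zero |>.1 this
  exact (sub_eq_zero.1 (norm_eq_zero.1 h3)).symm

/-- The lower bound for `H₀ + λ T - z` on the range of `Q`. The projection `P` need not be
orthogonal; the constant `4` absorbs the contributions `5 / 4` of `P` and `9 / 4` of `1 - P`. -/
theorem Small.lower_bound (h : D.Small ρ lam) {z : ℂ} (hz : z.re < (D.E lam).re) {y : X}
    (hQ : D.Q (D.G y) = D.G y) : ((D.E lam).re - z.re) * ‖D.G y‖ ≤ 4 * ‖D.Hz lam z y‖ := by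
  have hc := D.c_pos
  set x := D.G y with hx
  set v := D.Hz lam z y with hv
  set d := (D.E lam).re - z.re with hd
  have hd0 : 0 < d := sub_pos.2 hz
  have hG : D.G (y - D.P1 lam x) = x - D.P lam x := by
    rw [map_sub, ← h.adm.P_eq h.lt]
  have hidem := DFunLike.congr_fun (h.adm.P_idem h.lt) x
  change D.P lam (D.P lam x) = D.P lam x at hidem
  have hPv : D.P lam v = (D.E lam - z) • D.P lam x := h.P_Hz z y
  have hPn : ‖D.P lam‖ ≤ 5 / 4 := by
    have h1 : ‖D.PΩ‖ ≤ 1 := ContinuousLinearMap.opNorm_le_bound _ zero_le_one fun x => by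
      rw [PΩ_apply, norm_smul, D.norm_Ω, mul_one, one_mul]
      simpa [D.norm_Ω] using norm_inner_le_norm (𝕜 := ℂ) D.Ω x
    have h2 := norm_add_le (D.P lam - D.PΩ) D.PΩ
    rw [sub_add_cancel] at h2
    linarith [h.norm_P_sub]
  have hPvn : ‖D.P lam v‖ ≤ 5 / 4 * ‖v‖ :=
    ((D.P lam).le_opNorm v).trans (mul_le_mul_of_nonneg_right hPn (norm_nonneg _))
  have h1 : d * ‖D.P lam x‖ ≤ 5 / 4 * ‖v‖ := by
    refine le_trans ?_ hPvn
    rw [hPv, norm_smul]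
    refine mul_le_mul_of_nonneg_right ?_ (norm_nonneg _)
    exact (le_abs_self _).trans (Complex.abs_re_le_norm (D.E lam - z))
  have h2 : d * ‖x - D.P lam x‖ ≤ 9 / 4 * ‖v‖ := by
    have h3 := h.accretive z (y := y - D.P1 lam x)
      (by rw [hG, map_sub, hQ, h.adm.Q_P h.lt])
      (by rw [hG, map_sub, hidem, sub_self])
    rw [hG, Hz_sub, ← hv, h.Hz_P1, ← hPv] at h3
    have h4 : ‖v - D.P lam v‖ ≤ 9 / 4 * ‖v‖ := by
      have := norm_sub_le v (D.P lam v)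
      linarith
    refine le_trans ?_ h4
    rcases (norm_nonneg (x - D.P lam x)).eq_or_lt with h0 | h0
    · rw [← h0, mul_zero]; exact norm_nonneg _
    refine le_of_mul_le_mul_right ?_ h0
    have h5 := (Complex.re_le_norm _).trans
      (norm_inner_le_norm (𝕜 := ℂ) (x - D.P lam x) (v - D.P lam v))
    have h6 : d * ‖x - D.P lam x‖ ^ 2 ≤ (D.c / 2 - z.re) * ‖x - D.P lam x‖ ^ 2 :=
      mul_le_mul_of_nonneg_right (by linarith [h.re_E_le]) (sq_nonneg _)
    nlinarith
  have h3 : ‖x‖ ≤ ‖D.P lam x‖ + ‖x - D.P lam x‖ := by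
    have := norm_add_le (D.P lam x) (x - D.P lam x)
    rwa [add_sub_cancel] at this
  have := mul_le_mul_of_nonneg_left h3 hd0.le
  linarith [norm_nonneg v]

/-- The eigenvalue is real for real couplings. -/
theorem Small.im_E {t : ℝ} (h : D.Small ρ (t : ℂ)) : (D.E t).im = 0 := by
  have h1 := im_inner_Hz (D := D) (t := t) (D.E t) (D.P1 t D.Ω)
  rw [h.Hz_P1, sub_self, zero_smul, inner_zero_right, Complex.zero_im,
    ← h.adm.P_eq h.lt] at h1
  have h2 : ‖D.P t D.Ω‖ ^ 2 ≠ 0 := pow_ne_zero _ (norm_ne_zero_iff.2 h.P_Ω_ne_zero)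
  rcases mul_eq_zero.1 h1.symm with h3 | h3
  · exact neg_eq_zero.1 h3
  · exact absurd h3 h2

end GapData

/-! ### Continuation of the resolvent set -/

section Unbounded

variable {X : Type*} [NormedAddCommGroup X] [NormedSpace ℂ X] {A : X →ₗ.[ℂ] X}

/-- The Neumann series for the resolvent near a point `z₀` of the resolvent set. -/
theorem mem_resolventSet_of_norm_lt [CompleteSpace X] {R : X →L[ℂ] X} {z₀ z : ℂ}
    (h1 : ∀ x : X, ∃ h : R x ∈ A.domain, A ⟨R x, h⟩ - z₀ • R x = x)
    (h2 : ∀ x : A.domain, R (A x - z₀ • (x : X)) = x) (h : ‖(z - z₀) • R‖ < 1) :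
    z ∈ resolventSet A := by
  have hu : IsUnit (1 - (z - z₀) • R) := isUnit_one_sub_of_norm_lt_one h
  set V := Ring.inverse (1 - (z - z₀) • R) with hV
  have hV1 : ∀ x, V x - (z - z₀) • R (V x) = x := fun x =>
    DFunLike.congr_fun (Ring.mul_inverse_cancel _ hu) x
  have hV2 : ∀ x, V (x - (z - z₀) • R x) = x := fun x =>
    DFunLike.congr_fun (Ring.inverse_mul_cancel _ hu) x
  have hc : ∀ x, R (V x) = V (R x) := fun x => by
    have := hV2 (R (V x))
    rw [← map_smul R, ← map_sub R, hV1] at this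
    exact this.symm
  refine ⟨R * V, fun x => ?_, fun x => ?_⟩
  · obtain ⟨hd, e⟩ := h1 (V x)
    refine ⟨hd, ?_⟩
    change A ⟨R (V x), hd⟩ - z • R (V x) = x
    linear_combination (norm := module) e + hV1 x
  · change R (V _) = _
    rw [hc]
    have : R (A x - z • (x : X)) = (x : X) - (z - z₀) • R x := by
      have e := h2 x
      rw [map_sub, map_smul] at e ⊢
      linear_combination (norm := module) e
    rw [this, hV2]

theorem isOpen_resolventSet [CompleteSpace X] : IsOpen (resolventSet A) := by
  rw [Metric.isOpen_iff]
  rintro z₀ ⟨R, h1, h2⟩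
  refine ⟨(‖R‖ + 1)⁻¹, by positivity, fun z hz => mem_resolventSet_of_norm_lt h1 h2 ?_⟩
  rw [Metric.mem_ball, dist_eq_norm] at hz
  rw [norm_smul]
  have h0 : 0 < ‖R‖ + 1 := by positivity
  calc ‖z - z₀‖ * ‖R‖ ≤ ‖z - z₀‖ * (‖R‖ + 1) := by gcongr; linarith
    _ < (‖R‖ + 1)⁻¹ * (‖R‖ + 1) := by gcongr
    _ = 1 := inv_mul_cancel₀ h0.ne'

/-- A connected open set that meets the resolvent set and on which `A - z` is locally uniformly
bounded below is contained in the resolvent set. -/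
theorem subset_resolventSet [CompleteSpace X] {s : Set ℂ} (hs : IsPreconnected s) (hso : IsOpen s)
    {m : ℂ → ℝ} (hm : Continuous m) (hpos : ∀ z ∈ s, 0 < m z)
    (hb : ∀ z ∈ s, ∀ x : A.domain, m z * ‖(x : X)‖ ≤ ‖A x - z • (x : X)‖)
    {z₁ : ℂ} (hz₁ : z₁ ∈ s) (hr : z₁ ∈ resolventSet A) : s ⊆ resolventSet A := by
  refine hs.subset_of_closure_inter_subset isOpen_resolventSet ⟨z₁, hz₁, hr⟩ ?_
  rintro z ⟨hzc, hzs⟩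
  have h1 : ∀ᶠ w in nhds z, ‖z - w‖ < m w :=
    ContinuousAt.eventually_lt (by fun_prop) hm.continuousAt (by simpa using hpos z hzs)
  obtain ⟨w, ⟨hw1, hw2⟩, hw3⟩ := mem_closure_iff_nhds.1 hzc _
    (Filter.inter_mem h1 (hso.mem_nhds hzs))
  obtain ⟨R, hR1, hR2⟩ := hw3
  refine mem_resolventSet_of_norm_lt hR1 hR2 ?_
  have hmw := hpos w hw2
  have hRn : ‖R‖ ≤ (m w)⁻¹ := R.opNorm_le_bound (by positivity) fun x => by
    obtain ⟨hd, e⟩ := hR1 x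
    have := hb w hw2 ⟨R x, hd⟩
    rw [e] at this
    rw [← div_eq_inv_mul, le_div_iff₀ hmw, mul_comm]
    exact this
  rw [norm_smul]
  calc ‖z - w‖ * ‖R‖ ≤ ‖z - w‖ * (m w)⁻¹ := by gcongr
    _ < m w * (m w)⁻¹ := by
      have : ‖z - w‖ < m w := hw1
      gcongr
    _ = 1 := mul_inv_cancel₀ hmw.ne'

theorem mem_spectrum_of_mem_eigenspace {z : ℂ} {x : X} (hx : x ∈ eigenspace A z) (h0 : x ≠ 0) :
    z ∈ spectrum A := by
  rintro ⟨R, -, hR⟩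
  obtain ⟨hd, e⟩ := hx
  have := hR ⟨x, hd⟩
  rw [e, sub_self, map_zero] at this
  exact h0 this.symm

end Unbounded

/-! ### The vacuum -/

theorem wf_vacuum_zero : wf vacuum 0 =ᵐ[volume] fun _ => 1 := by
  have h : (component vacuum 0 : Lp ℂ 2 (volume : Measure (Conf 0))) =
      indicatorConstLp 2 (MeasurableSet.univ (α := Conf 0)) (by simp [volume_pi]) (1 : ℂ) :=
    congrArg Subtype.val (lp.single_apply_self (E := fun n : ℕ => SymL2 n) 2 0 _)
  rw [wf, h]
  filter_upwards [indicatorConstLp_coeFn (p := 2) (hs := MeasurableSet.univ (α := Conf 0))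
    (hμs := by simp [volume_pi]) (c := (1 : ℂ))] with k hk
  rw [hk, Set.indicator_univ]

theorem wf_vacuum_succ (n : ℕ) : wf vacuum (n + 1) =ᵐ[volume] fun _ => 0 := by
  have h : component vacuum (n + 1) = 0 :=
    lp.single_apply_ne (E := fun n : ℕ => SymL2 n) 2 0 _ (Nat.succ_ne_zero n)
  rw [wf, h]
  exact Lp.coeFn_zero _ _ _

/-- `⟪Ω, ψ⟫` is the value of the zero particle wave function, on the one-point space `Conf 0`. -/
theorem inner_vacuum (ψ : Fock) : (fun _ : Conf 0 => inner ℂ vacuum ψ) =ᵐ[volume] wf ψ 0 := by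
  have h1 : inner ℂ vacuum ψ = ∫ k, (inner ℂ (wf vacuum 0 k) (wf ψ 0 k) : ℂ) := by
    refine (hasSum_inner_component vacuum ψ).unique ?_
    refine hasSum_single 0 fun n hn => ?_
    obtain ⟨n, rfl⟩ := Nat.exists_eq_add_one_of_ne_zero hn
    refine integral_eq_zero_of_ae ?_
    filter_upwards [wf_vacuum_succ n] with k hk
    rw [hk, inner_zero_left, Pi.zero_apply]
  refine Filter.Eventually.of_forall fun k => ?_
  change inner ℂ vacuum ψ = _
  have h2 : ∫ k, (inner ℂ (wf vacuum 0 k) (wf ψ 0 k) : ℂ) = ∫ _ : Conf 0, wf ψ 0 k := by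
    refine integral_congr_ae ?_
    filter_upwards [wf_vacuum_zero] with k' hk'
    rw [hk', Subsingleton.elim k' k]
    simp
  rw [h1, h2, integral_const]
  simp [volume_pi, Measure.real]

/-! ### Diagonal multiplication operators on the spin-boson space -/

/-- The diagonal operator matrix with entries `A 0`, `A 1`. -/
def diag (A : Fin 2 → (Fock →L[ℂ] Fock)) : SpinFock →L[ℂ] SpinFock :=
  ((PiLp.continuousLinearEquiv 2 ℂ fun _ : Fin 2 => Fock).symm : _ →L[ℂ] SpinFock) ∘L
    ContinuousLinearMap.pi fun i => A i ∘L PiLp.proj 2 _ i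

theorem spinFock_inner (ψ φ : SpinFock) : inner ℂ ψ φ = ∑ i, inner ℂ (ψ i) (φ i) :=
  PiLp.inner_apply _ _

theorem spinFock_norm_sq (ψ : SpinFock) : ‖ψ‖ ^ 2 = ∑ i, ‖ψ i‖ ^ 2 := PiLp.norm_sq_eq_of_L2 _ _

theorem inner_diag {A : Fin 2 → (Fock →L[ℂ] Fock)}
    (h : ∀ i ψ φ, inner ℂ (A i ψ) φ = inner ℂ ψ (A i φ)) (ψ φ : SpinFock) :
    inner ℂ (diag A ψ) φ = inner ℂ ψ (diag A φ) := by
  rw [spinFock_inner, spinFock_inner]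
  exact Finset.sum_congr rfl fun i _ => h i _ _

theorem norm_diag_le {A : Fin 2 → (Fock →L[ℂ] Fock)} {C : ℝ} (hC : 0 ≤ C)
    (h : ∀ i ψ, ‖A i ψ‖ ≤ C * ‖ψ‖) : ‖diag A‖ ≤ C := by
  refine ContinuousLinearMap.opNorm_le_bound _ hC fun ψ => ?_
  refine le_of_sq_le_sq ?_ (by positivity)
  rw [mul_pow, spinFock_norm_sq, spinFock_norm_sq, Finset.mul_sum]
  refine Finset.sum_le_sum fun i _ => ?_
  rw [← mul_pow]
  exact pow_le_pow_left₀ (norm_nonneg _) (h i _) 2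

theorem spinFock_ext {ψ φ : SpinFock} (h : ∀ i n, wf (ψ i) n =ᵐ[volume] wf (φ i) n) : ψ = φ := by
  ext1 i
  exact fock_ext (h i)

theorem inner_vacuumDown (ψ : SpinFock) : inner ℂ vacuumDown ψ = inner ℂ vacuum (ψ 1) := by
  rw [spinFock_inner, Fin.sum_univ_two]
  change inner ℂ (0 : Fock) _ + inner ℂ vacuum _ = _
  rw [inner_zero_left, zero_add]

theorem norm_vacuumDown : ‖vacuumDown‖ = 1 := by
  have h : inner ℂ vacuum vacuum = (1 : ℂ) := by
    obtain ⟨k, h1, h2⟩ := ((inner_vacuum vacuum).and wf_vacuum_zero).exists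
    exact h1.trans h2
  have h2 : inner ℂ vacuumDown vacuumDown = (1 : ℂ) := by rw [inner_vacuumDown]; exact h
  have h3 : ‖vacuumDown‖ ^ 2 = 1 := by
    rw [← inner_self_eq_norm_sq (𝕜 := ℂ), h2, RCLike.one_re]
  exact (pow_eq_one_iff_of_nonneg (norm_nonneg _) two_ne_zero).1 h3

/-- The projection onto `Ω_↓` restricts to the spin down component with no particles. -/
theorem wf_inner_smul_vacuumDown (ψ : SpinFock) (i : Fin 2) (n : ℕ) :
    wf ((inner ℂ vacuumDown ψ • vacuumDown : SpinFock) i) n =ᵐ[volume]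
      fun k => if i = 1 ∧ n = 0 then wf (ψ i) n k else 0 := by
  rw [inner_vacuumDown, PiLp.smul_apply]
  fin_cases i
  · filter_upwards [wf_smul (inner ℂ vacuum (ψ 1)) (vacuumDown 0) n, wf_zero n] with k h1 h2
    refine h1.trans ?_
    change _ * wf 0 n k = _
    rw [h2, mul_zero, if_neg]
    simp
  · cases n with
    | zero =>
      filter_upwards [wf_smul (inner ℂ vacuum (ψ 1)) (vacuumDown 1) 0, inner_vacuum (ψ 1),
        wf_vacuum_zero] with k h1 h2 h3
      refine h1.trans ?_
      change _ * wf vacuum 0 k = _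
      rw [h3, mul_one, h2, if_pos ⟨rfl, rfl⟩]
      rfl
    | succ n =>
      filter_upwards [wf_smul (inner ℂ vacuum (ψ 1)) (vacuumDown 1) (n + 1),
        wf_vacuum_succ n] with k h1 h2
      refine h1.trans ?_
      change _ * wf vacuum (n + 1) k = _
      rw [h2, mul_zero, if_neg]
      simp

/-! ### The free Hamiltonian, its resolvent and its reduced resolvent -/

/-- The energy `(H₀)ᵢ(k₁, …, kₙ)`: `2 + ∑ⱼ |kⱼ|` for spin up and `∑ⱼ |kⱼ|` for spin down. -/
def energy (i : Fin 2) {n : ℕ} (k : Conf n) : ℝ := (if i = 0 then 2 else 0) + ∑ j, ‖k j‖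

theorem energy_nonneg (i : Fin 2) {n : ℕ} (k : Conf n) : 0 ≤ energy i k :=
  add_nonneg (by split_ifs <;> norm_num) (Finset.sum_nonneg fun _ _ => norm_nonneg _)

theorem measurable_energy (i : Fin 2) (n : ℕ) : Measurable fun k : Conf n => energy i k :=
  measurable_const.add (Finset.measurable_fun_sum _ fun j _ => (measurable_pi_apply j).norm)

theorem energy_perm (i : Fin 2) {n : ℕ} (π : Equiv.Perm (Fin n)) (k : Conf n) :
    energy i (fun j => k (π j)) = energy i k := by
  rw [energy, energy, Equiv.sum_comp π fun j => ‖k j‖]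

/-- The momenta below the infrared cutoff. -/
def low (σ : ℝ) : Set E3 := {k | ‖k‖ < σ}

theorem measurableSet_low (σ : ℝ) : MeasurableSet (low σ) :=
  measurableSet_lt measurable_norm measurable_const

theorem energy_vacuum {k : Conf 0} : energy 1 k = 0 := by simp [energy]

/-- Without particles below the cutoff, the energies other than `0` are at least `min σ 2`. -/
theorem le_energy {σ : ℝ} {i : Fin 2} {n : ℕ} {k : Conf n} (h : occ (low σ) k = 0)
    (hi : ¬ (i = 1 ∧ n = 0)) : min σ 2 ≤ energy i k := by
  rcases eq_or_ne i 0 with rfl | hi0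
  · refine (min_le_right _ _).trans ?_
    rw [energy, if_pos rfl]
    exact le_add_of_nonneg_right (Finset.sum_nonneg fun _ _ => norm_nonneg _)
  · have h1 : i = 1 := by omega
    obtain ⟨n, rfl⟩ := Nat.exists_eq_succ_of_ne_zero fun h0 => hi ⟨h1, h0⟩
    refine (min_le_left _ _).trans ?_
    rw [energy, if_neg hi0, zero_add]
    have h2 : σ ≤ ‖k 0‖ := not_lt.1 ((occ_eq_zero_iff _ k).1 h 0)
    exact h2.trans (Finset.single_le_sum (f := fun j => ‖k j‖) (fun _ _ => norm_nonneg _)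
      (Finset.mem_univ 0))

/-- The symbol of `(H₀ + 1)⁻¹`. -/
def gSymbol (i : Fin 2) : Symbol where
  fn _ k := ((energy i k + 1 : ℝ) : ℂ)⁻¹
  meas n := (Complex.measurable_ofReal.comp ((measurable_energy i n).add_const 1)).inv
  symm n π k := by rw [energy_perm]
  bound := ⟨1, zero_le_one, fun n k => by
    rw [norm_inv, Complex.norm_real]
    have := energy_nonneg i k
    refine inv_le_one_of_one_le₀ ?_
    rw [Real.norm_of_nonneg (by linarith)]
    linarith⟩

open Classical in
theorem norm_sFn_le {σ : ℝ} (hσ : 0 < σ) (i : Fin 2) {n : ℕ} (k : Conf n) :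
    ‖if occ (low σ) k = 0 then ((energy i k : ℝ) : ℂ)⁻¹ else 0‖ ≤ (min σ 2)⁻¹ := by
  have hm : 0 < min σ 2 := lt_min hσ two_pos
  split_ifs with h
  · rw [norm_inv, Complex.norm_real, Real.norm_of_nonneg (energy_nonneg i k)]
    by_cases hi : i = 1 ∧ n = 0
    · obtain ⟨rfl, rfl⟩ := hi
      rw [energy_vacuum, inv_zero]
      positivity
    · exact inv_anti₀ hm (le_energy h hi)
  · rw [norm_zero]; positivity

open Classical in
/-- The symbol of the reduced resolvent: the inverse energy where no particle is below the cutoff.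
At the ground state energy `0` the convention `0⁻¹ = 0` gives the correct value. -/
def sSymbol {σ : ℝ} (hσ : 0 < σ) (i : Fin 2) : Symbol where
  fn _ k := if occ (low σ) k = 0 then ((energy i k : ℝ) : ℂ)⁻¹ else 0
  meas n := Measurable.ite (measurable_occ (measurableSet_low σ) n (measurableSet_singleton 0))
    (Complex.measurable_ofReal.comp (measurable_energy i n)).inv measurable_const
  symm n π k := by rw [energy_perm, occ_perm]
  bound := ⟨(min σ 2)⁻¹, inv_nonneg.2 (le_min hσ.le zero_le_two), fun n k => norm_sFn_le hσ i k⟩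

/-- The resolvent `(H₀ + 1)⁻¹`. -/
def Gop : SpinFock →L[ℂ] SpinFock := diag fun i => mulOp (gSymbol i)

/-- The reduced resolvent `H₀⁻¹ (1 - P_{Ω_↓}) Q_σ`. -/
def Sop {σ : ℝ} (hσ : 0 < σ) : SpinFock →L[ℂ] SpinFock := diag fun i => mulOp (sSymbol hσ i)

/-- The projection onto the states with `m` particles below the cutoff. -/
def sectorOp (σ : ℝ) (m : ℕ) : SpinFock →L[ℂ] SpinFock :=
  diag fun _ => sector (low σ) (measurableSet_low σ) m

theorem wf_Gop (ψ : SpinFock) (i : Fin 2) (n : ℕ) :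
    wf (Gop ψ i) n =ᵐ[volume] fun k => ((energy i k + 1 : ℝ) : ℂ)⁻¹ * wf (ψ i) n k :=
  wf_mulOp (gSymbol i) (ψ i) n

open Classical in
theorem wf_Sop {σ : ℝ} (hσ : 0 < σ) (ψ : SpinFock) (i : Fin 2) (n : ℕ) :
    wf (Sop hσ ψ i) n =ᵐ[volume] fun k =>
      (if occ (low σ) k = 0 then ((energy i k : ℝ) : ℂ)⁻¹ else 0) * wf (ψ i) n k :=
  wf_mulOp (sSymbol hσ i) (ψ i) n

open Classical in
theorem wf_sectorOp (σ : ℝ) (m : ℕ) (ψ : SpinFock) (i : Fin 2) (n : ℕ) :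
    wf (sectorOp σ m ψ i) n =ᵐ[volume] fun k => if occ (low σ) k = m then wf (ψ i) n k else 0 :=
  wf_sector _ _ _ _ _

theorem energy_add_one_ne_zero (i : Fin 2) {n : ℕ} (k : Conf n) :
    ((energy i k + 1 : ℝ) : ℂ) ≠ 0 :=
  Complex.ofReal_ne_zero.2 (by linarith [energy_nonneg i k])

theorem Gop_inj (ψ : SpinFock) (h : Gop ψ = 0) : ψ = 0 := by
  refine spinFock_ext fun i n => ?_
  have h1 := wf_Gop ψ i n
  rw [h] at h1
  filter_upwards [h1, wf_zero n] with k h2 h3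
  change wf 0 n k = _ at h2
  rw [h3] at h2
  change _ = wf 0 n k
  rw [h3]
  exact (mul_eq_zero.1 h2.symm).resolve_left (inv_ne_zero (energy_add_one_ne_zero i k))

theorem Gop_symm (ψ φ : SpinFock) : inner ℂ (Gop ψ) φ = inner ℂ ψ (Gop φ) :=
  inner_diag (fun i => inner_mulOp (gSymbol i) fun n k => by
    change (starRingEnd ℂ) (((energy i k + 1 : ℝ) : ℂ)⁻¹) = _
    rw [map_inv₀, Complex.conj_ofReal]; rfl) ψ φ

theorem Sop_symm {σ : ℝ} (hσ : 0 < σ) (ψ φ : SpinFock) :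
    inner ℂ (Sop hσ ψ) φ = inner ℂ ψ (Sop hσ φ) :=
  inner_diag (fun i => inner_mulOp (sSymbol hσ i) fun n k => by
    change (starRingEnd ℂ) (ite _ (((energy i k : ℝ) : ℂ)⁻¹) 0) = ite _ _ _
    split_ifs
    · rw [map_inv₀, Complex.conj_ofReal]
    · rw [map_zero]) ψ φ

theorem sectorOp_symm (σ : ℝ) (m : ℕ) (ψ φ : SpinFock) :
    inner ℂ (sectorOp σ m ψ) φ = inner ℂ ψ (sectorOp σ m φ) :=
  inner_diag (fun _ => inner_sector _ _ _) ψ φ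

theorem sectorOp_sectorOp (σ : ℝ) (m : ℕ) (ψ : SpinFock) :
    sectorOp σ m (sectorOp σ m ψ) = sectorOp σ m ψ := by
  ext1 i
  exact sector_sector _ _ _ _

theorem wf_vacuumDown (i : Fin 2) (n : ℕ) :
    wf (vacuumDown i) n =ᵐ[volume] fun _ => if i = 1 ∧ n = 0 then 1 else 0 := by
  fin_cases i
  · filter_upwards [wf_zero n] with k hk
    rw [if_neg (by simp)]
    exact hk
  · cases n with
    | zero =>
      filter_upwards [wf_vacuum_zero] with k hk
      rw [if_pos ⟨rfl, rfl⟩]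
      exact hk
    | succ n =>
      filter_upwards [wf_vacuum_succ n] with k hk
      rw [if_neg (by simp)]
      exact hk

theorem occ_of_eq_zero (B : Set E3) {n : ℕ} (hn : n = 0) (k : Conf n) : occ B k = 0 := by
  subst hn
  exact (occ_eq_zero_iff B k).2 fun j => j.elim0

theorem energy_of_vacuum {i : Fin 2} {n : ℕ} (h : i = 1 ∧ n = 0) (k : Conf n) :
    energy i k = 0 := by
  obtain ⟨rfl, rfl⟩ := h
  exact energy_vacuum

theorem Gop_vacuumDown : Gop vacuumDown = vacuumDown := by
  refine spinFock_ext fun i n => ?_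
  filter_upwards [wf_Gop vacuumDown i n, wf_vacuumDown i n] with k h1 h2
  rw [h1, h2]
  split_ifs with h
  · rw [energy_of_vacuum h]; simp
  · rw [mul_zero]

theorem sectorOp_vacuumDown (σ : ℝ) : sectorOp σ 0 vacuumDown = vacuumDown := by
  refine spinFock_ext fun i n => ?_
  filter_upwards [wf_sectorOp σ 0 vacuumDown i n, wf_vacuumDown i n] with k h1 h2
  rw [h1, h2]
  by_cases h : i = 1 ∧ n = 0
  · rw [if_pos (occ_of_eq_zero _ h.2 k)]
  · rw [if_neg h, ite_self]

theorem Sop_vacuumDown {σ : ℝ} (hσ : 0 < σ) : Sop hσ vacuumDown = 0 := by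
  refine spinFock_ext fun i n => ?_
  filter_upwards [wf_Sop hσ vacuumDown i n, wf_vacuumDown i n, wf_zero n] with k h1 h2 h3
  rw [h1, h2]
  refine Eq.trans ?_ h3.symm
  by_cases h : i = 1 ∧ n = 0
  · rw [energy_of_vacuum h]; simp
  · rw [if_neg h, mul_zero]

theorem sectorOp_Gop (σ : ℝ) (m : ℕ) (ψ : SpinFock) :
    sectorOp σ m (Gop ψ) = Gop (sectorOp σ m ψ) := by
  refine spinFock_ext fun i n => ?_
  filter_upwards [wf_sectorOp σ m (Gop ψ) i n, wf_Gop ψ i n, wf_Gop (sectorOp σ m ψ) i n,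
    wf_sectorOp σ m ψ i n] with k h1 h2 h3 h4
  rw [h1, h2, h3, h4, mul_ite, mul_zero]

theorem Sop_Gop {σ : ℝ} (hσ : 0 < σ) (ψ : SpinFock) : Sop hσ (Gop ψ) = Gop (Sop hσ ψ) := by
  refine spinFock_ext fun i n => ?_
  filter_upwards [wf_Sop hσ (Gop ψ) i n, wf_Gop ψ i n, wf_Gop (Sop hσ ψ) i n,
    wf_Sop hσ ψ i n] with k h1 h2 h3 h4
  rw [h1, h2, h3, h4]
  ring

theorem sectorOp_Sop {σ : ℝ} (hσ : 0 < σ) (ψ : SpinFock) :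
    sectorOp σ 0 (Sop hσ ψ) = Sop hσ ψ := by
  refine spinFock_ext fun i n => ?_
  filter_upwards [wf_sectorOp σ 0 (Sop hσ ψ) i n, wf_Sop hσ ψ i n] with k h1 h2
  rw [h1, h2]
  split_ifs <;> simp

theorem Sop_sectorOp {σ : ℝ} (hσ : 0 < σ) (ψ : SpinFock) :
    Sop hσ (sectorOp σ 0 ψ) = Sop hσ ψ := by
  refine spinFock_ext fun i n => ?_
  filter_upwards [wf_sectorOp σ 0 ψ i n, wf_Sop hσ ψ i n, wf_Sop hσ (sectorOp σ 0 ψ) i n]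
    with k h1 h2 h3
  rw [h3, h1, h2]
  split_ifs <;> simp

theorem inner_vacuumDown_Sop {σ : ℝ} (hσ : 0 < σ) (ψ : SpinFock) :
    inner ℂ vacuumDown (Sop hσ ψ) = (0 : ℂ) := by
  rw [← Sop_symm, Sop_vacuumDown, inner_zero_left]

theorem norm_Sop_le {σ : ℝ} (hσ : 0 < σ) : min σ 2 * ‖Sop hσ‖ ≤ 1 := by
  have hm : 0 < min σ 2 := lt_min hσ two_pos
  have h : ‖Sop hσ‖ ≤ (min σ 2)⁻¹ := norm_diag_le (inv_nonneg.2 hm.le) fun i ψ =>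
    norm_mulOp_le _ (inv_nonneg.2 hm.le) (fun n k => norm_sFn_le hσ i k) ψ
  calc _ ≤ min σ 2 * (min σ 2)⁻¹ := mul_le_mul_of_nonneg_left h hm.le
    _ = 1 := mul_inv_cancel₀ hm.ne'

/-- `H₀ S = (1 - P_{Ω_↓}) Q_σ`, written with the resolvent `(H₀ + 1)⁻¹`. -/
theorem Sop_eq {σ : ℝ} (hσ : 0 < σ) (ψ : SpinFock) : Sop hσ ψ =
    Gop (Sop hσ ψ + sectorOp σ 0 ψ - inner ℂ vacuumDown ψ • vacuumDown) := by
  refine spinFock_ext fun i n => ?_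
  have hm : 0 < min σ 2 := lt_min hσ two_pos
  filter_upwards [wf_Gop (Sop hσ ψ + sectorOp σ 0 ψ - inner ℂ vacuumDown ψ • vacuumDown) i n,
    wf_sub ((Sop hσ ψ + sectorOp σ 0 ψ) i) ((inner ℂ vacuumDown ψ • vacuumDown : SpinFock) i) n,
    wf_add (Sop hσ ψ i) (sectorOp σ 0 ψ i) n, wf_Sop hσ ψ i n, wf_sectorOp σ 0 ψ i n,
    wf_inner_smul_vacuumDown ψ i n] with k h1 h2 h3 h4 h5 h6
  rw [h1]
  change _ = _ * wf ((Sop hσ ψ + sectorOp σ 0 ψ) i -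
    (inner ℂ vacuumDown ψ • vacuumDown : SpinFock) i) n k
  rw [h2]
  change _ = _ * (wf (Sop hσ ψ i + sectorOp σ 0 ψ i) n k - _)
  rw [h3, h4, h5, h6]
  by_cases h : i = 1 ∧ n = 0
  · rw [if_pos h, if_pos (occ_of_eq_zero _ h.2 k), if_pos (occ_of_eq_zero _ h.2 k),
      energy_of_vacuum h]
    simp
  · rw [if_neg h]
    split_ifs with h0
    · have he : ((energy i k : ℝ) : ℂ) ≠ 0 :=
        Complex.ofReal_ne_zero.2 (hm.trans_le (le_energy h0 h)).ne'
      have he' := energy_add_one_ne_zero i k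
      push_cast at he' ⊢
      field_simp
      ring
    · simp

/-- A pointwise lower bound on the energy gives a lower bound on the quadratic form of `H₀ + 1`. -/
theorem form_lower_bound {a : ℝ} (ha : 0 < a) (y : SpinFock)
    (h : ∀ i n, ∀ᵐ k : Conf n, wf (Gop y i) n k ≠ 0 → a ≤ energy i k + 1) :
    a * ‖Gop y‖ ^ 2 ≤ (inner ℂ (Gop y) y).re := by
  rw [spinFock_norm_sq, spinFock_inner, Complex.re_sum, Finset.mul_sum]
  refine Finset.sum_le_sum fun i _ => ?_
  have h1 := lintegral_weight_le_re_inner (Gop y i) (y i) (fun _ _ => a) (fun _ _ => ha.le)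
    fun n => by
      filter_upwards [h i n, wf_Gop y i n] with k h2 h3
      have h4 : wf (y i) n k = ((energy i k + 1 : ℝ) : ℂ) * wf (Gop y i) n k := by
        rw [h3, mul_inv_cancel_left₀ (energy_add_one_ne_zero i k)]
      rw [h4, RCLike.inner_apply, mul_assoc, Complex.mul_conj, Complex.normSq_eq_norm_sq,
        ← Complex.ofReal_mul, Complex.ofReal_re]
      by_cases h0 : wf (Gop y i) n k = 0
      · simp [h0]
      · exact mul_le_mul_of_nonneg_right (h2 h0) (sq_nonneg _)
  have h2 : ∑' n, ∫⁻ k : Conf n, ENNReal.ofReal a * ‖wf (Gop y i) n k‖ₑ ^ 2 =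
      ENNReal.ofReal (a * ‖Gop y i‖ ^ 2) := by
    rw [ENNReal.ofReal_mul ha.le, ← enorm_sq_eq_ofReal, enorm_sq_eq, ← ENNReal.tsum_mul_left]
    refine tsum_congr fun n => ?_
    rw [lintegral_const_mul _ ((stronglyMeasurable_wf _ n).measurable.enorm.pow_const 2)]
  rw [h2] at h1
  have h3 : 0 ≤ (inner ℂ (Gop y i) (y i)).re := by
    by_contra! h4
    rw [ENNReal.ofReal_of_nonpos h4.le, nonpos_iff_eq_zero, ENNReal.ofReal_eq_zero] at h1
    have h5 : ‖Gop y i‖ ^ 2 = 0 := le_antisymm (nonpos_of_mul_nonpos_right h1 ha) (sq_nonneg _)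
    rw [norm_eq_zero.1 (pow_eq_zero_iff two_ne_zero |>.1 h5), inner_zero_left] at h4
    exact lt_irrefl _ h4
  exact (ENNReal.ofReal_le_ofReal_iff h3).1 h1

/-! ### The field operator and the Hamiltonian as relations -/

section

/-- A linear relation which is single-valued, total and bounded is a bounded operator. -/
theorem exists_clm_of_graph {V W : Type*} [NormedAddCommGroup V] [NormedSpace ℂ V]
    [NormedAddCommGroup W] [NormedSpace ℂ W] (S : Submodule ℂ (V × W))
    (h0 : ∀ y, (0, y) ∈ S → y = 0) (M : ℝ) (h : ∀ x, ∃ y, (x, y) ∈ S ∧ ‖y‖ ≤ M * ‖x‖) :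
    ∃ A : V →L[ℂ] W, ∀ x, (x, A x) ∈ S := by
  choose A hA hb using h
  have hu : ∀ {x y y'}, (x, y) ∈ S → (x, y') ∈ S → y = y' := fun {x y y'} h1 h2 => by
    have := S.sub_mem h1 h2
    rw [Prod.mk_sub_mk, sub_self] at this
    exact sub_eq_zero.1 (h0 _ this)
  exact ⟨LinearMap.mkContinuous
    { toFun := A
      map_add' := fun x y => hu (hA _) (S.add_mem (hA x) (hA y))
      map_smul' := fun c x => hu (hA _) (S.smul_mem c (hA x)) } M hb, hA⟩

/-- The form factor `χ_σ f / √ω`. -/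
def formFactor (f : E3 → ℂ) (σ : ℝ) (k : E3) : ℂ := cutoff σ f k / (Real.sqrt ‖k‖ : ℂ)

theorem memLp_formFactor {f : E3 → ℂ} (hf : MemLp (fun k => f k / (Real.sqrt ‖k‖ : ℂ)) 2 volume)
    (σ : ℝ) : MemLp (formFactor f σ) 2 volume := by
  classical
  have e : formFactor f σ = (low σ)ᶜ.indicator fun k => f k / (Real.sqrt ‖k‖ : ℂ) := by
    funext k
    rw [Set.indicator_apply]
    change (if σ ≤ ‖k‖ then f k else 0) / _ = _
    have : k ∈ (low σ)ᶜ ↔ σ ≤ ‖k‖ := not_lt (a := ‖k‖) (b := σ)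
    by_cases hk : σ ≤ ‖k‖
    · rw [if_pos hk, if_pos (this.2 hk)]
    · rw [if_neg hk, if_neg (mt this.1 hk), zero_div]
  rw [e]
  exact hf.indicator (measurableSet_low σ).compl

theorem formFactor_low (f : E3 → ℂ) {σ : ℝ} {k : E3} (hk : k ∈ low σ) : formFactor f σ k = 0 := by
  rw [formFactor, cutoff, if_neg (not_le.2 hk), zero_div]

/-- The relation `θ = (4π)⁻¹ (a*(g) + a(g)) ψ`, in terms of wave functions. -/
def FieldRel (g : E3 → ℂ) (ψ θ : Fock) : Prop :=
  ∃ a b, CreRel g ψ a ∧ AnnRel g ψ b ∧ θ = ((4 * Real.pi : ℝ) : ℂ)⁻¹ • (a + b)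

/-- The field operator is symmetric. -/
theorem FieldRel.inner_eq {g : E3 → ℂ} (hg : MemLp g 2 volume) {ψ η φ θ : Fock}
    (h1 : FieldRel g ψ η) (h2 : FieldRel g φ θ) : inner ℂ η φ = inner ℂ ψ θ := by
  obtain ⟨a, b, ha, hb, rfl⟩ := h1
  obtain ⟨a', b', ha', hb', rfl⟩ := h2
  have e1 := inner_annRel_creRel hg hb ha'
  have e2 : inner ℂ a φ = inner ℂ ψ b' := by
    rw [← inner_conj_symm, ← inner_annRel_creRel hg hb' ha, inner_conj_symm]
  rw [inner_smul_left, inner_smul_right, inner_add_left, inner_add_right, e1, e2, map_inv₀,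
    Complex.conj_ofReal, add_comm]

theorem FieldRel.mem_graph {f : E3 → ℂ} {σ : ℝ} (hg : MemLp (formFactor f σ) 2 volume)
    {ψ θ : Fock} (h : FieldRel (formFactor f σ) ψ θ) : (ψ, θ) ∈ (field (cutoff σ f)).graph := by
  obtain ⟨a, b, ha, hb, rfl⟩ := h
  have ha' : (ψ, a) ∈ (creation (formFactor f σ)).graph :=
    (mem_graph_creation _ _).2 ha
  have hb' := mem_annihilation_graph hg hb
  obtain ⟨⟨x, hx⟩, h1, h2⟩ := (LinearPMap.mem_graph_iff _).1 ha'
  obtain ⟨⟨y, hy⟩, h3, h4⟩ := (LinearPMap.mem_graph_iff _).1 hb'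
  change x = ψ at h1
  change y = ψ at h3
  subst h1
  subst h3
  refine (LinearPMap.mem_graph_iff _).2 ⟨⟨y, hx, hy⟩, rfl, ?_⟩
  change ((4 * Real.pi : ℝ) : ℂ)⁻¹ •
    (creation (formFactor f σ) ⟨y, hx⟩ + annihilation (formFactor f σ) ⟨y, hy⟩) = _
  rw [h2, h4]

theorem FieldRel.sector {g : E3 → ℂ} {ψ θ : Fock} (h : FieldRel g ψ θ) {B : Set E3}
    (hB : MeasurableSet B) (hgB : ∀ k ∈ B, g k = 0) (m : ℕ) :
    FieldRel g (sector B hB m ψ) (sector B hB m θ) := by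
  obtain ⟨a, b, ha, hb, rfl⟩ := h
  exact ⟨_, _, ha.sector hB hgB m, hb.sector hB hgB m, by rw [map_smul, map_add]⟩

/-- The field operator is bounded relative to the square root of the energy: the momenta outside the
cutoff carry at least the energy `σ` each. -/
theorem exists_fieldRel {f : E3 → ℂ} {σ : ℝ} (hσ : 0 < σ)
    (hg : MemLp (formFactor f σ) 2 volume) : ∃ M : ℝ, 0 ≤ M ∧ ∀ (y : SpinFock) (i : Fin 2),
      ∃ θ, FieldRel (formFactor f σ) (Gop y i) θ ∧
        ‖θ‖ ^ 2 ≤ M * (inner ℂ (Gop y i) (y i)).re := by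
  set N : ℝ≥0∞ := ∫⁻ q, ‖formFactor f σ q‖ₑ ^ 2 with hN
  have hNfin : N ≠ ∞ := by
    have := hg.2
    rw [eLpNorm_lt_top_iff_lintegral_rpow_enorm_lt_top (by norm_num) (by norm_num)] at this
    simpa [hN] using this.ne
  set K : ℝ := 1 + σ⁻¹ with hK
  have hK0 : 0 ≤ K := by positivity
  -- `‖a + b‖² ≤ 2 ‖a‖² + 2 ‖b‖²`, and each of the two squares is at most `N K r`.
  refine ⟨4 * (N.toReal * K), by positivity, fun y i => ?_⟩
  set ψ := Gop y i with hψ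
  set r := (inner ℂ ψ (y i)).re with hr
  have h1 := lintegral_weight_le_re_inner ψ (y i) (fun _ k => energy i k + 1)
    (fun _ k => by linarith [energy_nonneg i k]) fun n => by
      filter_upwards [wf_Gop y i n] with k h3
      have h4 : wf (y i) n k = ((energy i k + 1 : ℝ) : ℂ) * wf ψ n k := by
        rw [h3, mul_inv_cancel_left₀ (energy_add_one_ne_zero i k)]
      rw [h4, RCLike.inner_apply, mul_assoc, Complex.mul_conj, Complex.normSq_eq_norm_sq,
        ← Complex.ofReal_mul, Complex.ofReal_re]
  have hr0 : 0 ≤ r ∨ ψ = 0 := by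
    by_contra! h2
    rw [ENNReal.ofReal_of_nonpos h2.1.le, nonpos_iff_eq_zero] at h1
    refine h2.2 ?_
    have h3 : ‖ψ‖ₑ ^ 2 = 0 := by
      rw [enorm_sq_eq]
      refine le_antisymm (le_trans (ENNReal.tsum_le_tsum fun n => lintegral_mono fun k => ?_)
        h1.le) zero_le
      refine le_mul_of_one_le_left zero_le ?_
      rw [← ENNReal.ofReal_one]
      exact ENNReal.ofReal_le_ofReal (by linarith [energy_nonneg i k])
    exact enorm_eq_zero.1 (pow_eq_zero_iff two_ne_zero |>.1 h3)
  have hr1 : 0 ≤ r := by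
    rcases hr0 with h | h
    · exact h
    · rw [hr, h, inner_zero_left, Complex.zero_re]
  have h2 : ∑' n, ∫⁻ k : Conf n, (1 + occ (low σ)ᶜ k : ℝ≥0∞) * ‖wf ψ n k‖ₑ ^ 2 ≤
      ENNReal.ofReal (K * r) := by
    rw [ENNReal.ofReal_mul hK0]
    refine le_trans ?_ (mul_le_mul_right h1 _)
    rw [← ENNReal.tsum_mul_left]
    refine ENNReal.tsum_le_tsum fun n => ?_
    rw [← lintegral_const_mul' _ _ ENNReal.ofReal_ne_top]
    refine lintegral_mono fun k => ?_
    change _ ≤ _ * (_ * _)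
    rw [← mul_assoc, ← ENNReal.ofReal_mul hK0]
    refine mul_le_mul_left ?_ _
    have h3 : (1 + occ (low σ)ᶜ k : ℝ≥0∞) = ENNReal.ofReal (1 + occ (low σ)ᶜ k) := by
      rw [ENNReal.ofReal_add zero_le_one (Nat.cast_nonneg _), ENNReal.ofReal_one,
        ENNReal.ofReal_natCast]
    rw [h3]
    refine ENNReal.ofReal_le_ofReal ?_
    classical
    have h4 : σ * occ (low σ)ᶜ k ≤ energy i k := by
      rw [occ_eq_card, mul_comm, ← nsmul_eq_mul]
      calc _ ≤ ∑ j ∈ Finset.univ.filter fun j => k j ∈ (low σ)ᶜ, ‖k j‖ :=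
            Finset.card_nsmul_le_sum _ _ _ fun j hj => not_lt.1 (Finset.mem_filter.1 hj).2
        _ ≤ ∑ j, ‖k j‖ := Finset.sum_le_sum_of_subset_of_nonneg (Finset.filter_subset _ _)
            fun _ _ _ => norm_nonneg _
        _ ≤ energy i k := le_add_of_nonneg_left (by split_ifs <;> norm_num)
    have h5 : (occ (low σ)ᶜ k : ℝ) ≤ σ⁻¹ * energy i k := by
      rw [← div_eq_inv_mul, le_div_iff₀ hσ, mul_comm]
      exact h4
    have := energy_nonneg i k
    have : 0 ≤ σ⁻¹ := by positivity
    rw [hK]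
    nlinarith
  have hfin := ne_top_of_le_ne_top ENNReal.ofReal_ne_top h2
  have hhigh : ∀ k ∉ (low σ)ᶜ, formFactor f σ k = 0 := fun k hk =>
    formFactor_low f (not_not.1 hk)
  have key : ∀ a : Fock, ‖a‖ₑ ^ 2 ≤ N * ∑' n, ∫⁻ k : Conf n,
      (1 + occ (low σ)ᶜ k : ℝ≥0∞) * ‖wf ψ n k‖ₑ ^ 2 → ‖a‖ ^ 2 ≤ N.toReal * K * r := by
    intro a ha
    have h3 := ha.trans (mul_le_mul_right h2 N)
    rw [enorm_sq_eq_ofReal, ← ENNReal.ofReal_toReal hNfin,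
      ← ENNReal.ofReal_mul ENNReal.toReal_nonneg,
      ENNReal.ofReal_le_ofReal_iff (by positivity)] at h3
    rw [mul_assoc]
    exact h3
  obtain ⟨a, ha, ha'⟩ := exists_creRel hg (measurableSet_low σ).compl hhigh ψ hfin
  obtain ⟨b, hb, hb'⟩ := exists_annRel hg (measurableSet_low σ).compl hhigh ψ hfin
  refine ⟨_, ⟨a, b, ha, hb, rfl⟩, ?_⟩
  have h3 := key a ha'
  have h4 := key b hb'
  have h5 : ‖(((4 * Real.pi : ℝ) : ℂ)⁻¹ • (a + b) : Fock)‖ ≤ ‖a‖ + ‖b‖ := by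
    rw [norm_smul, norm_inv, Complex.norm_real, Real.norm_of_nonneg (by positivity)]
    refine le_trans ?_ (norm_add_le a b)
    refine mul_le_of_le_one_left (norm_nonneg _) (inv_le_one_of_one_le₀ ?_)
    linarith [Real.pi_gt_three]
  have h6 := pow_le_pow_left₀ (norm_nonneg _) h5 2
  nlinarith [sq_nonneg (‖a‖ - ‖b‖)]

/-- Flipping the spin. -/
def flip (i : Fin 2) : Fin 2 := 1 - i

/-- The relation `η = T_σ ψ`, in terms of wave functions. -/
def TRel (g : E3 → ℂ) (ψ θ : SpinFock) : Prop := ∀ i, FieldRel g (ψ (flip i)) (θ i)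

theorem sum_flip {M : Type*} [AddCommMonoid M] (F : Fin 2 → M) :
    ∑ i, F (flip i) = ∑ i, F i := by
  rw [Fin.sum_univ_two, Fin.sum_univ_two, add_comm]
  rfl

theorem flip_flip (i : Fin 2) : flip (flip i) = i := by
  fin_cases i <;> rfl

theorem TRel.inner_eq {g : E3 → ℂ} (hg : MemLp g 2 volume) {ψ η φ θ : SpinFock}
    (h1 : TRel g ψ η) (h2 : TRel g φ θ) : inner ℂ η φ = inner ℂ ψ θ := by
  rw [spinFock_inner, spinFock_inner, ← sum_flip]
  refine Finset.sum_congr rfl fun i _ => ?_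
  have := h1 (flip i)
  rw [flip_flip] at this
  exact this.inner_eq hg (φ := φ (flip i)) (h2 i)

theorem TRel.mem_graph {f : E3 → ℂ} {σ : ℝ} (hg : MemLp (formFactor f σ) 2 volume)
    {ψ θ : SpinFock} (h : TRel (formFactor f σ) ψ θ) : (ψ, θ) ∈ (Tint f σ).graph := by
  have h0 := (LinearPMap.mem_graph_iff _).1 ((h 1).mem_graph hg)
  have h1 := (LinearPMap.mem_graph_iff _).1 ((h 0).mem_graph hg)
  obtain ⟨⟨x0, hx0⟩, e0, e0'⟩ := h0
  obtain ⟨⟨x1, hx1⟩, e1, e1'⟩ := h1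
  change x0 = ψ 0 at e0
  change x1 = ψ 1 at e1
  subst e0
  subst e1
  refine (LinearPMap.mem_graph_iff _).2 ⟨⟨ψ, fun j => ?_⟩, rfl, ?_⟩
  · fin_cases j
    · exact hx0
    · exact hx1
  · ext1 i
    change ∑ j, _ • field (cutoff σ f) ⟨ψ j, _⟩ = θ i
    rw [Fin.sum_univ_two]
    fin_cases i
    · change (0 : ℂ) • field (cutoff σ f) ⟨ψ 0, hx0⟩ + (1 : ℂ) • field (cutoff σ f) ⟨ψ 1, hx1⟩ = θ 0
      rw [zero_smul, zero_add, one_smul, e1']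
    · change (1 : ℂ) • field (cutoff σ f) ⟨ψ 0, hx0⟩ + (0 : ℂ) • field (cutoff σ f) ⟨ψ 1, hx1⟩ = θ 1
      rw [zero_smul, add_zero, one_smul, e0']

/-- The range of `(H₀ + 1)⁻¹` is in the domain of `T_σ`, which is bounded relative to the square
root of the energy. -/
theorem exists_TRel {f : E3 → ℂ} {σ : ℝ} (hσ : 0 < σ) (hg : MemLp (formFactor f σ) 2 volume) :
    ∃ M : ℝ, 0 ≤ M ∧ ∀ y : SpinFock, ∃ θ, TRel (formFactor f σ) (Gop y) θ ∧
      ‖θ‖ ^ 2 ≤ M * (inner ℂ (Gop y) y).re := by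
  obtain ⟨M, hM, h⟩ := exists_fieldRel hσ hg
  refine ⟨M, hM, fun y => ?_⟩
  choose θ h1 h2 using h y
  refine ⟨WithLp.toLp 2 fun i => θ (flip i), fun i => h1 (flip i), ?_⟩
  rw [spinFock_norm_sq, spinFock_inner, Complex.re_sum, Finset.mul_sum, ← sum_flip]
  refine Finset.sum_le_sum fun i _ => ?_
  change ‖θ (flip (flip i))‖ ^ 2 ≤ _
  rw [flip_flip]
  exact h2 i

theorem norm_sq_Gop_le (y : SpinFock) : ‖Gop y‖ ^ 2 ≤ (inner ℂ (Gop y) y).re := by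
  have := form_lower_bound one_pos y fun i n => Filter.Eventually.of_forall fun k _ => by
    linarith [energy_nonneg i k]
  rwa [one_mul] at this

/-- `T_σ (H₀ + 1)⁻¹` is a bounded operator, and `T_σ` is bounded relative to the form of
`H₀ + 1`. -/
theorem exists_TG {f : E3 → ℂ} {σ : ℝ} (hσ : 0 < σ) (hg : MemLp (formFactor f σ) 2 volume) :
    ∃ (TG : SpinFock →L[ℂ] SpinFock) (C : ℝ), 0 < C ∧ (∀ y, TRel (formFactor f σ) (Gop y) (TG y)) ∧
      ∀ y, ‖inner ℂ (Gop y) (TG y)‖ ≤ C * (inner ℂ (Gop y) y).re := by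
  obtain ⟨M, hM, h⟩ := exists_TRel hσ hg
  have hform : ∀ y : SpinFock, (inner ℂ (Gop y) y).re ≤ ‖y‖ ^ 2 := fun y => by
    have h1 := norm_sq_Gop_le y
    have h2 := (Complex.re_le_norm _).trans (norm_inner_le_norm (𝕜 := ℂ) (Gop y) y)
    nlinarith [sq_nonneg (‖Gop y‖ - ‖y‖)]
  obtain ⟨TG, hTG⟩ := exists_clm_of_graph
    ((Tint f σ).graph.comap ((Gop : SpinFock →ₗ[ℂ] SpinFock).prodMap LinearMap.id))
    (fun y hy => by
      have : (Gop 0, y) ∈ (Tint f σ).graph := hy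
      rw [map_zero] at this
      exact LinearPMap.graph_fst_eq_zero_snd _ this rfl) (Real.sqrt M) fun x => by
        obtain ⟨θ, h1, h2⟩ := h x
        refine ⟨θ, h1.mem_graph hg, le_of_sq_le_sq ?_ (by positivity)⟩
        rw [mul_pow, Real.sq_sqrt hM]
        exact h2.trans (mul_le_mul_of_nonneg_left (hform x) hM)
  have hTG' : ∀ y, (Gop y, TG y) ∈ (Tint f σ).graph := hTG
  have huniq : ∀ {y θ}, TRel (formFactor f σ) (Gop y) θ → TG y = θ := fun {y θ} h1 =>
    LinearPMap.mem_graph_snd_inj _ (hTG' y) (h1.mem_graph hg) rfl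
  refine ⟨TG, Real.sqrt M + 1, by positivity, fun y => ?_, fun y => ?_⟩
  · obtain ⟨θ, h1, -⟩ := h y
    rwa [huniq h1]
  · obtain ⟨θ, h1, h2⟩ := h y
    rw [huniq h1]
    set a := (inner ℂ (Gop y) y).re with ha
    have h3 := norm_sq_Gop_le y
    have ha0 : 0 ≤ a := (sq_nonneg _).trans h3
    have h4 : ‖Gop y‖ ≤ Real.sqrt a := Real.le_sqrt_of_sq_le h3
    have h5 : ‖θ‖ ≤ Real.sqrt M * Real.sqrt a := by
      rw [← Real.sqrt_mul hM]
      exact Real.le_sqrt_of_sq_le h2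
    calc _ ≤ ‖Gop y‖ * ‖θ‖ := norm_inner_le_norm _ _
      _ ≤ Real.sqrt a * (Real.sqrt M * Real.sqrt a) := by gcongr
      _ = Real.sqrt M * a := by
        rw [mul_left_comm, Real.mul_self_sqrt ha0]
      _ ≤ (Real.sqrt M + 1) * a := by gcongr; linarith

/-- The operator `T_σ (H₀ + 1)⁻¹`. -/
def TGop {f : E3 → ℂ} {σ : ℝ} (hσ : 0 < σ) (hg : MemLp (formFactor f σ) 2 volume) :
    SpinFock →L[ℂ] SpinFock := (exists_TG hσ hg).choose

variable {f : E3 → ℂ} {σ : ℝ} (hσ : 0 < σ) (hg : MemLp (formFactor f σ) 2 volume)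

theorem TRel_TGop (y : SpinFock) : TRel (formFactor f σ) (Gop y) (TGop hσ hg y) :=
  (exists_TG hσ hg).choose_spec.choose_spec.2.1 y

theorem TGop_eq {y θ : SpinFock} (h : TRel (formFactor f σ) (Gop y) θ) : TGop hσ hg y = θ :=
  LinearPMap.mem_graph_snd_inj _ ((TRel_TGop hσ hg y).mem_graph hg) (h.mem_graph hg) rfl

theorem sectorOp_TGop (m : ℕ) (y : SpinFock) :
    sectorOp σ m (TGop hσ hg y) = TGop hσ hg (sectorOp σ m y) := by
  refine (TGop_eq hσ hg fun i => ?_).symm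
  rw [← sectorOp_Gop]
  exact (TRel_TGop hσ hg y i).sector (measurableSet_low σ) (fun k hk => formFactor_low f hk) m

/-- The perturbation theoretic data of the spin-boson Hamiltonian. -/
def gapData : GapData SpinFock where
  G := Gop
  TG := TGop hσ hg
  Q := sectorOp σ 0
  S := Sop hσ
  Ω := vacuumDown
  c := min σ 2
  C := (exists_TG hσ hg).choose_spec.choose
  c_pos := lt_min hσ two_pos
  C_pos := (exists_TG hσ hg).choose_spec.choose_spec.1
  G_inj := Gop_inj
  G_symm := Gop_symm
  G_Ω := Gop_vacuumDown
  Q_Ω := sectorOp_vacuumDown σ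
  norm_Ω := norm_vacuumDown
  T_symm x y := (TRel_TGop hσ hg x).inner_eq hg (TRel_TGop hσ hg y)
  G_nonneg := norm_sq_Gop_le
  T_bound := (exists_TG hσ hg).choose_spec.choose_spec.2.2
  Q_symm := sectorOp_symm σ 0
  Q_idem := sectorOp_sectorOp σ 0
  Q_G := sectorOp_Gop σ 0
  Q_T := sectorOp_TGop hσ hg 0
  S_eq := Sop_eq hσ
  S_G := Sop_Gop hσ
  Q_S := sectorOp_Sop hσ
  S_Q := Sop_sectorOp hσ
  inner_S := inner_vacuumDown_Sop hσ
  S_norm := norm_Sop_le hσ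
  gap y hQ hΩ := by
    have hm : 0 < min σ 2 := lt_min hσ two_pos
    refine form_lower_bound (by linarith) y fun i n => ?_
    have h1 := wf_sectorOp σ 0 (Gop y) i n
    have h2 := wf_inner_smul_vacuumDown (Gop y) i n
    rw [hQ] at h1
    rw [hΩ, zero_smul] at h2
    filter_upwards [h1, h2, wf_zero n] with k h3 h4 h5 h6
    have h7 : ¬ (i = 1 ∧ n = 0) := fun h8 => by
      rw [if_pos h8] at h4
      exact h6 (h4.symm.trans h5)
    have h8 : occ (low σ) k = 0 := by
      by_contra h9
      rw [if_neg h9] at h3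
      exact h6 h3
    linarith [le_energy h8 h7]

/-- The relation `η = H_{λ,σ} ψ`, in terms of wave functions. -/
def HRel (g : E3 → ℂ) (lam : ℂ) (ψ η : SpinFock) : Prop :=
  ∃ κ θ : SpinFock, (∀ i, (ψ i, κ i) ∈ dGammaGraph fun k => (‖k‖ : ℂ)) ∧ TRel g ψ θ ∧
    ∀ i, η i = (if i = 0 then (2 : ℂ) else 0) • ψ i + κ i + lam • θ i

/-- `(1 ⊗ H_f) (H₀ + 1)⁻¹ y = y - (1 + τ ⊗ 1) (H₀ + 1)⁻¹ y` with `τ = diag(2, 0)`. -/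
theorem dGammaGraph_Gop (y : SpinFock) (i : Fin 2) :
    (Gop y i, y i - Gop y i - (if i = 0 then (2 : ℂ) else 0) • Gop y i) ∈
      dGammaGraph fun k => (‖k‖ : ℂ) := by
  intro n
  filter_upwards [wf_sub (y i - Gop y i) ((if i = 0 then (2 : ℂ) else 0) • Gop y i) n,
    wf_sub (y i) (Gop y i) n, wf_smul (if i = 0 then (2 : ℂ) else 0) (Gop y i) n,
    wf_Gop y i n] with k h1 h2 h3 h4
  have h5 : wf (y i) n k = ((energy i k + 1 : ℝ) : ℂ) * wf (Gop y i) n k := by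
    rw [h4, mul_inv_cancel_left₀ (energy_add_one_ne_zero i k)]
  refine h1.trans ?_
  rw [h2, h3, h5, energy]
  push_cast
  split_ifs <;> push_cast <;> ring

theorem HRel_Gop (lam : ℂ) (y : SpinFock) :
    HRel (formFactor f σ) lam (Gop y) ((gapData hσ hg).Hz lam 0 y) := by
  refine ⟨WithLp.toLp 2 fun i => y i - Gop y i - (if i = 0 then (2 : ℂ) else 0) • Gop y i,
    TGop hσ hg y, dGammaGraph_Gop y, TRel_TGop hσ hg y, fun i => ?_⟩
  change y i + lam • TGop hσ hg y i - Gop y i - (0 : ℂ) • Gop y i =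
    _ + (y i - Gop y i - (if i = 0 then (2 : ℂ) else 0) • Gop y i) + _
  module

/-- The domain of `H_{λ,σ}` is the range of `(H₀ + 1)⁻¹`. -/
theorem exists_eq_Gop {ψ κ : SpinFock} (h : ∀ i, (ψ i, κ i) ∈ dGammaGraph fun k => (‖k‖ : ℂ)) :
    ∃ y, ψ = Gop y := by
  refine ⟨WithLp.toLp 2 fun i => (if i = 0 then (2 : ℂ) else 0) • ψ i + κ i + ψ i,
    spinFock_ext fun i n => ?_⟩
  set y : SpinFock := WithLp.toLp 2 fun i => (if i = 0 then (2 : ℂ) else 0) • ψ i + κ i + ψ i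
  filter_upwards [wf_Gop y i n, wf_add ((if i = 0 then (2 : ℂ) else 0) • ψ i + κ i) (ψ i) n,
    wf_add ((if i = 0 then (2 : ℂ) else 0) • ψ i) (κ i) n,
    wf_smul (if i = 0 then (2 : ℂ) else 0) (ψ i) n, h i n] with k h1 h2 h3 h4 h5
  rw [h1]
  change _ = _ * wf ((if i = 0 then (2 : ℂ) else 0) • ψ i + κ i + ψ i) n k
  rw [h2, h3, h4, show wf (κ i) n k = (∑ j, (‖k j‖ : ℂ)) * wf (ψ i) n k from h5,
    eq_inv_mul_iff_mul_eq₀ (energy_add_one_ne_zero i k), energy]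
  push_cast
  split_ifs <;> push_cast <;> ring

/-- Every pair in the graph of `H_{λ,σ}` is of the form `(G y, H_{λ,σ} G y)` with
`G = (H₀ + 1)⁻¹`. -/
theorem HRel.exists_eq {lam : ℂ} {ψ η : SpinFock} (h : HRel (formFactor f σ) lam ψ η) :
    ∃ y, ψ = Gop y ∧ η = (gapData hσ hg).Hz lam 0 y := by
  obtain ⟨κ, θ, h1, h2, h3⟩ := h
  obtain ⟨y, rfl⟩ := exists_eq_Gop h1
  refine ⟨y, rfl, ?_⟩
  have h4 : ∀ i, κ i = y i - Gop y i - (if i = 0 then (2 : ℂ) else 0) • Gop y i := fun i =>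
    LinearPMap.mem_graph_snd_inj (dGamma fun k => (‖k‖ : ℂ))
      ((mem_graph_dGamma _ _).2 (h1 i)) ((mem_graph_dGamma _ _).2 (dGammaGraph_Gop y i)) rfl
  ext1 i
  rw [h3, h4, ← TGop_eq hσ hg h2]
  change _ = y i + lam • TGop hσ hg y i - Gop y i - (0 : ℂ) • Gop y i
  module

/-- The free Hamiltonian in terms of wave functions. -/
theorem mem_H0_graph {ψ η : SpinFock} : (ψ, η) ∈ H0.graph ↔ ∃ κ : SpinFock,
    (∀ i, (ψ i, κ i) ∈ dGammaGraph fun k => (‖k‖ : ℂ)) ∧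
      ∀ i, η i = (if i = 0 then (2 : ℂ) else 0) • ψ i + κ i := by
  have hval : ∀ (hd : ∀ j, ψ j ∈ Hf.domain) (hd1 : ψ ∈ H0.domain) (i : Fin 2),
      (H0 ⟨ψ, hd1⟩) i = (if i = 0 then (2 : ℂ) else 0) • ψ i + Hf ⟨ψ i, hd i⟩ := by
    intro hd hd1 i
    change (∑ j, _ • ψ j) + ∑ j, _ • Hf ⟨ψ j, hd j⟩ = _
    rw [Fin.sum_univ_two, Fin.sum_univ_two]
    fin_cases i
    · change (2 : ℂ) • ψ 0 + (0 : ℂ) • ψ 1 + ((1 : Matrix (Fin 2) (Fin 2) ℂ) 0 0 • Hf ⟨ψ 0, hd 0⟩ +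
        (1 : Matrix (Fin 2) (Fin 2) ℂ) 0 1 • Hf ⟨ψ 1, hd 1⟩) = (2 : ℂ) • ψ 0 + Hf ⟨ψ 0, hd 0⟩
      simp
    · change (0 : ℂ) • ψ 0 + (0 : ℂ) • ψ 1 + ((1 : Matrix (Fin 2) (Fin 2) ℂ) 1 0 • Hf ⟨ψ 0, hd 0⟩ +
        (1 : Matrix (Fin 2) (Fin 2) ℂ) 1 1 • Hf ⟨ψ 1, hd 1⟩) = (0 : ℂ) • ψ 1 + Hf ⟨ψ 1, hd 1⟩
      simp
  have hgr : ∀ {x y : Fock}, (x, y) ∈ Hf.graph ↔ (x, y) ∈ dGammaGraph fun k => (‖k‖ : ℂ) :=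
    mem_graph_dGamma _ _
  constructor
  · intro h
    obtain ⟨⟨x, hx⟩, h1, h2⟩ := (LinearPMap.mem_graph_iff _).1 h
    change x = ψ at h1
    subst h1
    have hd : ∀ j, x j ∈ Hf.domain := hx.2
    refine ⟨WithLp.toLp 2 fun i => Hf ⟨x i, hd i⟩,
      fun i => hgr.1 (LinearPMap.mem_graph Hf ⟨x i, hd i⟩), fun i => ?_⟩
    rw [← hval hd hx]
    exact congrArg (fun v : SpinFock => v i) h2.symm
  · rintro ⟨κ, h1, h2⟩
    have h3 : ∀ i, ∃ hd : ψ i ∈ Hf.domain, Hf ⟨ψ i, hd⟩ = κ i := fun i => by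
      obtain ⟨⟨x, hx⟩, e1, e2⟩ := (LinearPMap.mem_graph_iff _).1 (hgr.2 (h1 i))
      change x = ψ i at e1
      subst e1
      exact ⟨hx, e2⟩
    have hd : ψ ∈ H0.domain := ⟨fun j => Submodule.mem_top, fun j => (h3 j).1⟩
    refine (LinearPMap.mem_graph_iff _).2 ⟨⟨ψ, hd⟩, rfl, ?_⟩
    ext1 i
    rw [hval (fun j => (h3 j).1) hd, (h3 i).2]
    exact (h2 i).symm

/-- The Hamiltonian in terms of wave functions. -/
theorem mem_Hreg_graph {f : E3 → ℂ} {σ : ℝ} (hσ : 0 < σ)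
    (hg : MemLp (formFactor f σ) 2 volume) {lam : ℂ} {ψ η : SpinFock} :
    (ψ, η) ∈ (Hreg f σ lam).graph ↔ HRel (formFactor f σ) lam ψ η := by
  constructor
  · intro h
    obtain ⟨⟨x, hx⟩, h1, h2⟩ := (LinearPMap.mem_graph_iff _).1 h
    change x = ψ at h1
    subst h1
    obtain ⟨κ, h3, h4⟩ := mem_H0_graph.1 (LinearPMap.mem_graph H0 ⟨x, hx.1⟩)
    obtain ⟨y, rfl⟩ := exists_eq_Gop h3
    refine ⟨κ, TGop hσ hg y, h3, TRel_TGop hσ hg y, fun i => ?_⟩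
    have h5 : TGop hσ hg y = Tint f σ ⟨Gop y, hx.2⟩ :=
      LinearPMap.mem_graph_snd_inj _ ((TRel_TGop hσ hg y).mem_graph hg)
        (LinearPMap.mem_graph (Tint f σ) ⟨Gop y, hx.2⟩) rfl
    change η i = (if i = 0 then (2 : ℂ) else 0) • Gop y i + κ i + lam • TGop hσ hg y i
    refine (congrArg (fun v : SpinFock => v i) h2).symm.trans ?_
    exact congrArg₂ (· + ·) (h4 i) (congrArg (fun v : SpinFock => lam • v i) h5.symm)
  · rintro ⟨κ, θ, h1, h2, h3⟩
    have h4 : (ψ, (WithLp.toLp 2 fun i => (if i = 0 then (2 : ℂ) else 0) • ψ i + κ i : SpinFock)) ∈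
        H0.graph := mem_H0_graph.2 ⟨κ, h1, fun i => rfl⟩
    obtain ⟨⟨x, hx⟩, e1, e2⟩ := (LinearPMap.mem_graph_iff _).1 h4
    obtain ⟨⟨y, hy⟩, e3, e4⟩ := (LinearPMap.mem_graph_iff _).1 (h2.mem_graph hg)
    change x = ψ at e1
    change y = ψ at e3
    subst e1
    subst e3
    refine (LinearPMap.mem_graph_iff _).2 ⟨⟨y, hx, hy⟩, rfl, ?_⟩
    change H0 ⟨y, hx⟩ + lam • Tint f σ ⟨y, hy⟩ = η
    rw [e2, e4]
    ext1 i
    exact (h3 i).symm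

end

/-! ### The Rayleigh–Schrödinger terms as products of unbounded operators -/

section

section Unbounded

variable {X : Type*} [NormedAddCommGroup X] [NormedSpace ℂ X]

theorem mem_graph_everywhere (A : X →L[ℂ] X) (x : X) : (x, A x) ∈ (everywhere A).graph :=
  LinearPMap.mem_graph (everywhere A) ⟨x, Submodule.mem_top⟩

/-- A partial operator whose graph contains that of an everywhere defined operator is equal to
it. -/
theorem eq_everywhere {A : X →ₗ.[ℂ] X} {C : X →L[ℂ] X} (h : ∀ x, (x, C x) ∈ A.graph) :
    A = everywhere C := by
  have hle : everywhere C ≤ A := by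
    refine LinearPMap.le_of_le_graph ?_
    rintro ⟨x, y⟩ hxy
    obtain ⟨⟨x', hx'⟩, h1, h2⟩ := (LinearPMap.mem_graph_iff _).1 hxy
    change x' = x at h1
    subst h1
    have : C x' = y := h2
    rw [← this]
    exact h x'
  refine (LinearPMap.eq_of_le_of_domain_eq hle ?_).symm
  exact (top_le_iff.1 hle.1).symm

theorem mem_graph_pcomp {A B : X →ₗ.[ℂ] X} {x y z : X} (h1 : (x, y) ∈ B.graph)
    (h2 : (y, z) ∈ A.graph) : (x, z) ∈ (pcomp A B).graph := by
  obtain ⟨⟨x', hx⟩, e1, e2⟩ := (LinearPMap.mem_graph_iff _).1 h1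
  obtain ⟨⟨y', hy⟩, e3, e4⟩ := (LinearPMap.mem_graph_iff _).1 h2
  change x' = x at e1
  change y' = y at e3
  subst e1
  subst e3
  change B ⟨x', hx⟩ = y' at e2
  subst e2
  exact (LinearPMap.mem_graph_iff _).2 ⟨⟨x', ⟨⟨⟨x', hx⟩, hy, rfl⟩, hx⟩⟩, rfl, e4⟩

theorem pcomp_everywhere {A : X →ₗ.[ℂ] X} {B C : X →L[ℂ] X} (h : ∀ x, (B x, C x) ∈ A.graph) :
    pcomp A (everywhere B) = everywhere C :=
  eq_everywhere fun x => mem_graph_pcomp (mem_graph_everywhere B x) (h x)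

theorem sum_everywhere {ι : Type*} (s : Finset ι) (A : ι → X →L[ℂ] X) :
    ∑ i ∈ s, everywhere (A i) = everywhere (∑ i ∈ s, A i) := by
  classical
  induction s using Finset.induction_on with
  | empty => rfl
  | insert i s hi ih =>
    rw [Finset.sum_insert hi, Finset.sum_insert hi, ih]
    refine eq_everywhere fun x => ?_
    exact LinearPMap.mem_graph (everywhere (A i) + everywhere (∑ i ∈ s, A i))
      ⟨x, Submodule.mem_top, Submodule.mem_top⟩

end Unbounded

theorem PDown_apply (ψ : SpinFock) : PDown ψ = inner ℂ vacuumDown ψ • vacuumDown :=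
  Submodule.starProjection_unit_singleton ℂ norm_vacuumDown ψ

theorem starProjection_highFock (σ : ℝ) :
    (highFock σ).starProjection = sector (low σ) (measurableSet_low σ) 0 := by
  ext1 ψ
  have hmem : sector (low σ) (measurableSet_low σ) 0 ψ ∈ highFock σ := fun n => ?_
  · refine (Submodule.eq_starProjection_of_mem_of_inner_eq_zero hmem fun φ hφ => ?_)
    have h1 : sector (low σ) (measurableSet_low σ) 0 φ = φ := by
      refine fock_ext fun n => ?_
      filter_upwards [wf_sector (low σ) (measurableSet_low σ) 0 φ n, hφ n] with k h1 h2
      rw [h1]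
      split_ifs with h
      · rfl
      · rw [occ_eq_zero_iff] at h
        push Not at h
        exact (h2 h).symm
    rw [inner_sub_left, ← h1, inner_sector, sector_sector, sub_self]
  · filter_upwards [wf_sector (low σ) (measurableSet_low σ) 0 ψ n] with k h1 ⟨j, hj⟩
    rw [h1, if_neg fun h => (occ_eq_zero_iff _ k).1 h j hj]

theorem Qσ_eq (σ : ℝ) : Qσ σ = everywhere (sectorOp σ 0) := by
  rw [Qσ, starProjection_highFock]
  refine eq_everywhere fun ψ => ?_
  refine (LinearPMap.mem_graph_iff _).2 ⟨⟨ψ, fun _ => Submodule.mem_top⟩, rfl, ?_⟩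
  ext1 i
  change ∑ j, (1 : Matrix (Fin 2) (Fin 2) ℂ) i j • sector (low σ) (measurableSet_low σ) 0 (ψ j) =
    sector (low σ) (measurableSet_low σ) 0 (ψ i)
  rw [Fin.sum_univ_two]
  fin_cases i
  · change (1 : ℂ) • sector (low σ) (measurableSet_low σ) 0 (ψ 0) +
      (0 : ℂ) • sector (low σ) (measurableSet_low σ) 0 (ψ 1) = _
    rw [one_smul, zero_smul, add_zero]
    rfl
  · change (0 : ℂ) • sector (low σ) (measurableSet_low σ) 0 (ψ 0) +
      (1 : ℂ) • sector (low σ) (measurableSet_low σ) 0 (ψ 1) = _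
    rw [one_smul, zero_smul, zero_add]
    rfl

theorem mem_H0_graph_Gop (y : SpinFock) : (Gop y, y - Gop y) ∈ H0.graph :=
  mem_H0_graph.2 ⟨WithLp.toLp 2 fun i => y i - Gop y i - (if i = 0 then (2 : ℂ) else 0) • Gop y i,
    dGammaGraph_Gop y, fun i => by
      change y i - Gop y i =
        _ + (y i - Gop y i - (if i = 0 then (2 : ℂ) else 0) • Gop y i)
      module⟩

/-- The kernel of `H₀` is spanned by the ground state: configurations of momenta with total energy
`0` are negligible unless they are empty. -/
theorem H0_injective {ψ : SpinFock} (h : (ψ, 0) ∈ H0.graph) (h0 : inner ℂ vacuumDown ψ = (0 : ℂ)) :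
    ψ = 0 := by
  obtain ⟨κ, h1, h2⟩ := mem_H0_graph.1 h
  have h3 := wf_inner_smul_vacuumDown ψ
  rw [h0, zero_smul] at h3
  refine spinFock_ext fun i n => ?_
  have h4 : ∀ᵐ k : Conf n, ¬ (i = 1 ∧ n = 0) → energy i k ≠ 0 := by
    rcases eq_or_ne i 0 with rfl | hi
    · refine Filter.Eventually.of_forall fun k _ => ne_of_gt ?_
      rw [energy, if_pos rfl]
      exact add_pos_of_pos_of_nonneg two_pos (Finset.sum_nonneg fun _ _ => norm_nonneg _)
    · cases n with
      | zero => exact Filter.Eventually.of_forall fun k hk => absurd ⟨by omega, rfl⟩ hk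
      | succ n =>
        have h5 : ∀ᵐ k : Conf (n + 1), k 0 ≠ 0 :=
          (quasiMeasurePreserving_apply n 0).ae (Measure.ae_ne volume 0)
        filter_upwards [h5] with k hk _
        refine ne_of_gt ?_
        rw [energy, if_neg hi, zero_add]
        exact (norm_pos_iff.2 hk).trans_le (Finset.single_le_sum (f := fun j => ‖k j‖)
          (fun _ _ => norm_nonneg _) (Finset.mem_univ 0))
  have h5 : (if i = 0 then (2 : ℂ) else 0) • ψ i + κ i = 0 := (h2 i).symm
  have h6 := wf_add ((if i = 0 then (2 : ℂ) else 0) • ψ i) (κ i) n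
  rw [h5] at h6
  filter_upwards [h3 i n, h4, h6, wf_smul (if i = 0 then (2 : ℂ) else 0) (ψ i) n, h1 i n,
    wf_zero n] with k e1 e2 e3 e4 e5 e6
  change _ = wf 0 n k
  rw [e6]
  by_cases h7 : i = 1 ∧ n = 0
  · rw [if_pos h7] at e1
    exact e1.symm.trans e6
  · rw [e6, e4, show wf (κ i) n k = (∑ j, (‖k j‖ : ℂ)) * wf (ψ i) n k from e5, ← add_mul] at e3
    refine (mul_eq_zero.1 e3.symm).resolve_left fun h8 => e2 h7 ?_
    rw [energy]
    split_ifs at h8 ⊢ <;> exact_mod_cast h8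

/-- Away from the ground state `H0inv` inverts `H₀`. The injectivity of the restriction of `H₀` is
needed, as `LinearPMap.inverse` is defined by the reversed graph. -/
theorem mem_H0inv_graph {ψ η : SpinFock} (h : (ψ, η) ∈ H0.graph)
    (h0 : inner ℂ vacuumDown ψ = (0 : ℂ)) : (η, ψ) ∈ H0inv.graph := by
  have hker : LinearMap.ker (H0.domRestrict (ℂ ∙ vacuumDown)ᗮ).toFun = ⊥ := by
    rw [LinearMap.ker_eq_bot']
    rintro ⟨x, hx⟩ hx0
    refine Subtype.ext (H0_injective ?_
      ((Submodule.mem_orthogonal_singleton_iff_inner_right).1 hx.1))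
    exact (LinearPMap.mem_graph_iff _).2 ⟨⟨x, hx.2⟩, rfl, hx0⟩
  obtain ⟨⟨x, hx⟩, e1, e2⟩ := (LinearPMap.mem_graph_iff _).1 h
  change x = ψ at e1
  subst e1
  have := LinearPMap.mem_inverse_graph hker
    ⟨x, Submodule.mem_orthogonal_singleton_iff_inner_right.2 h0, hx⟩
  have e3 : (H0.domRestrict (ℂ ∙ vacuumDown)ᗮ)
      ⟨x, Submodule.mem_orthogonal_singleton_iff_inner_right.2 h0, hx⟩ = η := e2
  rw [e3] at this
  exact this

theorem mem_H0inv_graph_Sop {σ : ℝ} (hσ : 0 < σ) (ψ : SpinFock) :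
    (sectorOp σ 0 ψ - inner ℂ vacuumDown ψ • vacuumDown, Sop hσ ψ) ∈ H0inv.graph := by
  refine mem_H0inv_graph ?_ (inner_vacuumDown_Sop hσ ψ)
  have h := mem_H0_graph_Gop (Sop hσ ψ + sectorOp σ 0 ψ - inner ℂ vacuumDown ψ • vacuumDown)
  rw [← Sop_eq] at h
  convert h using 2
  abel

/-- `H₀^{-ν} (1 - P_{Ω_↓}) Q_σ` is defined everywhere and equal to the power `S^ν`. -/
theorem mem_ppow_graph {σ : ℝ} (hσ : 0 < σ) (ν : ℕ) (ψ : SpinFock) :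
    (sectorOp σ 0 ψ - inner ℂ vacuumDown ψ • vacuumDown, (Sop hσ ^ (ν + 1)) ψ) ∈
      (ppow H0inv (ν + 1)).graph := by
  induction ν with
  | zero =>
    refine mem_graph_pcomp (mem_graph_everywhere _ _) ?_
    rw [zero_add, pow_one]
    exact mem_H0inv_graph_Sop hσ ψ
  | succ ν ih =>
    refine mem_graph_pcomp ih ?_
    have h := mem_H0inv_graph_Sop hσ ((Sop hσ ^ (ν + 1)) ψ)
    have e : (Sop hσ ^ (ν + 1)) ψ = Sop hσ ((Sop hσ ^ ν) ψ) := by rw [pow_succ']; rfl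
    have e1 : sectorOp σ 0 ((Sop hσ ^ (ν + 1)) ψ) = (Sop hσ ^ (ν + 1)) ψ := by
      rw [e, sectorOp_Sop]
    have e2 : inner ℂ vacuumDown ((Sop hσ ^ (ν + 1)) ψ) = (0 : ℂ) := by
      rw [e, inner_vacuumDown_Sop]
    rw [e1, e2, zero_smul, sub_zero] at h
    have e3 : (Sop hσ ^ (ν + 1 + 1)) ψ = Sop hσ ((Sop hσ ^ (ν + 1)) ψ) := by rw [pow_succ']; rfl
    rw [e3]
    exact h

variable {f : E3 → ℂ} {σ : ℝ} (hσ : 0 < σ) (hg : MemLp (formFactor f σ) 2 volume)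

/-- The reduced resolvents are bounded and everywhere defined. -/
theorem reducedResolvent_eq (ν : ℕ) :
    reducedResolvent σ ν = everywhere (Gop * (gapData hσ hg).V ν) := by
  cases ν with
  | zero =>
    refine eq_everywhere fun ψ => ?_
    have e : (Gop * (gapData hσ hg).V 0) ψ = (-PDown) ψ := by
      change Gop (-(inner ℂ vacuumDown ψ • vacuumDown)) = -PDown ψ
      rw [PDown_apply, map_neg, map_smul, Gop_vacuumDown]
    rw [e]
    exact mem_graph_everywhere _ ψ
  | succ ν =>
    refine eq_everywhere fun ψ => ?_
    have e1 : (Gop * (gapData hσ hg).V (ν + 1)) ψ = (Sop hσ ^ (ν + 1)) ψ := by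
      rw [pow_succ']
      exact (Sop_eq hσ ((Sop hσ ^ ν) ψ)).symm
    rw [e1]
    refine mem_graph_pcomp (y := sectorOp σ 0 ψ - inner ℂ vacuumDown ψ • vacuumDown) ?_
      (mem_ppow_graph hσ ν ψ)
    rw [Qσ_eq]
    refine mem_graph_pcomp (mem_graph_everywhere _ ψ) ?_
    have e2 : sectorOp σ 0 ψ - inner ℂ vacuumDown ψ • vacuumDown =
        (ContinuousLinearMap.id ℂ SpinFock - PDown) (sectorOp σ 0 ψ) := by
      change _ = sectorOp σ 0 ψ - PDown (sectorOp σ 0 ψ)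
      rw [PDown_apply, ← sectorOp_symm, sectorOp_vacuumDown]
    rw [e2]
    exact mem_graph_everywhere _ _

/-- The products of reduced resolvents and interactions are bounded and everywhere defined, because
`T_σ` is defined on the range of `(H₀ + 1)⁻¹`. -/
theorem rsTerm_eq (n : ℕ) (ν : Fin (n + 1) → ℕ) :
    rsTerm f σ n ν = everywhere (Gop * (gapData hσ hg).vprod n ν) := by
  induction n with
  | zero => exact reducedResolvent_eq hσ hg (ν 0)
  | succ n ih =>
    rw [rsTerm, ih, pcomp_everywhere (C := TGop hσ hg * (gapData hσ hg).vprod n (Fin.tail ν))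
      fun x => (TRel_TGop hσ hg _).mem_graph hg, reducedResolvent_eq hσ hg]
    exact pcomp_everywhere fun x => mem_graph_everywhere _ _

/-- The Rayleigh–Schrödinger coefficients are the coefficients of the power series of the
eigenprojection. -/
theorem rsCoefficient_eq (n : ℕ) :
    rsCoefficient f σ n = everywhere ((gapData hσ hg).Pc n) := by
  rw [rsCoefficient]
  simp only [rsTerm_eq hσ hg]
  rw [sum_everywhere, ← Finset.mul_sum]
  rfl

end

/-! ### States with particles below the cutoff -/

section

theorem spinFock_enorm_sq (ψ : SpinFock) : ‖ψ‖ₑ ^ 2 = ∑ i, ‖ψ i‖ₑ ^ 2 := by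
  simp only [enorm_sq_eq_ofReal]
  rw [spinFock_norm_sq, ENNReal.ofReal_sum_of_nonneg fun _ _ => sq_nonneg _]

theorem tsum_enorm_sectorOp_sq (σ : ℝ) (ψ : SpinFock) :
    ∑' m, ‖sectorOp σ m ψ‖ₑ ^ 2 = ‖ψ‖ₑ ^ 2 := by
  simp only [spinFock_enorm_sq, Fin.sum_univ_two]
  rw [ENNReal.tsum_add, ← tsum_enorm_sector_sq (low σ) (measurableSet_low σ) (ψ 0),
    ← tsum_enorm_sector_sq (low σ) (measurableSet_low σ) (ψ 1)]
  rfl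

theorem sectorOp_apply (σ : ℝ) (m : ℕ) (ψ : SpinFock) (i : Fin 2) :
    sectorOp σ m ψ i = sector (low σ) (measurableSet_low σ) m (ψ i) := rfl

variable {f : E3 → ℂ} {σ : ℝ} {lam : ℂ}

/-- The Hamiltonian preserves the number of particles below the cutoff. -/
theorem HRel.sectorOp {ψ η : SpinFock} (h : HRel (formFactor f σ) lam ψ η) (m : ℕ) :
    HRel (formFactor f σ) lam (sectorOp σ m ψ) (sectorOp σ m η) := by
  obtain ⟨κ, θ, h1, h2, h3⟩ := h
  refine ⟨SpinBoson.sectorOp σ m κ, SpinBoson.sectorOp σ m θ,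
    fun i => dGammaGraph_sector (h1 i) _ _ _,
    fun i => (h2 i).sector (measurableSet_low σ) (fun k hk => formFactor_low f hk) m, fun i => ?_⟩
  rw [sectorOp_apply, h3, map_add, map_add, map_smul, map_smul]
  rfl

/-- Pulling a soft particle of momentum `q` through the Hamiltonian: the fibers satisfy
`(H + |q|) a_q ψ = a_q H ψ`. -/
theorem HRel.ae_fiber {ψ η : SpinFock} (h : HRel (formFactor f σ) lam ψ η) {m : ℕ}
    (hψ : SpinBoson.sectorOp σ (m + 1) ψ = ψ) (hη : SpinBoson.sectorOp σ (m + 1) η = η) :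
    ∀ᵐ q ∂(volume.restrict (low σ)), ∃ u v : SpinFock, (∀ i, IsFiber q (ψ i) (u i)) ∧
      (∀ i, IsFiber q (η i) (v i)) ∧ HRel (formFactor f σ) lam u (v - (‖q‖ : ℂ) • u) ∧
      SpinBoson.sectorOp σ m u = u ∧ SpinBoson.sectorOp σ m v = v := by
  obtain ⟨κ, θ, h1, h2, h3⟩ := h
  choose a b ha hb hθ using h2
  have hB := measurableSet_low σ
  have hgB : ∀ k ∈ low σ, formFactor f σ k = 0 := fun k hk => formFactor_low f hk
  have hψ' : ∀ i, sector (low σ) hB (m + 1) (ψ i) = ψ i := fun i =>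
    congrArg (fun x : SpinFock => x i) hψ
  have hη' : ∀ i, sector (low σ) hB (m + 1) (η i) = η i := fun i =>
    congrArg (fun x : SpinFock => x i) hη
  set κ' : Fin 2 → Fock := fun i => sector (low σ) hB (m + 1) (κ i) with hκ'
  set a' : Fin 2 → Fock := fun i => sector (low σ) hB (m + 1) (a i) with ha'
  set b' : Fin 2 → Fock := fun i => sector (low σ) hB (m + 1) (b i) with hb'
  set e : Fin 2 → ℂ := fun i => if i = 0 then 2 else 0 with he
  set s : ℂ := ((4 * Real.pi : ℝ) : ℂ)⁻¹ with hs
  have r1 : ∀ i, (ψ i, κ' i) ∈ dGammaGraph fun k => (‖k‖ : ℂ) := fun i => by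
    have := dGammaGraph_sector (h1 i) (low σ) hB (m + 1)
    rwa [hψ'] at this
  have r2 : ∀ i, CreRel (formFactor f σ) (ψ (flip i)) (a' i) := fun i => by
    have := (ha i).sector hB hgB (m + 1)
    rwa [hψ'] at this
  have r3 : ∀ i, AnnRel (formFactor f σ) (ψ (flip i)) (b' i) := fun i => by
    have := (hb i).sector hB hgB (m + 1)
    rwa [hψ'] at this
  have r4 : ∀ i, η i = (e i • ψ i + κ' i) + lam • s • (a' i + b' i) := fun i => by
    rw [← hη', h3, hθ]
    simp only [map_add, map_smul, hψ', hκ', ha', hb']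
    rfl
  have hex : ∀ F : Fin 2 → Fock, (∀ i, sector (low σ) hB (m + 1) (F i) = F i) →
      ∀ᵐ q ∂(volume.restrict (low σ)), ∀ i, ∃ u, IsFiber q (F i) u := fun F hF =>
    ae_all_iff.2 fun i => ae_exists_isFiber hB (hF i)
  have hall : ∀ {p : Fin 2 → E3 → Prop}, (∀ i, ∀ᵐ q, p i q) →
      ∀ᵐ q ∂(volume.restrict (low σ)), ∀ i, p i q := fun hp =>
    ae_restrict_of_ae (ae_all_iff.2 hp)
  filter_upwards [hex ψ hψ', hex κ' fun i => sector_sector _ _ _ _,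
    hex a' fun i => sector_sector _ _ _ _, hex b' fun i => sector_sector _ _ _ _,
    hall fun i => ae_isFiber_dGamma (r1 i), hall fun i => ae_isFiber_creRel (r2 i),
    hall fun i => ae_isFiber_annRel (r3 i), hall fun i => ae_isFiber_sector hB (hψ' i),
    hall fun i => ae_isFiber_sector hB (hη' i), hall fun i => ae_isFiber_smul (e i) (ψ i),
    hall fun i => ae_isFiber_add (e i • ψ i) (κ' i), hall fun i => ae_isFiber_add (a' i) (b' i),
    hall fun i => ae_isFiber_smul s (a' i + b' i),
    hall fun i => ae_isFiber_smul lam (s • (a' i + b' i)),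
    hall fun i => ae_isFiber_add (e i • ψ i + κ' i) (lam • s • (a' i + b' i)),
    ae_restrict_mem hB] with q e1 e2 e3 e4 e5 e6 e7 e8 e9 e10 e11 e12 e13 e14 e15 hq
  choose u hu using e1
  choose w hw using e2
  choose x hx using e3
  choose y hy using e4
  have hv : ∀ i, IsFiber q (η i) ((e i • u i + w i) + lam • s • (x i + y i)) := fun i => by
    rw [r4]
    exact e15 i _ _ (e11 i _ _ (e10 i _ (hu i)) (hw i))
      (e14 i _ (e13 i _ (e12 i _ _ (hx i) (hy i))))
  refine ⟨WithLp.toLp 2 u, WithLp.toLp 2 fun i => (e i • u i + w i) + lam • s • (x i + y i), hu,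
    hv, ⟨WithLp.toLp 2 fun i => w i - (‖q‖ : ℂ) • u i,
      WithLp.toLp 2 fun i => s • (x i + y i), fun i => e5 i _ _ (hu i) (hw i),
      fun i => ⟨x i, y i, e6 i (hgB q hq) _ _ (hu (flip i)) (hx i),
        e7 i _ _ (hu (flip i)) (hy i), rfl⟩, fun i => ?_⟩, ?_, ?_⟩
  · change (e i • u i + w i) + lam • s • (x i + y i) - (‖q‖ : ℂ) • u i =
      e i • u i + (w i - (‖q‖ : ℂ) • u i) + lam • s • (x i + y i)
    module
  · ext1 i
    exact e8 i hq _ (hu i)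
  · ext1 i
    exact e9 i hq _ (hv i)

theorem lintegral_sum_fiberSq {m : ℕ} {ψ : SpinFock} (hψ : sectorOp σ (m + 1) ψ = ψ) :
    ∫⁻ q in low σ, ∑ i, fiberSq (ψ i) q = (m + 1 : ℕ) * ‖ψ‖ₑ ^ 2 := by
  rw [lintegral_finsetSum _ fun i _ => measurable_fiberSq _, spinFock_enorm_sq, Finset.mul_sum]
  exact Finset.sum_congr rfl fun i _ => lintegral_fiberSq_sector (measurableSet_low σ)
    (congrArg (fun x : SpinFock => x i) hψ)

/-- Lower bounds for all fibers give a lower bound, since `∫ ‖a_q ψ‖² dq` over the momenta below the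
cutoff is the number of these particles times `‖ψ‖²`. The last premise of `H` passes an eigenvalue
equation on to the fibers. -/
theorem HRel.le_of_fiber {ψ η : SpinFock} (h : HRel (formFactor f σ) lam ψ η) {m : ℕ}
    (hψ : SpinBoson.sectorOp σ (m + 1) ψ = ψ) (hη : SpinBoson.sectorOp σ (m + 1) η = η)
    (z : ℂ) {d K : ℝ} (hd : 0 ≤ d) (hK : 0 ≤ K)
    (H : ∀ (q : E3) (u v : SpinFock), q ≠ 0 →
      HRel (formFactor f σ) lam u (v - (‖q‖ : ℂ) • u) → SpinBoson.sectorOp σ m u = u →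
      SpinBoson.sectorOp σ m v = v → (η = z • ψ → v = z • u) → d * ‖u‖ ≤ K * ‖v - z • u‖) :
    d * ‖ψ‖ ≤ K * ‖η - z • ψ‖ := by
  have hall : ∀ {p : Fin 2 → E3 → Prop}, (∀ i, ∀ᵐ q, p i q) →
      ∀ᵐ q ∂(volume.restrict (low σ)), ∀ i, p i q := fun hp =>
    ae_restrict_of_ae (ae_all_iff.2 hp)
  have h1 : ∀ᵐ q ∂(volume.restrict (low σ)),
      ENNReal.ofReal d ^ 2 * ∑ i, fiberSq (ψ i) q ≤
        ENNReal.ofReal K ^ 2 * ∑ i, fiberSq ((η - z • ψ) i) q := by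
    filter_upwards [h.ae_fiber hψ hη, ae_restrict_of_ae (Measure.ae_ne volume (0 : E3)),
      hall fun i => ae_isFiber_smul (-z) (ψ i), hall fun i => ae_isFiber_smul z (ψ i),
      hall fun i => ae_isFiber_add (η i) (-z • ψ i)] with q ⟨u, v, hu, hv, hH, su, sv⟩ hq e1 e2 e3
    have hw : ∀ i, IsFiber q ((η - z • ψ) i) ((v - z • u) i) := fun i => by
      have h4 : (η - z • ψ) i = η i + -z • ψ i := by
        change η i - z • ψ i = _
        module
      have h5 : (v - z • u) i = v i + -z • u i := by
        change v i - z • u i = _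
        module
      rw [h4, h5]
      exact e3 i _ _ (hv i) (e1 i _ (hu i))
    have h6 := H q u v hq hH su sv fun h7 => by
      ext1 i
      have h8 := hv i
      rw [h7] at h8
      exact h8.unique (e2 i _ (hu i))
    have h9 : ∑ i, fiberSq (ψ i) q = ‖u‖ₑ ^ 2 := by
      rw [spinFock_enorm_sq]
      exact Finset.sum_congr rfl fun i _ => (hu i).enorm_sq.symm
    have h10 : ∑ i, fiberSq ((η - z • ψ) i) q = ‖v - z • u‖ₑ ^ 2 := by
      rw [spinFock_enorm_sq]
      exact Finset.sum_congr rfl fun i _ => (hw i).enorm_sq.symm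
    rw [h9, h10, ← mul_pow, ← mul_pow, ← ofReal_norm, ← ofReal_norm, ← ENNReal.ofReal_mul hd,
      ← ENNReal.ofReal_mul hK]
    exact pow_le_pow_left₀ zero_le (ENNReal.ofReal_le_ofReal h6) 2
  have h2 := lintegral_mono_ae h1
  have hηψ : SpinBoson.sectorOp σ (m + 1) (η - z • ψ) = η - z • ψ := by
    rw [map_sub, map_smul, hψ, hη]
  rw [lintegral_const_mul _ (Finset.measurable_fun_sum _ fun i _ => measurable_fiberSq _),
    lintegral_const_mul _ (Finset.measurable_fun_sum _ fun i _ => measurable_fiberSq _),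
    lintegral_sum_fiberSq hψ, lintegral_sum_fiberSq hηψ, mul_left_comm, mul_left_comm (_ ^ 2),
    ENNReal.mul_le_mul_iff_right (by simp) (ENNReal.natCast_ne_top _), ← mul_pow, ← mul_pow,
    ← ofReal_norm, ← ofReal_norm, ← ENNReal.ofReal_mul hd, ← ENNReal.ofReal_mul hK] at h2
  have h3 := (ENNReal.pow_le_pow_left_iff two_ne_zero).1 h2
  exact (ENNReal.ofReal_le_ofReal_iff (by positivity)).1 h3

/-- A lower bound for `H - z` on the states without soft particles extends to all sectors, as a soft
particle of momentum `q` shifts the energy by `|q|`. -/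
theorem HRel.lower_bound_sector {e : ℝ} (H : ∀ z : ℂ, z.re < e → ∀ ψ η,
      HRel (formFactor f σ) lam ψ η → SpinBoson.sectorOp σ 0 ψ = ψ →
        (e - z.re) * ‖ψ‖ ≤ 4 * ‖η - z • ψ‖) (m : ℕ) :
    ∀ z : ℂ, z.re < e → ∀ ψ η, HRel (formFactor f σ) lam ψ η →
      SpinBoson.sectorOp σ m ψ = ψ → SpinBoson.sectorOp σ m η = η →
        (e - z.re) * ‖ψ‖ ≤ 4 * ‖η - z • ψ‖ := by
  induction m with
  | zero => exact fun z hz ψ η h hψ _ => H z hz ψ η h hψ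
  | succ m ih =>
    intro z hz ψ η h hψ hη
    refine h.le_of_fiber hψ hη z (by linarith) (by norm_num) fun q u v _ hu su sv _ => ?_
    have h0 : (z - (‖q‖ : ℂ)).re = z.re - ‖q‖ := by simp
    have h1 := ih (z - (‖q‖ : ℂ)) (by rw [h0]; linarith [norm_nonneg q]) u _ hu su
      (by rw [map_sub, map_smul, su, sv])
    have h2 : v - (‖q‖ : ℂ) • u - (z - (‖q‖ : ℂ)) • u = v - z • u := by module
    rw [h2, h0] at h1
    nlinarith [norm_nonneg q, norm_nonneg u, mul_nonneg (norm_nonneg q) (norm_nonneg u)]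

/-- The sectors are orthogonal and preserved by the Hamiltonian, so that a lower bound on each of
them is a lower bound on the whole space. -/
theorem HRel.lower_bound {e : ℝ} (H : ∀ z : ℂ, z.re < e → ∀ ψ η,
      HRel (formFactor f σ) lam ψ η → SpinBoson.sectorOp σ 0 ψ = ψ →
        (e - z.re) * ‖ψ‖ ≤ 4 * ‖η - z • ψ‖) {z : ℂ} (hz : z.re < e) {ψ η : SpinFock}
    (h : HRel (formFactor f σ) lam ψ η) : (e - z.re) * ‖ψ‖ ≤ 4 * ‖η - z • ψ‖ := by
  have hd : 0 ≤ e - z.re := by linarith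
  have h4 : (0 : ℝ) ≤ 4 := by norm_num
  have h1 : ENNReal.ofReal (e - z.re) ^ 2 * ‖ψ‖ₑ ^ 2 ≤
      ENNReal.ofReal 4 ^ 2 * ‖η - z • ψ‖ₑ ^ 2 := by
    rw [← tsum_enorm_sectorOp_sq σ ψ, ← tsum_enorm_sectorOp_sq σ (η - z • ψ),
      ← ENNReal.tsum_mul_left, ← ENNReal.tsum_mul_left]
    refine ENNReal.tsum_le_tsum fun m => ?_
    have h2 := HRel.lower_bound_sector H m z hz _ _ (h.sectorOp m) (sectorOp_sectorOp σ m ψ)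
      (sectorOp_sectorOp σ m η)
    rw [← map_smul, ← map_sub] at h2
    rw [← mul_pow, ← mul_pow, ← ofReal_norm, ← ofReal_norm, ← ENNReal.ofReal_mul hd,
      ← ENNReal.ofReal_mul h4]
    exact pow_le_pow_left₀ zero_le (ENNReal.ofReal_le_ofReal h2) 2
  rw [← mul_pow, ← mul_pow, ← ofReal_norm, ← ofReal_norm, ← ENNReal.ofReal_mul hd,
    ← ENNReal.ofReal_mul h4] at h1
  have h3 := (ENNReal.pow_le_pow_left_iff two_ne_zero).1 h1
  exact (ENNReal.ofReal_le_ofReal_iff (by positivity)).1 h3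

/-- An eigenvector at the bottom of the spectrum contains no soft particles. -/
theorem HRel.sectorOp_zero_eq {e : ℂ} (H : ∀ z : ℂ, z.re < e.re → ∀ ψ η,
      HRel (formFactor f σ) lam ψ η → SpinBoson.sectorOp σ 0 ψ = ψ →
        (e.re - z.re) * ‖ψ‖ ≤ 4 * ‖η - z • ψ‖) {ψ : SpinFock}
    (h : HRel (formFactor f σ) lam ψ (e • ψ)) : SpinBoson.sectorOp σ 0 ψ = ψ := by
  -- A fiber would be an eigenvector with the eigenvalue `e - |q|`, to the left of `e`.
  have h1 : ∀ m, SpinBoson.sectorOp σ (m + 1) ψ = 0 := fun m => by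
    have h2 := h.sectorOp (m + 1)
    rw [map_smul] at h2
    have h3 := h2.le_of_fiber (d := 1) (K := 0) (sectorOp_sectorOp σ _ ψ)
      (by rw [map_smul, sectorOp_sectorOp]) e zero_le_one le_rfl fun q u v hq hu su sv huv => by
        have h4 : v = e • u := huv rfl
        have hq' := norm_pos_iff.2 hq
        have h0 : (e - (‖q‖ : ℂ)).re = e.re - ‖q‖ := by simp
        have h5 := HRel.lower_bound_sector H m (e - (‖q‖ : ℂ)) (by rw [h0]; linarith) u _ hu su
          (by rw [map_sub, map_smul, su, sv])
        rw [h4, sub_smul, sub_self, norm_zero, mul_zero, h0, sub_sub_cancel] at h5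
        have h6 : ‖u‖ ≤ 0 := nonpos_of_mul_nonpos_right h5 hq'
        rw [one_mul, zero_mul]
        exact h6
    rw [one_mul, zero_mul] at h3
    exact norm_le_zero_iff.1 h3
  have h2 := tsum_enorm_sectorOp_sq σ ψ
  rw [tsum_eq_single 0 fun m hm => by
    obtain ⟨m, rfl⟩ := Nat.exists_eq_add_one_of_ne_zero hm
    rw [h1, enorm_zero, zero_pow two_ne_zero]] at h2
  have h3 : ‖SpinBoson.sectorOp σ 0 ψ‖ ^ 2 = ‖ψ‖ ^ 2 := by
    rw [enorm_sq_eq_ofReal, enorm_sq_eq_ofReal] at h2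
    exact (ENNReal.ofReal_eq_ofReal_iff (sq_nonneg _) (sq_nonneg _)).1 h2
  have h4 : ‖ψ - SpinBoson.sectorOp σ 0 ψ‖ ^ 2 = 0 := by
    rw [norm_sub_sq (𝕜 := ℂ)]
    have h5 : (inner ℂ ψ (SpinBoson.sectorOp σ 0 ψ) : ℂ) =
        inner ℂ (SpinBoson.sectorOp σ 0 ψ) (SpinBoson.sectorOp σ 0 ψ) := by
      rw [sectorOp_symm, sectorOp_sectorOp]
    rw [h5, inner_self_eq_norm_sq (𝕜 := ℂ), h3]
    ring
  exact (sub_eq_zero.1 (norm_eq_zero.1 (pow_eq_zero_iff two_ne_zero |>.1 h4))).symm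

end

/-! ### The spectrum of the Hamiltonian -/

section

variable {f : E3 → ℂ} {σ : ℝ} (hσ : 0 < σ) (hg : MemLp (formFactor f σ) 2 volume)

theorem Hreg_apply_Gop (lam z : ℂ) (y : SpinFock) : ∃ h : Gop y ∈ (Hreg f σ lam).domain,
    Hreg f σ lam ⟨Gop y, h⟩ - z • Gop y = (gapData hσ hg).Hz lam z y := by
  obtain ⟨⟨x, hx⟩, h1, h2⟩ := (LinearPMap.mem_graph_iff _).1
    ((mem_Hreg_graph hσ hg).2 (HRel_Gop hσ hg lam y))
  change x = Gop y at h1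
  subst h1
  refine ⟨hx, ?_⟩
  rw [h2, GapData.Hz_eq _ lam z]
  rfl

theorem exists_Gop_of_mem_domain {lam : ℂ} (x : (Hreg f σ lam).domain) :
    ∃ y, (x : SpinFock) = Gop y ∧
      ∀ z : ℂ, Hreg f σ lam x - z • (x : SpinFock) = (gapData hσ hg).Hz lam z y := by
  obtain ⟨y, h1, -⟩ := ((mem_Hreg_graph hσ hg).1 (LinearPMap.mem_graph _ x)).exists_eq hσ hg
  obtain ⟨x, hx⟩ := x
  change x = Gop y at h1
  subst h1
  exact ⟨y, rfl, fun z => (Hreg_apply_Gop hσ hg lam z y).2⟩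

variable {ρ : ℝ} {lam : ℂ}

/-- The lower bound of the abstract perturbation theory, on the states without soft particles. -/
theorem lower_bound_no_soft {hσ : 0 < σ} {hg : MemLp (formFactor f σ) 2 volume}
    (h : (gapData hσ hg).Small ρ lam) (z : ℂ) (hz : z.re < ((gapData hσ hg).E lam).re)
    (ψ η : SpinFock) (hH : HRel (formFactor f σ) lam ψ η) (hψ : sectorOp σ 0 ψ = ψ) :
    (((gapData hσ hg).E lam).re - z.re) * ‖ψ‖ ≤ 4 * ‖η - z • ψ‖ := by
  obtain ⟨y, rfl, rfl⟩ := hH.exists_eq hσ hg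
  have h1 := h.lower_bound hz hψ
  rw [GapData.Hz_eq] at h1
  exact h1

theorem mem_eigenspace_iff {z : ℂ} {ψ : SpinFock} :
    ψ ∈ eigenspace (Hreg f σ lam) z ↔ (ψ, z • ψ) ∈ (Hreg f σ lam).graph := by
  rw [LinearPMap.mem_graph_iff]
  constructor
  · rintro ⟨hd, e⟩
    exact ⟨⟨ψ, hd⟩, rfl, e⟩
  · rintro ⟨⟨x, hx⟩, h1, h2⟩
    change x = ψ at h1
    subst h1
    exact ⟨hx, h2⟩

/-- The eigenspace is the range of the eigenprojection. For the inclusion of the eigenspace, its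
vectors are first shown to contain no soft particles. -/
theorem eigenspace_eq_range {hσ : 0 < σ} {hg : MemLp (formFactor f σ) 2 volume}
    (h : (gapData hσ hg).Small ρ lam) :
    LinearMap.range ((gapData hσ hg).P lam : SpinFock →ₗ[ℂ] SpinFock) =
      eigenspace (Hreg f σ lam) ((gapData hσ hg).E lam) := by
  ext ψ
  constructor
  · rintro ⟨x, rfl⟩
    obtain ⟨hd, e⟩ := Hreg_apply_Gop hσ hg lam ((gapData hσ hg).E lam) ((gapData hσ hg).P1 lam x)
    rw [h.Hz_P1, sub_self, zero_smul, sub_eq_zero] at e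
    have e1 : (gapData hσ hg).P lam x = Gop ((gapData hσ hg).P1 lam x) :=
      h.adm.P_eq h.lt x
    change (gapData hσ hg).P lam x ∈ _
    rw [e1]
    exact ⟨hd, e⟩
  · intro hψ
    have h1 := (mem_Hreg_graph hσ hg).1 (mem_eigenspace_iff.1 hψ)
    have h2 := HRel.sectorOp_zero_eq (lower_bound_no_soft h) h1
    obtain ⟨y, h3, h4⟩ := h1.exists_eq hσ hg
    refine ⟨ψ, ?_⟩
    rw [h3] at h2 h4 ⊢
    refine h.P_eq_self h2 ?_
    rw [GapData.Hz_eq, ← h4]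
    exact sub_self _

theorem isNondegenerateEigenvalue {hσ : 0 < σ} {hg : MemLp (formFactor f σ) 2 volume}
    (h : (gapData hσ hg).Small ρ lam) :
    IsNondegenerateEigenvalue (Hreg f σ lam) ((gapData hσ hg).E lam) := by
  have h1 : eigenspace (Hreg f σ lam) ((gapData hσ hg).E lam) =
      ℂ ∙ ((gapData hσ hg).P lam vacuumDown) := by
    rw [← eigenspace_eq_range h]
    refine le_antisymm ?_ ?_
    · rintro _ ⟨x, rfl⟩
      have h2 := h.eq_smul (DFunLike.congr_fun (h.adm.P_idem h.lt) x)
      exact Submodule.mem_span_singleton.2 ⟨_, h2.symm⟩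
    · rw [Submodule.span_singleton_le_iff_mem]
      exact ⟨_, rfl⟩
  rw [IsNondegenerateEigenvalue, h1]
  exact finrank_span_singleton h.P_Ω_ne_zero

theorem isEigenprojection {hσ : 0 < σ} {hg : MemLp (formFactor f σ) 2 volume}
    (h : (gapData hσ hg).Small ρ lam) :
    IsEigenprojection (Hreg f σ lam) ((gapData hσ hg).E lam) ((gapData hσ hg).P lam) := by
  refine ⟨h.adm.P_idem h.lt, eigenspace_eq_range h, fun x => ?_⟩
  obtain ⟨y, h1, h2⟩ := exists_Gop_of_mem_domain hσ hg x
  have h3 : (gapData hσ hg).P lam x ∈ eigenspace (Hreg f σ lam) ((gapData hσ hg).E lam) := by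
    rw [← eigenspace_eq_range h]
    exact ⟨_, rfl⟩
  obtain ⟨hd, e⟩ := h3
  refine ⟨hd, ?_⟩
  have h4 := h2 0
  rw [zero_smul, sub_zero] at h4
  rw [e, h4, h.P_Hz, sub_zero, h1]
  rfl

/-- `H_{λ,σ} + 1 = (1 + λ T_σ (H₀ + 1)⁻¹) (H₀ + 1)` is invertible for small `λ`. -/
theorem neg_one_mem_resolventSet {hσ : 0 < σ} {hg : MemLp (formFactor f σ) 2 volume}
    (h : ‖lam • (gapData hσ hg).TG‖ < 1) : (-1 : ℂ) ∈ resolventSet (Hreg f σ lam) := by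
  have hu : IsUnit (1 + lam • (gapData hσ hg).TG) := by
    have := isUnit_one_sub_of_norm_lt_one (x := -(lam • (gapData hσ hg).TG)) (by rwa [norm_neg])
    rwa [sub_neg_eq_add] at this
  have hHz : ∀ y, (gapData hσ hg).Hz lam (-1) y = (1 + lam • (gapData hσ hg).TG) y := fun y => by
    change y + lam • (gapData hσ hg).TG y - Gop y - (-1 : ℂ) • Gop y =
      y + lam • (gapData hσ hg).TG y
    module
  refine ⟨Gop * Ring.inverse (1 + lam • (gapData hσ hg).TG), fun x => ?_, fun x => ?_⟩
  · obtain ⟨hd, e⟩ := Hreg_apply_Gop hσ hg lam (-1)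
      (Ring.inverse (1 + lam • (gapData hσ hg).TG) x)
    refine ⟨hd, e.trans ?_⟩
    rw [hHz]
    exact DFunLike.congr_fun (Ring.mul_inverse_cancel _ hu) x
  · obtain ⟨y, h1, h2⟩ := exists_Gop_of_mem_domain hσ hg x
    rw [h2, hHz, h1]
    exact congrArg Gop (DFunLike.congr_fun (Ring.inverse_mul_cancel _ hu) y)

/-- The open half plane to the left of the eigenvalue belongs to the resolvent set. -/
theorem setOf_re_lt_subset_resolventSet {hσ : 0 < σ} {hg : MemLp (formFactor f σ) 2 volume}
    (h : (gapData hσ hg).Small ρ lam) :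
    {z : ℂ | z.re < ((gapData hσ hg).E lam).re} ⊆ resolventSet (Hreg f σ lam) := by
  refine subset_resolventSet (convex_halfSpace_re_lt _).isPreconnected
    (isOpen_lt Complex.continuous_re continuous_const)
    (m := fun z => (((gapData hσ hg).E lam).re - z.re) / 4)
    ((continuous_const.sub Complex.continuous_re).div_const _)
    (fun z hz => by linarith [show z.re < _ from hz]) (fun z hz x => ?_) (z₁ := -1)
    (by simpa using h.lt_re_E) (neg_one_mem_resolventSet h.norm_lt)
  have h1 := HRel.lower_bound (lower_bound_no_soft h) hz
    ((mem_Hreg_graph hσ hg).1 (LinearPMap.mem_graph _ x))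
  linarith

/-- For real couplings the Hamiltonian is self-adjoint, so that its spectrum is real. -/
theorem im_eq_zero_of_mem_spectrum {t : ℝ} {hσ : 0 < σ}
    {hg : MemLp (formFactor f σ) 2 volume} (h : (gapData hσ hg).Small ρ (t : ℂ)) {z : ℂ}
    (hz : z ∈ spectrum (Hreg f σ t)) : z.im = 0 := by
  have hb : ∀ (w : ℂ) (x : (Hreg f σ (t : ℂ)).domain),
      |w.im| * ‖(x : SpinFock)‖ ≤ ‖Hreg f σ t x - w • (x : SpinFock)‖ := fun w x => by
    obtain ⟨y, h1, h2⟩ := exists_Gop_of_mem_domain hσ hg x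
    rw [h2, h1]
    exact GapData.abs_im_mul_norm_le (D := gapData hσ hg) w y
  have hl := setOf_re_lt_subset_resolventSet h
  by_contra h0
  -- A half plane off the real axis meets the half plane to the left of `E`, at real part `-1`.
  have key : ∀ s : Set ℂ, Convex ℝ s → IsOpen s → (∀ w ∈ s, w.im ≠ 0) → ∀ w ∈ s, w.re = -1 →
      s ⊆ resolventSet (Hreg f σ t) := fun s hs hso hs0 w hw hre =>
    subset_resolventSet hs.isPreconnected hso (m := fun w => |w.im|) Complex.continuous_im.abs
      (fun w hw => abs_pos.2 (hs0 w hw)) (fun w _ x => hb w x) hw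
      (hl (hre.trans_lt h.lt_re_E))
  rcases lt_or_gt_of_ne h0 with h1 | h1
  · exact hz (key {w | w.im < 0} (convex_halfSpace_im_lt 0)
      (isOpen_lt Complex.continuous_im continuous_const) (fun w hw => ne_of_lt hw)
      (-1 - Complex.I) (by simp) (by simp) h1)
  · exact hz (key {w | 0 < w.im} (convex_halfSpace_im_gt 0)
      (isOpen_lt continuous_const Complex.continuous_im) (fun w hw => ne_of_gt hw)
      (-1 + Complex.I) (by simp) (by simp) h1)

theorem E_mem_spectrum {hσ : 0 < σ} {hg : MemLp (formFactor f σ) 2 volume}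
    (h : (gapData hσ hg).Small ρ lam) : (gapData hσ hg).E lam ∈ spectrum (Hreg f σ lam) := by
  refine mem_spectrum_of_mem_eigenspace ?_ h.P_Ω_ne_zero
  rw [← eigenspace_eq_range h]
  exact ⟨_, rfl⟩

theorem re_E_le_of_mem_spectrum {hσ : 0 < σ} {hg : MemLp (formFactor f σ) 2 volume}
    (h : (gapData hσ hg).Small ρ lam) {z : ℂ} (hz : z ∈ spectrum (Hreg f σ lam)) :
    ((gapData hσ hg).E lam).re ≤ z.re := by
  by_contra! h1
  exact hz (setOf_re_lt_subset_resolventSet h h1)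

end

end SpinBoson

end

theorem mainTheorem6 (f : SpinBoson.E3 → ℂ)
    (hf : MeasureTheory.MemLp (fun k => f k / (Real.sqrt ‖k‖ : ℂ)) 2 MeasureTheory.volume)
    (hf' : MeasureTheory.MemLp (fun k => f k / (‖k‖ : ℂ)) 2 MeasureTheory.volume)
    (σ : ℝ) (hσ : 0 < σ) :
    ∃ lam₀ : ℝ, 0 < lam₀ ∧
    ∃ (E : ℂ → ℂ) (P : ℂ → (SpinBoson.SpinFock →L[ℂ] SpinBoson.SpinFock)),
      -- for each coupling in the disc, a non-degenerate eigenvalue with its eigenprojection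
      (∀ lam ∈ Metric.ball (0 : ℂ) lam₀,
        SpinBoson.IsNondegenerateEigenvalue (SpinBoson.Hreg f σ lam) (E lam) ∧
        SpinBoson.IsEigenprojection (SpinBoson.Hreg f σ lam) (E lam) (P lam)) ∧
      -- (i) bottom of the spectrum: for complex couplings in the sense of real parts,
      (∀ lam ∈ Metric.ball (0 : ℂ) lam₀,
        IsGLB (Complex.re '' SpinBoson.spectrum (SpinBoson.Hreg f σ lam)) (E lam).re) ∧
      -- and for real couplings the spectrum is real and `E` is its infimum
      (∀ t : ℝ, |t| < lam₀ →
        (∀ z ∈ SpinBoson.spectrum (SpinBoson.Hreg f σ t), z.im = 0) ∧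
        (E t).im = 0 ∧
        IsGLB {x : ℝ | (x : ℂ) ∈ SpinBoson.spectrum (SpinBoson.Hreg f σ t)} (E t).re) ∧
      E 0 = 0 ∧
      -- (ii) analyticity (for `P` in operator norm)
      AnalyticOnNhd ℂ E (Metric.ball 0 lam₀) ∧
      AnalyticOnNhd ℂ P (Metric.ball 0 lam₀) ∧
      -- (iii) adjoints
      (∀ lam ∈ Metric.ball (0 : ℂ) lam₀,
        ContinuousLinearMap.adjoint (P lam) = P (starRingEnd ℂ lam)) ∧
      -- the power series of `P` and its coefficients
      ∃ Pc : ℕ → (SpinBoson.SpinFock →L[ℂ] SpinBoson.SpinFock),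
        (∀ lam ∈ Metric.ball (0 : ℂ) lam₀, HasSum (fun n => lam ^ n • Pc n) (P lam)) ∧
        ∀ n, SpinBoson.everywhere (Pc n) = SpinBoson.rsCoefficient f σ n := by
  have hg := SpinBoson.memLp_formFactor hf σ
  obtain ⟨ρ, hρ⟩ := (SpinBoson.gapData hσ hg).exists_admissible
  obtain ⟨δ, hδ, hδρ, hs, hE⟩ := hρ.exists_small
  refine ⟨δ, hδ, (SpinBoson.gapData hσ hg).E, (SpinBoson.gapData hσ hg).P,
    fun lam hl => ⟨SpinBoson.isNondegenerateEigenvalue (hs lam hl),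
      SpinBoson.isEigenprojection (hs lam hl)⟩,
    fun lam hl => IsLeast.isGLB ⟨⟨_, SpinBoson.E_mem_spectrum (hs lam hl), rfl⟩, ?_⟩,
    fun t ht => ?_, SpinBoson.GapData.E_zero _, hE,
    hρ.analyticOnNhd_P.mono (Metric.ball_subset_ball hδρ), fun lam hl => ?_,
    (SpinBoson.gapData hσ hg).Pc, fun lam hl => hρ.hasSum_P (hs lam hl).lt,
    fun n => (SpinBoson.rsCoefficient_eq hσ hg n).symm⟩
  · rintro _ ⟨z, hz, rfl⟩
    exact SpinBoson.re_E_le_of_mem_spectrum (hs lam hl) hz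
  · have ht' := hs (t : ℂ) (by simpa using ht)
    refine ⟨fun z hz => SpinBoson.im_eq_zero_of_mem_spectrum ht' hz, ht'.im_E,
      IsLeast.isGLB ⟨?_, fun x hx => SpinBoson.re_E_le_of_mem_spectrum ht' hx⟩⟩
    have h1 := SpinBoson.E_mem_spectrum ht'
    have h2 : ((((SpinBoson.gapData hσ hg).E t).re : ℝ) : ℂ) = (SpinBoson.gapData hσ hg).E t :=
      Complex.ext rfl ht'.im_E.symm
    rw [← h2] at h1
    exact h1
  · have hl' : ‖(starRingEnd ℂ) lam‖ < ρ := by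
      rw [RCLike.norm_conj]
      exact (hs lam hl).lt
    refine ((ContinuousLinearMap.eq_adjoint_iff _ _).2 fun x y => ?_).symm
    rw [hρ.inner_P hl', Complex.conj_conj]
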